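/- Consider the class of equations $$u_t+a(u^n)_x=g(t)u_{xx},\qquad a\neq0,\quad n\in\mathbb R\setminus\{0,1\}, \tag{$*$}$$ where $g$ is a smooth nonvanishing real function on a nonempty open interval $I$. The equation is studied on boxes $(t,x,u)\in I\times X\times J$ with $X,J$ nonempty open intervals such that $u^n$ is well defined and smooth on $J$ ($J\subseteq(0,\infty)$, or $n$ is an integer and $0\notin J$ if $n<0$). Its maximal Lie invariance algebra $A^{\max}$ on a box consists of all smooth vector fields $\Gamma=\tau\partial_t+\xi\partial_x+\theta\partial_u$ on the box, $\tau,\xi,\theta$ depending on $(t,x,u)$, whose second prolongation satisfies $\Gamma^{(2)}\{u_t+anu^{n-1}u_x-g(t)u_{xx}\}=0$ at all second-order jets over the box that satisfy the equation. For $n\ne2$, equations are called equivalent if they are connected by a transformation of the usual equivalence group $G^\sim$: $$\tilde t=\delta_1t+\delta_2,\quad \tilde x=\delta_3x+\delta_4,\quad \tilde u=\delta_5u,\quad \tilde a=\tfrac{\delta_3}{\delta_1}\delta_5^{1-n}a,\quad \tilde g=\tfrac{\delta_3^2}{\delta_1}g,\quad \tilde n=n,\qquad \delta_1\delta_3\delta_5\ne0$$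 ($\delta_5>0$ unless $n$ is an integer). For $n=2$, equations are called equivalent if they are connected by a transformation of the generalized equivalence group $\hat G^\sim_2$: $$\tilde t=\tfrac{\alpha t+\beta}{\gamma t+\delta},\quad \tilde x=\tfrac{\kappa x+\mu_1t+\mu_0}{\gamma t+\delta},\quad \tilde u=\tfrac{\sigma}{2a(\alpha\delta-\beta\gamma)}\bigl(2a\kappa(\gamma t+\delta)u-\kappa\gamma x+\mu_1\delta-\mu_0\gamma\bigr),\quad \tilde a=\tfrac a\sigma,\quad \tilde g=\tfrac{\kappa^2}{\alpha\delta-\beta\gamma}g,$$ where $\alpha\delta-\beta\gamma\neq0$, $\kappa\sigma\ne0$ and $\gamma t+\delta\neq0$ on $I$. In both cases the $t$-interval $I$ is mapped onto the $t$-interval $\tilde I$ of the transformed equation. **Kernel.** Let $a$, $n$ and the box be fixed. The vector fields that are Lie symmetries of $(*)$ for every smooth nonvanishing $g$ on $I$ are those in $\langle\partial_x\rangle$ if $n\neq2$, and those in $\langle\partial_x,\ 2at\partial_x+\partial_u\rangle$ if $n=2$ (that is, $\langle\partial_x,\ t\partial_x+\partial_u\rangle$ when $a=1/2$). **Gauge.**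 Every equation $(*)$ is mapped by a transformation from $G^\sim$ to one with $a=1/n$. **Extensions.** Let $\varepsilon=\pm1$, let $\rho\ne0$ be a constant, and let $a=1/n$. In the following cases (on any $t$-interval on which $g$ is smooth and nonvanishing; for $t^\rho$: $t>0$, or $\rho$ an integer), the listed operators, restricted to the box, form a basis of $A^{\max}$ on every box. * Row 2: $n\ne2$, $g=\varepsilon t^\rho$: $\ \partial_x,\ 2t\partial_t+(\rho+1)x\partial_x+\frac{\rho-1}{n-1}u\partial_u$. * Row 3: $n\ne2$, $g=\varepsilon e^t$: $\ \partial_x,\ 2\partial_t+x\partial_x+\frac1{n-1}u\partial_u$. * Row 4: $n\ne2$, $g=1$: $\ \partial_x,\ \partial_t,\ 2t\partial_t+x\partial_x-\frac1{n-1}u\partial_u$. * Row 6: $n=2$, $g=\varepsilon t^\rho$: $\ \partial_x,\ t\partial_x+\partial_u,\ 2t\partial_t+(\rho+1)x\partial_x+(\rho-1)u\partial_u$. * Row 7: $n=2$, $g=\varepsilon e^t$: $\ \partial_x,\ t\partial_x+\partial_u,\ 2\partial_t+x\partial_x+u\partial_u$. * Row 8: $n=2$, $g=\varepsilon e^{2\rho\arctan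 t}$: $\ \partial_x,\ t\partial_x+\partial_u,\ (t^2+1)\partial_t+(t+\rho)x\partial_x+(x+(\rho-t)u)\partial_u$. * Row 9: $n=2$, $g=1$: $\ \partial_x,\ t\partial_x+\partial_u,\ \partial_t,\ 2t\partial_t+x\partial_x-u\partial_u,\ t^2\partial_t+tx\partial_x+(x-tu)\partial_u$. If an equation is mapped by an equivalence transformation to an equation of one of these rows, then its $A^{\max}$ on any box is the pullback of the algebra listed in the row under that transformation of $(t,x,u)$. **Completeness (Rows 1 and 5, arbitrary $g$).** On every box, $A^{\max}$ of an equation $(*)$ is just the kernel, with basis $\partial_x$ if $n\ne2$ (Row 1) and $\partial_x,\ 2at\partial_x+\partial_u$ if $n=2$ (Row 5), if and only if the equation is not equivalent to an equation of one of the Rows 2–4, 6–9. **Inequivalence.** Equations of different rows among 2–4, 6–9 are not equivalent. Every equation of Row 6 is equivalent to one of Row 6 with $\rho>0$, and to one of Row 6 with $\rho<0$. **Structure.** In Row 9 the five-dimensional algebra $A^{\max}$, with the commutator of vector fields, is isomorphic to $\mathfrak{sl}(2,\mathbb R)\ltimes 2A_1$, where $2A_1$ is the two-dimensional abelian algebra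 on which $\mathfrak{sl}(2,\mathbb R)$ acts by its natural representation on $\mathbb R^2$. -/

import Mathlib

open scoped ContDiff

namespace BurgersLie

noncomputable section

/-! ### The class of equations -/

/-- Nonempty open intervals of the real line, bounded or not. -/
def IsOpenInterval (I : Set ℝ) : Prop :=
  IsOpen I ∧ I.OrdConnected ∧ I.Nonempty

/-- The power `s ↦ s ^ r` is a well-defined smooth real function on `S`: either `S` consists of
positive numbers, or the exponent is an integer and no negative power of `0` is taken. -/
def PowerRegular (r : ℝ) (S : Set ℝ) : Prop :=
  S ⊆ Set.Ioi 0 ∨ ∃ m : ℤ, r = m ∧ (0 ≤ m ∨ (0 : ℝ) ∉ S)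

/-- An equation `u_t + a (u ^ n)_x = g(t) u_xx`, where `a ≠ 0`, `n ≠ 0, 1` and `g` is a smooth
nonvanishing function on the open interval `I` of the `t`-axis. -/
structure Equation where
  a : ℝ
  n : ℝ
  g : ℝ → ℝ
  I : Set ℝ
  a_ne_zero : a ≠ 0
  n_ne_zero : n ≠ 0
  n_ne_one : n ≠ 1
  interval_I : IsOpenInterval I
  smooth_g : ContDiffOn ℝ ∞ g I
  g_ne_zero : ∀ t ∈ I, g t ≠ 0

/-- Points `(t, x, u)`. -/
abbrev Pt := ℝ × ℝ × ℝ

/-- Vector fields; `V p = (τ, ξ, θ)` stands for `τ ∂_t + ξ ∂_x + θ ∂_u` at `p`. -/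
abbrev VF := Pt → Pt

/-- First-order jets `(t, x, u, u_t, u_x)`. -/
abbrev Jet1 := ℝ × ℝ × ℝ × ℝ × ℝ

/-- Second-order jets `(t, x, u, u_t, u_x, u_tt, u_tx, u_xx)`. -/
abbrev Jet2 := ℝ × ℝ × ℝ × ℝ × ℝ × ℝ × ℝ × ℝ

/-- The box `I × X × J` of the space of the variables `(t, x, u)` on which an equation is studied:
`I` is the `t`-interval of the equation, `X` and `J` are open intervals, and `u ^ n` makes sense
for `u ∈ J`. -/
structure Box (E : Equation) where
  X : Set ℝ
  J : Set ℝ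
  interval_X : IsOpenInterval X
  interval_J : IsOpenInterval J
  power_J : PowerRegular E.n J

def Box.dom {E : Equation} (B : Box E) : Set Pt := E.I ×ˢ B.X ×ˢ B.J

/-- `u_t + a n u ^ (n - 1) u_x - g(t) u_xx` as a function on the second-order jet space. -/
def Equation.F (E : Equation) : Jet2 → ℝ := fun (t, _, u, ut, ux, _, _, uxx) =>
  ut + E.a * E.n * u ^ (E.n - 1) * ux - E.g t * uxx

/-! ### Prolongation of vector fields -/

/-- Total derivatives of functions of `(t, x, u)`. -/
def Dt0 (f : Pt → ℝ) : Jet1 → ℝ := fun (t, x, u, ut, _) => fderiv ℝ f (t, x, u) (1, 0, ut)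

def Dx0 (f : Pt → ℝ) : Jet1 → ℝ := fun (t, x, u, _, ux) => fderiv ℝ f (t, x, u) (0, 1, ux)

/-- Total derivatives of functions of `(t, x, u, u_t, u_x)`. -/
def Dt1 (f : Jet1 → ℝ) : Jet2 → ℝ := fun (t, x, u, ut, ux, utt, utx, _) =>
  fderiv ℝ f (t, x, u, ut, ux) (1, 0, ut, utt, utx)

def Dx1 (f : Jet1 → ℝ) : Jet2 → ℝ := fun (t, x, u, ut, ux, _, utx, uxx) =>
  fderiv ℝ f (t, x, u, ut, ux) (0, 1, ux, utx, uxx)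

def tauOf (V : VF) : Pt → ℝ := fun p => (V p).1
def xiOf (V : VF) : Pt → ℝ := fun p => (V p).2.1
def thetaOf (V : VF) : Pt → ℝ := fun p => (V p).2.2

/-- The `∂_{u_t}`-coefficient of the prolongation. -/
def etaT (V : VF) : Jet1 → ℝ := fun (t, x, u, ut, ux) =>
  Dt0 (thetaOf V) (t, x, u, ut, ux) - ut * Dt0 (tauOf V) (t, x, u, ut, ux)
    - ux * Dt0 (xiOf V) (t, x, u, ut, ux)

/-- The `∂_{u_x}`-coefficient of the prolongation. -/
def etaX (V : VF) : Jet1 → ℝ := fun (t, x, u, ut, ux) =>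
  Dx0 (thetaOf V) (t, x, u, ut, ux) - ut * Dx0 (tauOf V) (t, x, u, ut, ux)
    - ux * Dx0 (xiOf V) (t, x, u, ut, ux)

/-- The `∂_{u_tt}`-coefficient of the prolongation. -/
def etaTT (V : VF) : Jet2 → ℝ := fun (t, x, u, ut, ux, utt, utx, uxx) =>
  Dt1 (etaT V) (t, x, u, ut, ux, utt, utx, uxx) - utt * Dt0 (tauOf V) (t, x, u, ut, ux)
    - utx * Dt0 (xiOf V) (t, x, u, ut, ux)

/-- The `∂_{u_tx}`-coefficient of the prolongation. -/
def etaTX (V : VF) : Jet2 → ℝ := fun (t, x, u, ut, ux, utt, utx, uxx) =>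
  Dx1 (etaT V) (t, x, u, ut, ux, utt, utx, uxx) - utt * Dx0 (tauOf V) (t, x, u, ut, ux)
    - utx * Dx0 (xiOf V) (t, x, u, ut, ux)

/-- The `∂_{u_xx}`-coefficient of the prolongation. -/
def etaXX (V : VF) : Jet2 → ℝ := fun (t, x, u, ut, ux, utt, utx, uxx) =>
  Dx1 (etaX V) (t, x, u, ut, ux, utt, utx, uxx) - utx * Dx0 (tauOf V) (t, x, u, ut, ux)
    - uxx * Dx0 (xiOf V) (t, x, u, ut, ux)

/-- The second prolongation of `V`, a vector field on the second-order jet space. -/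
def prolong2 (V : VF) : Jet2 → Jet2 := fun (t, x, u, ut, ux, utt, utx, uxx) =>
  (tauOf V (t, x, u), xiOf V (t, x, u), thetaOf V (t, x, u),
    etaT V (t, x, u, ut, ux), etaX V (t, x, u, ut, ux),
    etaTT V (t, x, u, ut, ux, utt, utx, uxx), etaTX V (t, x, u, ut, ux, utt, utx, uxx),
    etaXX V (t, x, u, ut, ux, utt, utx, uxx))

/-! ### Lie invariance algebras -/

/-- `V` is (the generator of) a Lie point symmetry of `E` on the box `B`: it is smooth there and
satisfies the infinitesimal invariance criterion, i.e. its second prolongation annihilates the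
equation at every second-order jet over the box that satisfies the equation. Only the values of `V`
on the box matter. The maximal Lie invariance algebra of `E` on `B` is the set of all such `V`,
restricted to the box. -/
def IsLieSymmetry (E : Equation) (B : Box E) (V : VF) : Prop :=
  ContDiffOn ℝ ∞ V B.dom ∧
    ∀ t x u ut ux utt utx uxx : ℝ, (t, x, u) ∈ B.dom →
      E.F (t, x, u, ut, ux, utt, utx, uxx) = 0 →
      fderiv ℝ E.F (t, x, u, ut, ux, utt, utx, uxx)
        (prolong2 V (t, x, u, ut, ux, utt, utx, uxx)) = 0

/-- The linear span of a list of vector fields. -/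
def spanOf (b : List VF) : Submodule ℝ VF := Submodule.span ℝ {W | W ∈ b}

/-- The listed vector fields, restricted to the box `B`, form a basis of the maximal Lie invariance
algebra of `E` on `B`. -/
def IsBasisOfMaxAlgebra (E : Equation) (B : Box E) (b : List VF) : Prop :=
  LinearIndependent ℝ (fun i : Fin b.length => B.dom.domRestrict (b.get i)) ∧
    ∀ V : VF, IsLieSymmetry E B V ↔ ∃ W ∈ spanOf b, Set.EqOn V W B.dom

/-! ### Equivalence groups -/

/-- A transformation of the usual equivalence group, with projection `φ` to the space `(t, x, u)`,
maps the equation `E` to the equation `E'`. (For a non-integer `n`, where `u > 0`, the scaling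
factor of `u` is positive.) -/
def UsualEquiv (E E' : Equation) (φ : Pt → Pt) : Prop :=
  ∃ δ₁ δ₂ δ₃ δ₄ δ₅ : ℝ, δ₁ * δ₃ * δ₅ ≠ 0 ∧ (0 < δ₅ ∨ ∃ m : ℤ, E.n = m) ∧
    (∀ t x u : ℝ, φ (t, x, u) = (δ₁ * t + δ₂, δ₃ * x + δ₄, δ₅ * u)) ∧
    E'.n = E.n ∧
    E'.a = δ₃ / δ₁ * δ₅ ^ (1 - E.n) * E.a ∧
    E'.I = (fun t => δ₁ * t + δ₂) '' E.I ∧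
    ∀ t ∈ E.I, E'.g (δ₁ * t + δ₂) = δ₃ ^ 2 / δ₁ * E.g t

/-- A transformation of the generalized equivalence group of the subclass `n = 2`, with projection
`φ` to the space `(t, x, u)`, maps the equation `E` to the equation `E'`. The transformation has to
be defined on the whole `t`-interval of `E`. -/
def QuadraticEquiv (E E' : Equation) (φ : Pt → Pt) : Prop :=
  ∃ α β γ δ κ μ₁ μ₀ σ : ℝ, α * δ - β * γ ≠ 0 ∧ κ * σ ≠ 0 ∧
    (∀ t ∈ E.I, γ * t + δ ≠ 0) ∧
    (∀ t x u : ℝ, φ (t, x, u) =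
      ((α * t + β) / (γ * t + δ), (κ * x + μ₁ * t + μ₀) / (γ * t + δ),
        σ / (2 * E.a * (α * δ - β * γ)) *
          (2 * E.a * κ * (γ * t + δ) * u - κ * γ * x + μ₁ * δ - μ₀ * γ))) ∧
    E.n = 2 ∧ E'.n = 2 ∧
    E'.a = E.a / σ ∧
    E'.I = (fun t => (α * t + β) / (γ * t + δ)) '' E.I ∧
    ∀ t ∈ E.I, E'.g ((α * t + β) / (γ * t + δ)) = κ ^ 2 / (α * δ - β * γ) * E.g t

/-- The equivalence used in the classification: that of the usual equivalence group for `n ≠ 2`, and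
that of the generalized equivalence group of the subclass for `n = 2`. -/
def Equiv (E E' : Equation) (φ : Pt → Pt) : Prop :=
  (E.n ≠ 2 ∧ UsualEquiv E E' φ) ∨ (E.n = 2 ∧ QuadraticEquiv E E' φ)

/-! ### The classification list -/

/-- `∂_x`. -/
def dx : VF := fun _ => (0, 1, 0)

/-- `∂_t`. -/
def dt : VF := fun _ => (1, 0, 0)

/-- `2 a t ∂_x + ∂_u`; this is `t ∂_x + ∂_u` in the gauge `a = 1 / 2`. -/
def galilei (a : ℝ) : VF := fun (t, _, _) => (0, 2 * a * t, 1)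

/-- The rows of the classification table whose algebra extends the kernel, with their
parameters. -/
inductive Row
  | row2 (n ε ρ : ℝ)
  | row3 (n ε : ℝ)
  | row4 (n : ℝ)
  | row6 (ε ρ : ℝ)
  | row7 (ε : ℝ)
  | row8 (ε ρ : ℝ)
  | row9

namespace Row

/-- The number of the row. -/
def no : Row → ℕ
  | row2 _ _ _ => 2
  | row3 _ _ => 3
  | row4 _ => 4
  | row6 _ _ => 6
  | row7 _ => 7
  | row8 _ _ => 8
  | row9 => 9

/-- The exponent `n`. -/
def n : Row → ℝ
  | row2 n _ _ => n
  | row3 n _ => n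
  | row4 n => n
  | row6 _ _ => 2
  | row7 _ => 2
  | row8 _ _ => 2
  | row9 => 2

/-- The function `g`. -/
def g : Row → ℝ → ℝ
  | row2 _ ε ρ => fun t => ε * t ^ ρ
  | row3 _ ε => fun t => ε * Real.exp t
  | row4 _ => fun _ => 1
  | row6 ε ρ => fun t => ε * t ^ ρ
  | row7 ε => fun t => ε * Real.exp t
  | row8 ε ρ => fun t => ε * Real.exp (2 * ρ * Real.arctan t)
  | row9 => fun _ => 1

/-- The conditions on the parameters: `n ≠ 2` in the first rows, `ε = ±1`, `ρ ≠ 0`. -/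
def Valid : Row → Prop
  | row2 n ε ρ => n ≠ 2 ∧ (ε = 1 ∨ ε = -1) ∧ ρ ≠ 0
  | row3 n ε => n ≠ 2 ∧ (ε = 1 ∨ ε = -1)
  | row4 n => n ≠ 2
  | row6 ε ρ => (ε = 1 ∨ ε = -1) ∧ ρ ≠ 0
  | row7 ε => ε = 1 ∨ ε = -1
  | row8 ε ρ => (ε = 1 ∨ ε = -1) ∧ ρ ≠ 0
  | row9 => True

/-- The condition on the `t`-interval: the power function has to make sense on it. -/
def Admits : Row → Set ℝ → Prop
  | row2 _ _ ρ => fun I => PowerRegular ρ I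
  | row6 _ ρ => fun I => PowerRegular ρ I
  | _ => fun _ => True

/-- The basis operators of the row. -/
def basis : Row → List VF
  | row2 n _ ρ => [dx, fun (t, x, u) => (2 * t, (ρ + 1) * x, (ρ - 1) / (n - 1) * u)]
  | row3 n _ => [dx, fun (_, x, u) => (2, x, 1 / (n - 1) * u)]
  | row4 n => [dx, dt, fun (t, x, u) => (2 * t, x, -(1 / (n - 1)) * u)]
  | row6 _ ρ => [dx, galilei (1 / 2), fun (t, x, u) => (2 * t, (ρ + 1) * x, (ρ - 1) * u)]
  | row7 _ => [dx, galilei (1 / 2), fun (_, x, u) => (2, x, u)]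
  | row8 _ ρ => [dx, galilei (1 / 2),
      fun (t, x, u) => (t ^ 2 + 1, (t + ρ) * x, x + (ρ - t) * u)]
  | row9 => [dx, galilei (1 / 2), dt, fun (t, x, u) => (2 * t, x, -u),
      fun (t, x, u) => (t ^ 2, t * x, x - t * u)]

end Row

/-- `E` is an equation of the row `R` of the table, in the gauge `a = 1 / n`. -/
def InRow (E : Equation) (R : Row) : Prop :=
  R.Valid ∧ R.Admits E.I ∧ E.n = R.n ∧ E.a = 1 / E.n ∧ ∀ t ∈ E.I, E.g t = R.g t

/-! ### The Lie algebra `sl(2, ℝ) ⋉ 2A₁` -/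

/-- The two-dimensional abelian Lie algebra: `ℝ²` with the zero bracket. -/
abbrev TwoA1 : Type := Fin 2 → ℝ

instance instLieRingTwoA1 : LieRing TwoA1 where
  bracket _ _ := 0
  add_lie _ _ _ := (add_zero 0).symm
  lie_add _ _ _ := (add_zero 0).symm
  lie_self _ := rfl
  leibniz_lie _ _ _ := (add_zero 0).symm

instance instLieAlgebraTwoA1 : LieAlgebra ℝ TwoA1 where
  lie_smul c _ _ := (smul_zero c).symm

/-- A `2 × 2` matrix acts on the abelian algebra `ℝ²` by derivations. -/
def matDer (A : Matrix (Fin 2) (Fin 2) ℝ) : LieDerivation ℝ TwoA1 TwoA1 where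
  toLinearMap := (A.mulVecLin : (Fin 2 → ℝ) →ₗ[ℝ] (Fin 2 → ℝ))
  leibniz' _ _ := (map_zero A.mulVecLin).trans (sub_self 0).symm

theorem matDer_apply (A : Matrix (Fin 2) (Fin 2) ℝ) (v : TwoA1) :
    matDer A v = A.mulVec v := rfl

/-- The natural representation of `sl(2, ℝ)` on the abelian algebra `ℝ²`. -/
def slAction : LieAlgebra.SpecialLinear.sl (Fin 2) ℝ →ₗ⁅ℝ⁆ LieDerivation ℝ TwoA1 TwoA1 where
  toFun A := matDer A.1
  map_add' A B := by
    refine LieDerivation.ext fun v => ?_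
    exact Matrix.add_mulVec A.1 B.1 v
  map_smul' c A := by
    refine LieDerivation.ext fun v => ?_
    exact Matrix.smul_mulVec c A.1 v
  map_lie' := by
    intro A B
    refine LieDerivation.ext fun v => ?_
    rw [LieDerivation.commutator_apply]
    simp only [matDer_apply]
    refine (Matrix.sub_mulVec (A.1 * B.1) (B.1 * A.1) v).trans ?_
    rw [← Matrix.mulVec_mulVec, ← Matrix.mulVec_mulVec]

/-- The semidirect sum of `sl(2, ℝ)` and `2A₁`. -/
abbrev SlTwoA1 := LieAlgebra.SemiDirectSum TwoA1 (LieAlgebra.SpecialLinear.sl (Fin 2) ℝ) slAction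

/-- The maximal Lie invariance algebra of `E` on the box `B`, with the commutator of vector fields
as its bracket, is isomorphic to the Lie algebra `L`: there is a linear map from `L` to the vector
fields which is injective on the box, whose range on the box is the algebra, and which carries the
bracket of `L` to the commutator. -/
def MaxAlgebraIso (E : Equation) (B : Box E) (L : Type) [LieRing L] [LieAlgebra ℝ L] : Prop :=
  ∃ Φ : L →ₗ[ℝ] VF,
    (∀ z : L, Set.EqOn (Φ z) 0 B.dom → z = 0) ∧
    (∀ V : VF, IsLieSymmetry E B V ↔ ∃ z : L, Set.EqOn V (Φ z) B.dom) ∧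
    ∀ z w : L, Set.EqOn (Φ ⁅z, w⁆) (VectorField.lieBracket ℝ (Φ z) (Φ w)) B.dom

end

end BurgersLie

namespace BurgersLie

/-! Once `u_t` is eliminated through the equation, the invariance condition is polynomial in the
free jet variables `u_x`, `u_tx`, `u_xx`. Splitting it into coefficients gives the system
`Determining`, which can be integrated completely. Every symmetry agrees on the box with some
`symField a n c`, where c ∈ ℝ⁶ and τ = c₀t² + c₁t + c₂, and all constraints collapse to
`Admissible`: c₀ = c₄ = 0 unless n = 2, together with the classifying equation τ g' = (2c₃ - c₁) g.
This is `isLieSymmetry_iff`. From there on, the problem is linear algebra in ℝ⁶ coupled to one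
first-order linear equation for g.

A symmetry outside the kernel exists exactly when the classifying equation holds with some τ ≢ 0.
Put k = 2c₃ - c₁. If k = 0, then g is constant. If k ≠ 0, then τ has no zero on the t-interval,
because g has none, and g is determined by τ and k up to a constant factor. Conversely, when g
satisfies such an equation with a nonvanishing quadratic factor, `LogDeriv.admissible_iff` describes
all admissible c by linear equations; this yields the algebras of the rows.

Equivalence transformations act on τ as on a binary quadratic form under a Möbius substitution in t
(affine if n ≠ 2), and they preserve k and the discriminant of τ (`pullParams`,
`IsTransformation.pullback_symField`, `IsTransformation.admissible_iff`). Completeness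
(`exists_inRow_of_admissible`) follows by moving the roots of τ to standard position: a pair of real
roots, possibly with one at infinity, gives a power of t, a double root sent to infinity gives the
exponential, and complex roots give the arctangent. Inequivalence (`InRow.no_eq`) follows by
comparing k² and the discriminant up to a common factor. For constant g with n = 2 the quadratics τ
carry 𝔰𝔩(2), which acts on the kernel by its natural representation. -/

/-- The derivative of `f` in the constant direction `v`. -/
noncomputable def pd (v : Pt) (f : Pt → ℝ) : Pt → ℝ := fun p => fderiv ℝ f p v

abbrev et : Pt := (1, 0, 0)
abbrev ex : Pt := (0, 1, 0)
abbrev eu : Pt := (0, 0, 1)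

/-! ### Calculus of derivatives in constant directions -/

section PartialDerivatives

variable {S : Set Pt} {f h : Pt → ℝ} {v w p q : Pt}

theorem fderiv_eq_pd (f : Pt → ℝ) (p : Pt) (r s y : ℝ) :
    fderiv ℝ f p (r, s, y) = r * pd et f p + s * pd ex f p + y * pd eu f p := by
  have : ((r, s, y) : Pt) = r • et + s • ex + y • eu := by simp
  rw [this, map_add, map_add, map_smul, map_smul, map_smul]
  rfl

theorem Dt0_eq (f : Pt → ℝ) (t x u ut ux : ℝ) :
    Dt0 f (t, x, u, ut, ux) = pd et f (t, x, u) + ut * pd eu f (t, x, u) := by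
  simp only [Dt0, fderiv_eq_pd]; ring

theorem Dx0_eq (f : Pt → ℝ) (t x u ut ux : ℝ) :
    Dx0 f (t, x, u, ut, ux) = pd ex f (t, x, u) + ux * pd eu f (t, x, u) := by
  simp only [Dx0, fderiv_eq_pd]; ring

theorem contDiffOn_pd (hS : IsOpen S) (hf : ContDiffOn ℝ ∞ f S) (v : Pt) :
    ContDiffOn ℝ ∞ (pd v f) S :=
  (hf.fderiv_of_isOpen hS (m := ∞) le_rfl).clm_apply contDiffOn_const

theorem differentiableAt_of_contDiffOn (hS : IsOpen S) (hf : ContDiffOn ℝ ∞ f S) (hp : p ∈ S) :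
    DifferentiableAt ℝ f p :=
  (hf.contDiffAt (hS.mem_nhds hp)).differentiableAt (by simp)

theorem pd_congr (hS : IsOpen S) (hfh : Set.EqOn f h S) (v : Pt) :
    Set.EqOn (pd v f) (pd v h) S := fun p hp => by
  have : f =ᶠ[nhds p] h := by
    filter_upwards [hS.mem_nhds hp] with q hq using hfh hq
  simp only [pd, this.fderiv_eq]

theorem pd_const (c : ℝ) : pd v (fun _ => c) p = 0 := by simp [pd]

theorem pd_eq_zero (hS : IsOpen S) {c : ℝ} (hf : ∀ p ∈ S, f p = c) (v : Pt) (hp : p ∈ S) :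
    pd v f p = 0 := by
  rw [pd_congr hS (h := fun _ => c) hf v hp, pd_const]

theorem pd_comm (hS : IsOpen S) (hf : ContDiffOn ℝ ∞ f S) (hp : p ∈ S) (v w : Pt) :
    pd v (pd w f) p = pd w (pd v f) p := by
  have hf2 : DifferentiableAt ℝ (fderiv ℝ f) p :=
    ((hf.fderiv_of_isOpen hS (m := ∞) le_rfl).contDiffAt (hS.mem_nhds hp)).differentiableAt
      (by simp)
  have hsymm : IsSymmSndFDerivAt ℝ f p :=
    (hf.contDiffAt (hS.mem_nhds hp)).isSymmSndFDerivAt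
      (by simpa using (WithTop.coe_le_coe.2 (le_top : (2 : ℕ∞) ≤ ⊤)))
  have key : ∀ v w : Pt, pd v (pd w f) p = fderiv ℝ (fderiv ℝ f) p v w := by
    intro v w
    have := hf2.hasFDerivAt.clm_apply (hasFDerivAt_const w p)
    have h2 := this.fderiv
    change fderiv ℝ (fun y => fderiv ℝ f y w) p v = _
    rw [h2]
    simp
  rw [key, key]
  exact hsymm v w

theorem pd_add (hf : DifferentiableAt ℝ f p) (hh : DifferentiableAt ℝ h p) :
    pd v (fun q => f q + h q) p = pd v f p + pd v h p := by
  simp [pd, fderiv_fun_add hf hh]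

theorem pd_sub (hf : DifferentiableAt ℝ f p) (hh : DifferentiableAt ℝ h p) :
    pd v (fun q => f q - h q) p = pd v f p - pd v h p := by
  simp [pd, fderiv_fun_sub hf hh]

theorem pd_mul (hf : DifferentiableAt ℝ f p) (hh : DifferentiableAt ℝ h p) :
    pd v (fun q => f q * h q) p = pd v f p * h p + f p * pd v h p := by
  simp only [pd, fderiv_fun_mul hf hh]
  simp; ring

/-- A function with vanishing derivative in the direction of `q - p` takes the same values at `p`
and `q`. -/
theorem eq_of_pd_eq_zero (hS : IsOpen S) (hc : Convex ℝ S) (hf : ContDiffOn ℝ ∞ f S)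
    (hp : p ∈ S) (hq : q ∈ S) (h0 : ∀ r ∈ S, pd (q - p) f r = 0) : f p = f q := by
  have hmem : ∀ s ∈ Set.Icc (0 : ℝ) 1, p + s • (q - p) ∈ S := fun s hs => by
    have := hc.add_smul_sub_mem hp hq hs
    exact this
  have hd : ∀ s ∈ Set.Icc (0 : ℝ) 1, HasDerivAt (fun s : ℝ => f (p + s • (q - p))) 0 s := by
    intro s hs
    have h1 := (differentiableAt_of_contDiffOn hS hf (hmem s hs)).hasFDerivAt
    have h2 : HasDerivAt (fun s : ℝ => p + s • (q - p)) (q - p) s := by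
      simpa using ((hasDerivAt_id s).smul_const (q - p)).const_add p
    have := h1.comp_hasDerivAt s h2
    rwa [show fderiv ℝ f (p + s • (q - p)) (q - p) = 0 from h0 _ (hmem s hs)] at this
  have := constant_of_has_deriv_right_zero (a := (0 : ℝ)) (b := 1)
    (fun s hs => (hd s hs).continuousAt.continuousWithinAt)
    (fun s hs => (hd s (Set.Ico_subset_Icc_self hs)).hasDerivWithinAt) 1 (by simp)
  simpa using this.symm

theorem eq_const_of_pd_eq_zero (hS : IsOpen S) (hc : Convex ℝ S) (hf : ContDiffOn ℝ ∞ f S)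
    (h0 : ∀ v, ∀ p ∈ S, pd v f p = 0) : ∃ c : ℝ, ∀ p ∈ S, f p = c := by
  rcases S.eq_empty_or_nonempty with rfl | ⟨q, hq⟩
  · exact ⟨0, by simp⟩
  · exact ⟨f q, fun p hp => eq_of_pd_eq_zero hS hc hf hp hq fun r hr => h0 _ r hr⟩

theorem pd_eq_zero_of_basis (ht : pd et f p = 0) (hx : pd ex f p = 0) (hu : pd eu f p = 0)
    (v : Pt) : pd v f p = 0 := by
  obtain ⟨r, s, y⟩ := v
  rw [pd, fderiv_eq_pd, ht, hx, hu]; ring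

end PartialDerivatives

/-! ### Boxes -/

theorem isOpen_dom {E : Equation} (B : Box E) : IsOpen B.dom :=
  E.interval_I.1.prod (B.interval_X.1.prod B.interval_J.1)

theorem convex_dom {E : Equation} (B : Box E) : Convex ℝ B.dom :=
  E.interval_I.2.1.convex.prod (B.interval_X.2.1.convex.prod B.interval_J.2.1.convex)

theorem Equation.differentiableAt_g (E : Equation) {t : ℝ} (ht : t ∈ E.I) :
    DifferentiableAt ℝ E.g t :=
  (E.smooth_g.contDiffAt (E.interval_I.1.mem_nhds ht)).differentiableAt (by simp)

/-- The value 0 can occur only for a nonnegative integer n, hence for n ≥ 2 since 0 and 1 are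
excluded. In that case `u ^ (n - 1)` is still differentiable at 0. -/
theorem PowerRegular.ne_zero_or {n : ℝ} {J : Set ℝ} (h : PowerRegular n J) (h0 : n ≠ 0)
    (h1 : n ≠ 1) {u : ℝ} (hu : u ∈ J) : u ≠ 0 ∨ 2 ≤ n := by
  rcases h with h | ⟨m, rfl, hm | hm⟩
  · exact Or.inl (ne_of_gt (h hu))
  · right
    have h0' : m ≠ 0 := by exact_mod_cast h0
    have h1' : m ≠ 1 := by exact_mod_cast h1
    have : 2 ≤ m := by omega
    exact_mod_cast this
  · exact Or.inl fun h => hm (h ▸ hu)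

/-! ### The second prolongation -/

section Prolongation

/-- The projection of first-order jets to points. -/
def jetPt : Jet1 →L[ℝ] Pt :=
  (ContinuousLinearMap.fst ℝ ℝ _).prod
    (((ContinuousLinearMap.fst ℝ ℝ _).comp (ContinuousLinearMap.snd ℝ ℝ _)).prod
      ((ContinuousLinearMap.fst ℝ ℝ _).comp ((ContinuousLinearMap.snd ℝ ℝ _).comp
        (ContinuousLinearMap.snd ℝ ℝ _))))

def jetUt : Jet1 →L[ℝ] ℝ :=
  (ContinuousLinearMap.fst ℝ ℝ ℝ).comp ((ContinuousLinearMap.snd ℝ ℝ _).comp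
    ((ContinuousLinearMap.snd ℝ ℝ _).comp (ContinuousLinearMap.snd ℝ ℝ _)))

def jetUx : Jet1 →L[ℝ] ℝ :=
  (ContinuousLinearMap.snd ℝ ℝ ℝ).comp ((ContinuousLinearMap.snd ℝ ℝ _).comp
    ((ContinuousLinearMap.snd ℝ ℝ _).comp (ContinuousLinearMap.snd ℝ ℝ _)))

variable {S : Set Pt} {V : VF} {t x u ut ux utt utx uxx : ℝ}

theorem etaT_eq (V : VF) (t x u ut ux : ℝ) : etaT V (t, x, u, ut, ux) =
    pd et (thetaOf V) (t, x, u) + ut * pd eu (thetaOf V) (t, x, u)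
      - ut * (pd et (tauOf V) (t, x, u) + ut * pd eu (tauOf V) (t, x, u))
      - ux * (pd et (xiOf V) (t, x, u) + ut * pd eu (xiOf V) (t, x, u)) := by
  simp only [etaT, Dt0_eq]

theorem etaX_eq (V : VF) (t x u ut ux : ℝ) : etaX V (t, x, u, ut, ux) =
    pd ex (thetaOf V) (t, x, u) + ux * pd eu (thetaOf V) (t, x, u)
      - ut * (pd ex (tauOf V) (t, x, u) + ux * pd eu (tauOf V) (t, x, u))
      - ux * (pd ex (xiOf V) (t, x, u) + ux * pd eu (xiOf V) (t, x, u)) := by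
  simp only [etaX, Dx0_eq]

theorem hasFDerivAt_comp_jetPt {h : Pt → ℝ} (hh : DifferentiableAt ℝ h (t, x, u)) :
    HasFDerivAt (fun j : Jet1 => h (jetPt j)) ((fderiv ℝ h (t, x, u)).comp jetPt)
      (t, x, u, ut, ux) :=
  HasFDerivAt.comp (t, x, u, ut, ux) (f := jetPt) (g := h) hh.hasFDerivAt jetPt.hasFDerivAt

/-- Of the second-order coefficients only this one is needed explicitly, since the equation involves
neither `u_tt` nor `u_tx`. It comes from differentiating the expression of `etaX` through partial
derivatives, each of them composed with the linear projection of jets to points. -/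
theorem etaXX_eq (hS : IsOpen S) (hτ : ContDiffOn ℝ ∞ (tauOf V) S)
    (hξ : ContDiffOn ℝ ∞ (xiOf V) S) (hθ : ContDiffOn ℝ ∞ (thetaOf V) S) (hp : (t, x, u) ∈ S)
    (ut ux utt utx uxx : ℝ) :
    etaXX V (t, x, u, ut, ux, utt, utx, uxx) =
      (pd ex (pd ex (thetaOf V)) (t, x, u) + ux * pd eu (pd ex (thetaOf V)) (t, x, u)
        + uxx * pd eu (thetaOf V) (t, x, u)
        + ux * (pd ex (pd eu (thetaOf V)) (t, x, u) + ux * pd eu (pd eu (thetaOf V)) (t, x, u)))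
      - (2 * utx * (pd ex (tauOf V) (t, x, u) + ux * pd eu (tauOf V) (t, x, u))
        + ut * (pd ex (pd ex (tauOf V)) (t, x, u) + ux * pd eu (pd ex (tauOf V)) (t, x, u)
          + uxx * pd eu (tauOf V) (t, x, u)
          + ux * (pd ex (pd eu (tauOf V)) (t, x, u) + ux * pd eu (pd eu (tauOf V)) (t, x, u))))
      - (2 * uxx * (pd ex (xiOf V) (t, x, u) + ux * pd eu (xiOf V) (t, x, u))
        + ux * (pd ex (pd ex (xiOf V)) (t, x, u) + ux * pd eu (pd ex (xiOf V)) (t, x, u)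
          + uxx * pd eu (xiOf V) (t, x, u)
          + ux * (pd ex (pd eu (xiOf V)) (t, x, u) + ux * pd eu (pd eu (xiOf V)) (t, x, u)))) := by
  have D : ∀ {f : Pt → ℝ}, ContDiffOn ℝ ∞ f S → ∀ v, HasFDerivAt (fun j : Jet1 => pd v f (jetPt j))
      ((fderiv ℝ (pd v f) (t, x, u)).comp jetPt) (t, x, u, ut, ux) := fun hf v =>
    hasFDerivAt_comp_jetPt (differentiableAt_of_contDiffOn hS (contDiffOn_pd hS hf v) hp)
  have hut : HasFDerivAt (fun j : Jet1 => jetUt j) jetUt (t, x, u, ut, ux) := jetUt.hasFDerivAt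
  have hux : HasFDerivAt (fun j : Jet1 => jetUx j) jetUx (t, x, u, ut, ux) := jetUx.hasFDerivAt
  have key := (((D hθ ex).add (hux.mul (D hθ eu))).sub
    (hut.mul ((D hτ ex).add (hux.mul (D hτ eu))))).sub
    (hux.mul ((D hξ ex).add (hux.mul (D hξ eu))))
  have key' : HasFDerivAt (etaX V) _ (t, x, u, ut, ux) :=
    key.congr_of_eventuallyEq (Filter.Eventually.of_forall fun ⟨t, x, u, ut, ux⟩ =>
      etaX_eq V t x u ut ux)
  simp only [etaXX, Dx1, key'.fderiv, Dx0_eq]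
  simp only [jetPt, jetUt, jetUx, add_apply, sub_apply, smul_apply, ContinuousLinearMap.comp_apply, ContinuousLinearMap.prod_apply,
    smul_eq_mul,
    ContinuousLinearMap.coe_fst', ContinuousLinearMap.coe_snd', fderiv_eq_pd, Pi.add_apply,
    Pi.mul_apply]
  ring

end Prolongation

/-- The derivative of the left-hand side of the equation along a vector of the jet space. -/
theorem Equation.fderiv_F (E : Equation) {t u : ℝ} (ht : t ∈ E.I) (hu : u ≠ 0 ∨ 2 ≤ E.n)
    (x ut ux utt utx uxx t' x' u' ut' ux' utt' utx' uxx' : ℝ) :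
    fderiv ℝ E.F (t, x, u, ut, ux, utt, utx, uxx) (t', x', u', ut', ux', utt', utx', uxx') =
      ut' + E.a * E.n * ((E.n - 1) * u ^ (E.n - 2) * u' * ux + u ^ (E.n - 1) * ux')
        - deriv E.g t * t' * uxx - E.g t * uxx' := by
  set j : Jet2 := (t, x, u, ut, ux, utt, utx, uxx) with hj
  have hp : DifferentiableAt ℝ (fun v : ℝ => v ^ (E.n - 1)) u :=
    (Real.hasDerivAt_rpow_const (hu.imp_right fun h => by linarith)).differentiableAt
  have hg := E.differentiableAt_g ht
  have hd : DifferentiableAt ℝ E.F j := by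
    have h1 : DifferentiableAt ℝ (fun j : Jet2 => j.2.2.1 ^ (E.n - 1)) j :=
      DifferentiableAt.comp j (f := fun j : Jet2 => j.2.2.1) (g := fun v : ℝ => v ^ (E.n - 1)) hp
        (by fun_prop)
    have h2 : DifferentiableAt ℝ (fun j : Jet2 => E.g j.1) j :=
      DifferentiableAt.comp j (f := fun j : Jet2 => j.1) (g := E.g) hg (by fun_prop)
    have : DifferentiableAt ℝ (fun j : Jet2 => j.2.2.2.1 + E.a * E.n * j.2.2.1 ^ (E.n - 1)
        * j.2.2.2.2.1 - E.g j.1 * j.2.2.2.2.2.2.2) j := by fun_prop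
    exact this
  set w : Jet2 := (t', x', u', ut', ux', utt', utx', uxx') with hw
  -- With differentiability of `E.F` known, its derivative along `w` is the derivative at s = 0 of a
  -- function of one variable.
  have hline : HasDerivAt (fun s : ℝ => j + s • w) w 0 := by
    simpa using ((hasDerivAt_id (0 : ℝ)).smul_const w).const_add j
  have h1 : HasDerivAt (fun s : ℝ => E.F (j + s • w)) (fderiv ℝ E.F j w) 0 := by
    have h0 : HasFDerivAt E.F (fderiv ℝ E.F j) (j + (0 : ℝ) • w) := by simpa using hd.hasFDerivAt
    exact h0.comp_hasDerivAt (0 : ℝ) hline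
  have lin : ∀ b c : ℝ, HasDerivAt (fun s : ℝ => b + s * c) c 0 := fun b c => by
    simpa using ((hasDerivAt_id (0 : ℝ)).mul_const c).const_add b
  have hpow : HasDerivAt (fun s : ℝ => (u + s * u') ^ (E.n - 1))
      ((E.n - 1) * u ^ (E.n - 2) * u') 0 := by
    have h0 : HasDerivAt (fun v : ℝ => v ^ (E.n - 1)) ((E.n - 1) * u ^ (E.n - 1 - 1))
        (u + 0 * u') := by
      simpa using Real.hasDerivAt_rpow_const (hu.imp_right fun h => by linarith)
    have := h0.comp (0 : ℝ) (lin u u')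
    rwa [show E.n - 1 - 1 = E.n - 2 by ring] at this
  have hgd : HasDerivAt (fun s : ℝ => E.g (t + s * t')) (deriv E.g t * t') 0 := by
    have h0 : HasDerivAt E.g (deriv E.g t) (t + 0 * t') := by simpa using hg.hasDerivAt
    exact h0.comp (0 : ℝ) (lin t t')
  have h2 :=
    ((lin ut ut').add ((hpow.const_mul (E.a * E.n)).mul (lin ux ux'))).sub (hgd.mul (lin uxx uxx'))
  have h3 : HasDerivAt (fun s : ℝ => E.F (j + s • w)) _ 0 := h2
  rw [h1.unique h3]
  simp only [zero_mul, add_zero]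
  ring

/-! ### The determining equations -/

theorem contDiffOn_tauOf {V : VF} {S : Set Pt} (hV : ContDiffOn ℝ ∞ V S) :
    ContDiffOn ℝ ∞ (tauOf V) S := hV.fst

theorem contDiffOn_xiOf {V : VF} {S : Set Pt} (hV : ContDiffOn ℝ ∞ V S) :
    ContDiffOn ℝ ∞ (xiOf V) S := hV.snd.fst

theorem contDiffOn_thetaOf {V : VF} {S : Set Pt} (hV : ContDiffOn ℝ ∞ V S) :
    ContDiffOn ℝ ∞ (thetaOf V) S := hV.snd.snd

/-- The determining equations of Lie symmetries, at a point. -/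
structure Determining (E : Equation) (V : VF) (p : Pt) : Prop where
  tau_x : pd ex (tauOf V) p = 0
  tau_u : pd eu (tauOf V) p = 0
  xi_u : pd eu (xiOf V) p = 0
  theta_uu : pd eu (pd eu (thetaOf V)) p = 0
  xi_x : 2 * E.g p.1 * pd ex (xiOf V) p
    = E.g p.1 * pd et (tauOf V) p + deriv E.g p.1 * tauOf V p
  theta : E.a * E.n * p.2.2 ^ (E.n - 1) * (pd et (tauOf V) p - pd ex (xiOf V) p)
    + E.a * E.n * (E.n - 1) * p.2.2 ^ (E.n - 2) * thetaOf V p - pd et (xiOf V) p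
    - E.g p.1 * (2 * pd ex (pd eu (thetaOf V)) p - pd ex (pd ex (xiOf V)) p) = 0
  theta_t : pd et (thetaOf V) p + E.a * E.n * p.2.2 ^ (E.n - 1) * pd ex (thetaOf V) p
    - E.g p.1 * pd ex (pd ex (thetaOf V)) p = 0

theorem isLieSymmetry_iff_determining (E : Equation) (B : Box E) (V : VF) :
    IsLieSymmetry E B V ↔ ContDiffOn ℝ ∞ V B.dom ∧ ∀ p ∈ B.dom, Determining E V p := by
  have hS := isOpen_dom B
  have hne : ∀ {t x u : ℝ}, (t, x, u) ∈ B.dom → u ≠ 0 ∨ 2 ≤ E.n := fun h =>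
    B.power_J.ne_zero_or E.n_ne_zero E.n_ne_one h.2.2
  refine and_congr_right fun hV => ?_
  have hτ := contDiffOn_tauOf hV
  have hξ := contDiffOn_xiOf hV
  have hθ := contDiffOn_thetaOf hV
  constructor
  · intro h
    -- On the equation `u_t` is a function of the other variables, so `u_x`, `u_tx`, `u_xx` may be
    -- given arbitrary values; `u_tt` plays no role and is set to 0.
    have inv : ∀ t x u : ℝ, (t, x, u) ∈ B.dom → ∀ ux utx uxx : ℝ, _ := fun t x u hp ux utx uxx => by
      have h0 := h t x u (E.g t * uxx - E.a * E.n * u ^ (E.n - 1) * ux) ux 0 utx uxx hp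
        (by simp only [Equation.F]; ring)
      simp only [prolong2] at h0
      rw [E.fderiv_F hp.1 (hne hp), etaT_eq, etaX_eq, etaXX_eq hS hτ hξ hθ hp] at h0
      exact h0
    have h1 : ∀ p ∈ B.dom, pd ex (tauOf V) p = 0 ∧ pd eu (tauOf V) p = 0 := by
      rintro ⟨t, x, u⟩ hp
      have hg := E.g_ne_zero t hp.1
      have a1 := inv t x u hp 0 0 0
      have a2 := inv t x u hp 0 1 0
      have a3 := inv t x u hp 1 0 0
      have a4 := inv t x u hp 1 1 0
      -- Changing only `u_tx` isolates its coefficient 2g(τ_x + u_x τ_u), here at `u_x` = 0 and at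
      -- `u_x` = 1.
      have b1 : E.g t * pd ex (tauOf V) (t, x, u) = 0 := by linarith
      have b2 : E.g t * (pd ex (tauOf V) (t, x, u) + pd eu (tauOf V) (t, x, u)) = 0 := by
        linarith
      have c1 := (mul_eq_zero.1 b1).resolve_left hg
      have c2 := (mul_eq_zero.1 b2).resolve_left hg
      exact ⟨c1, by linarith⟩
    have z1 : ∀ v, ∀ p ∈ B.dom, pd v (pd ex (tauOf V)) p = 0 := fun v p hp =>
      pd_eq_zero hS (fun q hq => (h1 q hq).1) v hp
    have z2 : ∀ v, ∀ p ∈ B.dom, pd v (pd eu (tauOf V)) p = 0 := fun v p hp =>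
      pd_eq_zero hS (fun q hq => (h1 q hq).2) v hp
    have h2 : ∀ p ∈ B.dom, pd eu (xiOf V) p = 0 := by
      rintro ⟨t, x, u⟩ hp
      have hg := E.g_ne_zero t hp.1
      have a0 := inv t x u hp 0 0 0
      have a1 := inv t x u hp 1 0 0
      have a2 := inv t x u hp 0 0 1
      have a3 := inv t x u hp 1 0 1
      rw [(h1 _ hp).1, (h1 _ hp).2, z1 _ _ hp, z2 _ _ hp, z1 _ _ hp, z2 _ _ hp] at a0 a1 a2 a3
      -- The mixed difference over `u_x`, `u_xx` ∈ {0, 1} isolates the coefficient of `u_x u_xx`.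
      have : 2 * E.g t * pd eu (xiOf V) (t, x, u) = 0 := by linarith
      simpa [hg] using this
    have z3 : ∀ v, ∀ p ∈ B.dom, pd v (pd eu (xiOf V)) p = 0 := fun v p hp =>
      pd_eq_zero hS h2 v hp
    have z4 : ∀ p ∈ B.dom, pd eu (pd ex (xiOf V)) p = 0 := fun p hp => by
      rw [pd_comm hS hξ hp, z3 _ _ hp]
    rintro ⟨t, x, u⟩ hp
    have hg := E.g_ne_zero t hp.1
    have inv' := inv t x u hp
    have hcomm := pd_comm hS hθ hp eu ex
    rw [hcomm] at inv'
    rw [(h1 _ hp).1, (h1 _ hp).2, z1 _ _ hp, z2 _ _ hp, z1 _ _ hp, z2 _ _ hp, h2 _ hp, z3 _ _ hp,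
      z3 _ _ hp, z4 _ hp] at inv'
    -- What is left has degree 2 in `u_x` and degree 1 in `u_xx`, with no mixed term, so these four
    -- jets determine every coefficient.
    have a0 := inv' 0 0 0
    have a1 := inv' 1 0 0
    have a2 := inv' (-1) 0 0
    have a3 := inv' 0 0 1
    have h3 : E.g t * pd eu (pd eu (thetaOf V)) (t, x, u) = 0 := by linarith
    have h3' := (mul_eq_zero.1 h3).resolve_left hg
    refine ⟨(h1 _ hp).1, (h1 _ hp).2, h2 _ hp, h3', ?_, ?_, ?_⟩
    · change 2 * E.g t * pd ex (xiOf V) (t, x, u) = E.g t * pd et (tauOf V) (t, x, u)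
        + deriv E.g t * tauOf V (t, x, u)
      linarith
    · change E.a * E.n * u ^ (E.n - 1) * (pd et (tauOf V) (t, x, u) - pd ex (xiOf V) (t, x, u))
        + E.a * E.n * (E.n - 1) * u ^ (E.n - 2) * thetaOf V (t, x, u) - pd et (xiOf V) (t, x, u)
        - E.g t * (2 * pd ex (pd eu (thetaOf V)) (t, x, u) - pd ex (pd ex (xiOf V)) (t, x, u)) = 0
      linarith
    · change pd et (thetaOf V) (t, x, u) + E.a * E.n * u ^ (E.n - 1) * pd ex (thetaOf V) (t, x, u)
        - E.g t * pd ex (pd ex (thetaOf V)) (t, x, u) = 0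
      linarith
  · intro h t x u ut ux utt utx uxx hp hF
    have z1 : ∀ v, pd v (pd ex (tauOf V)) (t, x, u) = 0 := fun v =>
      pd_eq_zero hS (fun q hq => (h q hq).tau_x) v hp
    have z2 : ∀ v, pd v (pd eu (tauOf V)) (t, x, u) = 0 := fun v =>
      pd_eq_zero hS (fun q hq => (h q hq).tau_u) v hp
    have z3 : ∀ v, pd v (pd eu (xiOf V)) (t, x, u) = 0 := fun v =>
      pd_eq_zero hS (fun q hq => (h q hq).xi_u) v hp
    have z4 : pd eu (pd ex (xiOf V)) (t, x, u) = 0 := by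
      rw [pd_comm hS hξ hp, z3]
    have hcomm := pd_comm hS hθ hp eu ex
    obtain ⟨e1, e2, e3, e4, e5, e6, e7⟩ := h _ hp
    have hut : ut = E.g t * uxx - E.a * E.n * u ^ (E.n - 1) * ux := by
      simp only [Equation.F] at hF; linarith
    simp only [prolong2]
    rw [E.fderiv_F hp.1 (hne hp), etaT_eq, etaX_eq, etaXX_eq hS hτ hξ hθ hp, hcomm, e1, e2, e3, e4,
      z1, z1, z2, z2, z3, z3, z4, hut]
    simp only at e5 e6 e7
    -- Conversely, the invariance condition is the polynomial whose coefficients at `u_xx`, `u_x`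
    -- and 1 are the last three determining equations.
    linear_combination (-uxx) * (-e5) + ux * e6 + e7

/-! ### Polynomials and powers on open intervals -/

theorem IsOpenInterval.exists_sub_add_mem {I : Set ℝ} (hI : IsOpenInterval I) :
    ∃ t e : ℝ, 0 < e ∧ t - e ∈ I ∧ t ∈ I ∧ t + e ∈ I := by
  obtain ⟨t, ht⟩ := hI.2.2
  obtain ⟨e, he, hb⟩ := Metric.isOpen_iff.1 hI.1 t ht
  refine ⟨t, e / 2, half_pos he, hb ?_, ht, hb ?_⟩ <;>
    simp [abs_of_pos he, show 0 < e from he]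

theorem quadratic_eq_zero_on {I : Set ℝ} (hI : IsOpenInterval I) {A B C : ℝ}
    (h : ∀ t ∈ I, A * t ^ 2 + B * t + C = 0) : A = 0 ∧ B = 0 ∧ C = 0 := by
  obtain ⟨t, e, he, h1, h2, h3⟩ := hI.exists_sub_add_mem
  have a1 := h _ h1
  have a2 := h _ h2
  have a3 := h _ h3
  -- The second difference over three equidistant points isolates the leading coefficient.
  have hA : A * (2 * e ^ 2) = 0 := by linear_combination a1 + a3 - 2 * a2
  have hA : A = 0 := (mul_eq_zero.1 hA).resolve_right (by positivity)
  subst hA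
  have hB : B * e = 0 := by linear_combination a3 - a2
  have hB : B = 0 := (mul_eq_zero.1 hB).resolve_right he.ne'
  subst hB
  exact ⟨rfl, rfl, by linarith⟩

theorem affine_eq_zero_on {I : Set ℝ} (hI : IsOpenInterval I) {B C : ℝ}
    (h : ∀ t ∈ I, B * t + C = 0) : B = 0 ∧ C = 0 :=
  (quadratic_eq_zero_on hI (A := 0) fun t ht => by linarith [h t ht]).2

/-- For a negative base `Real.rpow` carries a cosine factor that could vanish. Negative values are
allowed only for integer n, where the power is an ordinary integer power. -/
theorem PowerRegular.rpow_ne_zero {n : ℝ} {J : Set ℝ} (h : PowerRegular n J) {u : ℝ} (hu : u ∈ J)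
    (hu0 : u ≠ 0) (k : ℤ) : u ^ (n + k) ≠ 0 := by
  rcases h with h | ⟨m, rfl, -⟩
  · exact (Real.rpow_pos_of_pos (h hu) _).ne'
  · rw [← Int.cast_add, Real.rpow_intCast]
    exact zpow_ne_zero _ hu0

/-- For `n ≠ 1, 2` the functions `u ^ (n - 1)`, `u ^ (n - 2)` and `1` are linearly independent on
every open interval. -/
theorem powers_independent {n : ℝ} {J : Set ℝ} (hJ : IsOpenInterval J) (hn : PowerRegular n J)
    (h1 : n ≠ 1) (h2 : n ≠ 2) {A B C : ℝ}
    (h : ∀ v ∈ J, A * v ^ (n - 1) + B * v ^ (n - 2) + C = 0) : A = 0 ∧ B = 0 ∧ C = 0 := by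
  -- Differentiation removes C, and division by `v ^ (n - 3)` leaves an affine function of v.
  have key : ∀ v ∈ J, v ≠ 0 → A * (n - 1) * v + B * (n - 2) = 0 := by
    intro v hv hv0
    have d1 : HasDerivAt (fun v : ℝ => v ^ (n - 1)) ((n - 1) * v ^ (n - 1 - 1)) v :=
      Real.hasDerivAt_rpow_const (Or.inl hv0)
    have d2 : HasDerivAt (fun v : ℝ => v ^ (n - 2)) ((n - 2) * v ^ (n - 2 - 1)) v :=
      Real.hasDerivAt_rpow_const (Or.inl hv0)
    have d3 := ((d1.const_mul A).add (d2.const_mul B)).add_const C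
    have d4 := d3.congr_of_eventuallyEq (f₁ := fun _ => (0 : ℝ)) (by
      filter_upwards [hJ.1.mem_nhds hv] with w hw using (h w hw).symm)
    have d5 := d4.unique (hasDerivAt_const v (0 : ℝ))
    have e1 : v ^ (n - 1 - 1) = v ^ (n - 3) * v := by
      rw [← Real.rpow_add_one hv0]; ring_nf
    have e2 : v ^ (n - 2 - 1) = v ^ (n - 3) := by ring_nf
    rw [e1, e2] at d5
    have d6 : v ^ (n - 3) * (A * (n - 1) * v + B * (n - 2)) = 0 := by linear_combination d5
    refine (mul_eq_zero.1 d6).resolve_left ?_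
    have := hn.rpow_ne_zero hv hv0 (-3)
    simpa [sub_eq_add_neg] using this
  obtain ⟨t, e, he, m1, m2, m3⟩ := hJ.exists_sub_add_mem
  -- The interval may contain 0, where that division fails; at most one of three distinct points is
  -- lost.
  have two : ∃ v w : ℝ, v ∈ J ∧ w ∈ J ∧ v ≠ 0 ∧ w ≠ 0 ∧ v ≠ w := by
    by_cases ht : t = 0
    · exact ⟨t - e, t + e, m1, m3, by intro h; linarith, by intro h; linarith,
        by intro h; linarith⟩
    · by_cases ht' : t + e = 0
      · exact ⟨t, t - e, m2, m1, ht, by intro h; linarith, by intro h; linarith⟩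
      · exact ⟨t, t + e, m2, m3, ht, ht', by intro h; linarith⟩
  obtain ⟨v, w, hv, hw, hv0, hw0, hvw⟩ := two
  have k1 := key v hv hv0
  have k2 := key w hw hw0
  have hA : A * ((n - 1) * (v - w)) = 0 := by linear_combination k1 - k2
  have hA : A = 0 :=
    (mul_eq_zero.1 hA).resolve_right (mul_ne_zero (sub_ne_zero.2 h1) (sub_ne_zero.2 hvw))
  subst hA
  have hB : B * (n - 2) = 0 := by linear_combination k1
  have hB : B = 0 := (mul_eq_zero.1 hB).resolve_right (sub_ne_zero.2 h2)
  subst hB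
  have := h v hv
  exact ⟨rfl, rfl, by linarith⟩

/-! ### Quadratic functions of `(t, x, u)` -/

/-- A normal form for all components of symmetry operators. Its partial derivatives stay in the same
family, so differentiation becomes a rewriting of coefficients. -/
def quad (A B C D E F G : ℝ) : Pt → ℝ := fun p =>
  A * p.1 ^ 2 + B * p.1 * p.2.1 + C * p.1 * p.2.2 + D * p.1 + E * p.2.1 + F * p.2.2 + G

theorem contDiff_quad (A B C D E F G : ℝ) : ContDiff ℝ ∞ (quad A B C D E F G) := by
  unfold quad; fun_prop

theorem fderiv_quad (A B C D E F G : ℝ) (p v : Pt) :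
    fderiv ℝ (quad A B C D E F G) p v = (2 * A * p.1 + B * p.2.1 + C * p.2.2 + D) * v.1
      + (B * p.1 + E) * v.2.1 + (C * p.1 + F) * v.2.2 := by
  have h1 : HasFDerivAt (fun p : Pt => p.1) (ContinuousLinearMap.fst ℝ ℝ (ℝ × ℝ)) p :=
    hasFDerivAt_fst
  have h2 : HasFDerivAt (fun p : Pt => p.2.1)
      ((ContinuousLinearMap.fst ℝ ℝ ℝ).comp (ContinuousLinearMap.snd ℝ ℝ (ℝ × ℝ))) p :=
    hasFDerivAt_fst.comp p hasFDerivAt_snd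
  have h3 : HasFDerivAt (fun p : Pt => p.2.2)
      ((ContinuousLinearMap.snd ℝ ℝ ℝ).comp (ContinuousLinearMap.snd ℝ ℝ (ℝ × ℝ))) p :=
    hasFDerivAt_snd.comp p hasFDerivAt_snd
  have h := (((((((h1.pow 2).const_mul A).add ((h1.const_mul B).mul h2)).add
    ((h1.const_mul C).mul h3)).add (h1.const_mul D)).add (h2.const_mul E)).add
    (h3.const_mul F)).add_const G
  have h' : HasFDerivAt (quad A B C D E F G) _ p := h
  rw [h'.fderiv]
  simp
  ring

theorem pd_et_quad (A B C D E F G : ℝ) :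
    pd et (quad A B C D E F G) = quad 0 0 0 (2 * A) B C D := by
  funext p; simp only [pd, fderiv_quad, quad]; ring

theorem pd_ex_quad (A B C D E F G : ℝ) :
    pd ex (quad A B C D E F G) = quad 0 0 0 B 0 0 E := by
  funext p; simp only [pd, fderiv_quad, quad]; ring

theorem pd_eu_quad (A B C D E F G : ℝ) :
    pd eu (quad A B C D E F G) = quad 0 0 0 C 0 0 F := by
  funext p; simp only [pd, fderiv_quad, quad]; ring

/-- Integration of a prescribed gradient: the difference from the quadratic without constant term
has zero derivative on a convex open set. -/
theorem exists_eqOn_quad {S : Set Pt} {f : Pt → ℝ} (hS : IsOpen S) (hc : Convex ℝ S)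
    (hf : ContDiffOn ℝ ∞ f S) {A B C D E F : ℝ}
    (ht : ∀ p ∈ S, pd et f p = 2 * A * p.1 + B * p.2.1 + C * p.2.2 + D)
    (hx : ∀ p ∈ S, pd ex f p = B * p.1 + E) (hu : ∀ p ∈ S, pd eu f p = C * p.1 + F) :
    ∃ G, ∀ p ∈ S, f p = quad A B C D E F G p := by
  have hq := contDiff_quad A B C D E F 0
  obtain ⟨G, hG⟩ := eq_const_of_pd_eq_zero (f := fun p => f p - quad A B C D E F 0 p) hS hc
    (hf.sub hq.contDiffOn) fun v p hp => by
      have hd := differentiableAt_of_contDiffOn hS hf hp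
      have hd' : DifferentiableAt ℝ (quad A B C D E F 0) p := hq.differentiable (by simp) p
      apply pd_eq_zero_of_basis <;> rw [pd_sub hd hd']
      · rw [ht p hp, pd_et_quad]; simp only [quad]; ring
      · rw [hx p hp, pd_ex_quad]; simp only [quad]; ring
      · rw [hu p hp, pd_eu_quad]; simp only [quad]; ring
  refine ⟨G, fun p hp => ?_⟩
  have := hG p hp
  simp only [quad] at this ⊢
  linarith

/-- Useful when constancy along a line comes from an algebraic relation, so that the relation itself
need not be differentiated. -/
theorem pd_eq_zero_of_line {S : Set Pt} {f : Pt → ℝ} {p v : Pt} (hS : IsOpen S)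
    (hf : ContDiffOn ℝ ∞ f S) (hp : p ∈ S)
    (h : ∀ s : ℝ, p + s • v ∈ S → f (p + s • v) = f p) : pd v f p = 0 := by
  have h2 : HasDerivAt (fun s : ℝ => p + s • v) v 0 := by
    simpa using ((hasDerivAt_id (0 : ℝ)).smul_const v).const_add p
  have h1 : HasFDerivAt f (fderiv ℝ f p) (p + (0 : ℝ) • v) := by
    simpa using (differentiableAt_of_contDiffOn hS hf hp).hasFDerivAt
  have h3 := h1.comp_hasDerivAt (0 : ℝ) h2
  have hmem : ∀ᶠ s : ℝ in nhds 0, p + s • v ∈ S :=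
    h2.continuousAt.eventually (hS.mem_nhds (by simpa using hp))
  have h4 := h3.congr_of_eventuallyEq (f₁ := fun _ => f p)
    (hmem.mono fun s hs => (h s hs).symm)
  exact h4.unique (hasDerivAt_const _ _)

/-! ### The general symmetry operator -/

/-- The coefficients of a symmetry operator. -/
abbrev Params := Fin 6 → ℝ

/-- The general solution of the determining equations before the classifying equation for g is
imposed: τ and ξ are free within these quadratics, and θ is forced by them. Linearity in c allows
spans and bases to be computed in ℝ⁶. -/
noncomputable def symField (a n : ℝ) : Params →ₗ[ℝ] VF where
  toFun c := fun p => (c 0 * p.1 ^ 2 + c 1 * p.1 + c 2, (c 0 * p.1 + c 3) * p.2.1 + c 4 * p.1 + c 5,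
    (-c 0 * p.1 + (c 3 - c 1) / (n - 1)) * p.2.2 + (c 0 * p.2.1 + c 4) / (2 * a))
  map_add' c d := by
    funext p
    simp only [Pi.add_apply, Prod.mk_add_mk, Prod.mk.injEq]
    refine ⟨?_, ?_, ?_⟩ <;> ring
  map_smul' r c := by
    funext p
    simp only [Pi.smul_apply, smul_eq_mul, RingHom.id_apply, Prod.smul_mk, Prod.mk.injEq]
    refine ⟨?_, ?_, ?_⟩ <;> ring

theorem symField_apply (a n : ℝ) (c : Params) (p : Pt) : symField a n c p =
    (c 0 * p.1 ^ 2 + c 1 * p.1 + c 2, (c 0 * p.1 + c 3) * p.2.1 + c 4 * p.1 + c 5,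
      (-c 0 * p.1 + (c 3 - c 1) / (n - 1)) * p.2.2 + (c 0 * p.2.1 + c 4) / (2 * a)) := rfl

theorem tauOf_symField (a n : ℝ) (c : Params) :
    tauOf (symField a n c) = quad (c 0) 0 0 (c 1) 0 0 (c 2) := by
  funext p; simp only [tauOf, symField_apply, quad]; ring

theorem xiOf_symField (a n : ℝ) (c : Params) :
    xiOf (symField a n c) = quad 0 (c 0) 0 (c 4) (c 3) 0 (c 5) := by
  funext p; simp only [xiOf, symField_apply, quad]; ring

theorem thetaOf_symField (a n : ℝ) (c : Params) :
    thetaOf (symField a n c) =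
      quad 0 0 (-c 0) 0 (c 0 / (2 * a)) ((c 3 - c 1) / (n - 1)) (c 4 / (2 * a)) := by
  funext p; simp only [thetaOf, symField_apply, quad]; ring

theorem contDiff_symField (a n : ℝ) (c : Params) : ContDiff ℝ ∞ (symField a n c) := by
  have h : symField a n c = fun p => (tauOf (symField a n c) p, xiOf (symField a n c) p,
    thetaOf (symField a n c) p) := rfl
  rw [h, tauOf_symField, xiOf_symField, thetaOf_symField]
  exact (contDiff_quad ..).prodMk ((contDiff_quad ..).prodMk (contDiff_quad ..))

/-- A symmetry operator is determined by its values on a box. -/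
theorem symField_injOn {a n : ℝ} {I X J : Set ℝ} (hI : IsOpenInterval I) (hX : IsOpenInterval X)
    (hJ : IsOpenInterval J) {c : Params} (h : Set.EqOn (symField a n c) 0 (I ×ˢ X ×ˢ J)) :
    c = 0 := by
  obtain ⟨u, hu⟩ := hJ.2.2
  have h' : ∀ t ∈ I, ∀ x ∈ X, c 0 * t ^ 2 + c 1 * t + c 2 = 0 ∧
      (c 0 * t + c 3) * x + c 4 * t + c 5 = 0 := fun t ht x hx => by
    have := h (x := (t, x, u)) ⟨ht, hx, hu⟩
    simp only [symField_apply, Pi.zero_apply, Prod.mk_eq_zero] at this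
    exact ⟨this.1, this.2.1⟩
  obtain ⟨x0, hx0⟩ := hX.2.2
  obtain ⟨h0, h1, h2⟩ := quadratic_eq_zero_on hI fun t ht => (h' t ht x0 hx0).1
  have h3 : ∀ x ∈ X, c 4 = 0 ∧ c 3 * x + c 5 = 0 := fun x hx =>
    affine_eq_zero_on hI fun t ht => by
      have := (h' t ht x hx).2
      rw [h0] at this
      linarith
  obtain ⟨h4, h5⟩ := affine_eq_zero_on hX fun x hx => (h3 x hx).2
  funext i
  fin_cases i
  exacts [h0, h1, h2, h4, (h3 x0 hx0).1, h5]

/-- The condition on the coefficients of a symmetry operator. -/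
def Admissible (E : Equation) (c : Params) : Prop :=
  (E.n = 2 ∨ c 0 = 0 ∧ c 4 = 0) ∧
    ∀ t ∈ E.I, (c 0 * t ^ 2 + c 1 * t + c 2) * deriv E.g t = (2 * c 3 - c 1) * E.g t

theorem rpow_sub_two_mul {n u : ℝ} (h1 : n ≠ 1) (hu : u ≠ 0 ∨ 2 ≤ n) :
    u ^ (n - 2) * u = u ^ (n - 1) := by
  by_cases h0 : u = 0
  · subst h0
    rw [Real.zero_rpow (sub_ne_zero.2 h1), mul_zero]
  · rw [← Real.rpow_add_one h0]; ring_nf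

theorem isLieSymmetry_symField {E : Equation} {B : Box E} {c : Params} (hc : Admissible E c) :
    IsLieSymmetry E B (symField E.a E.n c) := by
  rw [isLieSymmetry_iff_determining]
  refine ⟨(contDiff_symField _ _ _).contDiffOn, ?_⟩
  rintro ⟨t, x, u⟩ hp
  have hg := hc.2 t hp.1
  have hu := rpow_sub_two_mul E.n_ne_one (B.power_J.ne_zero_or E.n_ne_zero E.n_ne_one hp.2.2)
  have hn1 : E.n - 1 ≠ 0 := sub_ne_zero.2 E.n_ne_one
  have ha := E.a_ne_zero
  constructor <;>
    simp only [tauOf_symField, xiOf_symField, thetaOf_symField, pd_et_quad, pd_ex_quad, pd_eu_quad]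
  · simp [quad]
  · simp [quad]
  · simp [quad]
  · simp [quad]
  · simp only [quad]; linear_combination (-1) * hg
  · simp only [quad]
    rw [← hu]
    rcases hc.1 with h2 | ⟨h0, h4⟩
    · simp only [h2, sub_self, Real.rpow_zero]
      norm_num
      field_simp
      ring
    · rw [h0, h4]
      field_simp
      ring
  · simp only [quad]
    rcases hc.1 with h2 | ⟨h0, h4⟩
    · simp only [h2]
      norm_num
      field_simp
      ring
    · rw [h0]; simp

/-! ### Integration of the determining equations -/

section Forward

variable {E : Equation} {B : Box E} {V : VF}

/-- The consequences of the determining equations that do not depend on `n`. -/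
structure Reduced (E : Equation) (B : Box E) (V : VF) : Prop where
  tau_tx : ∀ p ∈ B.dom, pd ex (pd et (tauOf V)) p = 0
  tau_tu : ∀ p ∈ B.dom, pd eu (pd et (tauOf V)) p = 0
  xi_tu : ∀ p ∈ B.dom, pd eu (pd et (xiOf V)) p = 0
  xi_xu : ∀ p ∈ B.dom, pd eu (pd ex (xiOf V)) p = 0
  xi_xx : ∀ p ∈ B.dom, pd ex (pd ex (xiOf V)) p = 0
  theta : ∀ p ∈ B.dom, ∀ v ∈ B.J,
    E.a * E.n * (pd et (tauOf V) p - pd ex (xiOf V) p + (E.n - 1) * pd eu (thetaOf V) p)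
        * v ^ (E.n - 1)
      + E.a * E.n * (E.n - 1) * (thetaOf V p - p.2.2 * pd eu (thetaOf V) p) * v ^ (E.n - 2)
      + -(pd et (xiOf V) p + 2 * E.g p.1 * pd ex (pd eu (thetaOf V)) p) = 0

theorem reduced_of_determining (hV : ContDiffOn ℝ ∞ V B.dom)
    (hD : ∀ p ∈ B.dom, Determining E V p) : Reduced E B V := by
  have hS := isOpen_dom B
  have hcv := convex_dom B
  have hτ := contDiffOn_tauOf hV
  have hξ := contDiffOn_xiOf hV
  have hθ := contDiffOn_thetaOf hV
  have htx : ∀ p ∈ B.dom, pd ex (pd et (tauOf V)) p = 0 := fun p hp => by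
    rw [pd_comm hS hτ hp]; exact pd_eq_zero hS (fun q hq => (hD q hq).tau_x) _ hp
  have htu : ∀ p ∈ B.dom, pd eu (pd et (tauOf V)) p = 0 := fun p hp => by
    rw [pd_comm hS hτ hp]; exact pd_eq_zero hS (fun q hq => (hD q hq).tau_u) _ hp
  have hxtu : ∀ p ∈ B.dom, pd eu (pd et (xiOf V)) p = 0 := fun p hp => by
    rw [pd_comm hS hξ hp]; exact pd_eq_zero hS (fun q hq => (hD q hq).xi_u) _ hp
  have hxxu : ∀ p ∈ B.dom, pd eu (pd ex (xiOf V)) p = 0 := fun p hp => by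
    rw [pd_comm hS hξ hp]; exact pd_eq_zero hS (fun q hq => (hD q hq).xi_u) _ hp
  have hline : ∀ {f : Pt → ℝ}, ContDiffOn ℝ ∞ f B.dom → ∀ {v : Pt},
      (∀ r ∈ B.dom, pd v f r = 0) → ∀ p ∈ B.dom, ∀ s : ℝ, p + s • v ∈ B.dom →
      f (p + s • v) = f p := by
    intro f hf v h0 p hp s hs
    refine (eq_of_pd_eq_zero hS hcv hf hp hs fun r hr => ?_).symm
    rw [add_sub_cancel_left, pd, map_smul]
    have := h0 r hr
    rw [pd] at this
    rw [this, smul_zero]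
  -- The equation 2g ξ_x = g τ_t + g' τ has a right-hand side that depends on t alone, so ξ_x is
  -- constant along x.
  have hxxx : ∀ p ∈ B.dom, pd ex (pd ex (xiOf V)) p = 0 := fun p hp => by
    refine pd_eq_zero_of_line hS (contDiffOn_pd hS hξ ex) hp fun s hs => ?_
    have e1 := (hD p hp).xi_x
    have e2 := (hD _ hs).xi_x
    rw [hline (contDiffOn_pd hS hτ et) htx p hp s hs,
      hline hτ (fun r hr => (hD r hr).tau_x) p hp s hs] at e2
    have e3 : (p + s • ex).1 = p.1 := by simp
    rw [e3] at e2
    exact mul_left_cancel₀ (mul_ne_zero two_ne_zero (E.g_ne_zero p.1 hp.1)) (e2.trans e1.symm)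
  refine ⟨htx, htu, hxtu, hxxu, hxxx, fun p hp v hv => ?_⟩
  -- The determining equation is evaluated at the point with the same (t, x) and with u replaced by
  -- v.
  have hmem : p + (v - p.2.2) • eu ∈ B.dom := by
    refine ⟨?_, ?_, ?_⟩ <;> simp [hp.1, hp.2.1, hv]
  -- Since θ_uu = 0, θ is affine in u; this function is its intercept, which does not depend on u.
  have hB : ContDiffOn ℝ ∞ (fun q : Pt => thetaOf V q - q.2.2 * pd eu (thetaOf V) q) B.dom :=
    hθ.sub ((contDiff_snd.snd.contDiffOn).mul (contDiffOn_pd hS hθ eu))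
  have hB0 : ∀ q ∈ B.dom, pd eu (fun q : Pt => thetaOf V q - q.2.2 * pd eu (thetaOf V) q) q = 0 := by
    intro q hq
    have d1 := differentiableAt_of_contDiffOn hS hθ hq
    have d2 := differentiableAt_of_contDiffOn hS (contDiffOn_pd hS hθ eu) hq
    have d3 : DifferentiableAt ℝ (fun q : Pt => q.2.2) q := by fun_prop
    have e : pd eu (fun q : Pt => q.2.2) q = 1 := by
      have h3 : HasFDerivAt (fun p : Pt => p.2.2)
        ((ContinuousLinearMap.snd ℝ ℝ ℝ).comp (ContinuousLinearMap.snd ℝ ℝ (ℝ × ℝ))) q :=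
        hasFDerivAt_snd.comp q hasFDerivAt_snd
      rw [pd, h3.fderiv]; simp
    rw [pd_sub d1 (d3.fun_mul d2), pd_mul d3 d2, e, (hD q hq).theta_uu]
    ring
  have hθxu : ∀ q ∈ B.dom, pd eu (pd ex (pd eu (thetaOf V))) q = 0 := fun q hq => by
    rw [pd_comm hS (contDiffOn_pd hS hθ eu) hq]
    exact pd_eq_zero hS (fun r hr => (hD r hr).theta_uu) _ hq
  have key := (hD _ hmem).theta
  have hBp := hline hB hB0 p hp _ hmem
  rw [hxxx _ hmem, hline (contDiffOn_pd hS hτ et) htu p hp _ hmem,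
    hline (contDiffOn_pd hS hξ ex) hxxu p hp _ hmem,
    hline (contDiffOn_pd hS hξ et) hxtu p hp _ hmem,
    hline (contDiffOn_pd hS (contDiffOn_pd hS hθ eu) ex) hθxu p hp _ hmem] at key
  rw [hline (contDiffOn_pd hS hθ eu) (fun r hr => (hD r hr).theta_uu) p hp _ hmem] at hBp
  have c1 : (p + (v - p.2.2) • eu).1 = p.1 := by simp
  have c2 : (p + (v - p.2.2) • eu).2.2 = v := by simp
  rw [c1, c2] at key
  rw [c2] at hBp
  have hvp := rpow_sub_two_mul E.n_ne_one (B.power_J.ne_zero_or E.n_ne_zero E.n_ne_one hv)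
  linear_combination key - E.a * E.n * (E.n - 1) * v ^ (E.n - 2) * hBp
    - E.a * E.n * (E.n - 1) * pd eu (thetaOf V) p * hvp

theorem admissible_of_eqOn {c : Params} (hD : ∀ p ∈ B.dom, Determining E V p)
    (hn : E.n = 2 ∨ c 0 = 0 ∧ c 4 = 0)
    (hτ : ∀ p ∈ B.dom, tauOf V p = c 0 * p.1 ^ 2 + c 1 * p.1 + c 2)
    (hτt : ∀ p ∈ B.dom, pd et (tauOf V) p = 2 * c 0 * p.1 + c 1)
    (hξx : ∀ p ∈ B.dom, pd ex (xiOf V) p = c 0 * p.1 + c 3) : Admissible E c := by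
  refine ⟨hn, fun t ht => ?_⟩
  obtain ⟨x, hx⟩ := B.interval_X.2.2
  obtain ⟨u, hu⟩ := B.interval_J.2.2
  have hp : (t, x, u) ∈ B.dom := ⟨ht, hx, hu⟩
  have := (hD _ hp).xi_x
  rw [hτ _ hp, hτt _ hp, hξx _ hp] at this
  simp only at this
  linarith

/-- Here the powers of u in the `Reduced.theta` identity are independent, so it splits into three
relations. They give θ = u θ_u with (n - 1)θ_u = ξ_x - τ_t, a function of t only; hence θ_xu = 0 and
ξ_t = 0. Then ξ_x is constant, the last determining equation gives θ_t = 0, and θ_u and τ_t are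
constant as well. -/
theorem exists_params_of_ne_two (hn : E.n ≠ 2) (hV : ContDiffOn ℝ ∞ V B.dom)
    (hD : ∀ p ∈ B.dom, Determining E V p) :
    ∃ c, Admissible E c ∧ Set.EqOn V (symField E.a E.n c) B.dom := by
  have hS := isOpen_dom B
  have hcv := convex_dom B
  have hτ := contDiffOn_tauOf hV
  have hξ := contDiffOn_xiOf hV
  have hθ := contDiffOn_thetaOf hV
  have hR := reduced_of_determining hV hD
  have ha := E.a_ne_zero
  have hn0 := E.n_ne_zero
  have hn1 : E.n - 1 ≠ 0 := sub_ne_zero.2 E.n_ne_one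
  have hind : ∀ p ∈ B.dom, _ ∧ _ ∧ _ := fun p hp =>
    powers_independent B.interval_J B.power_J E.n_ne_one hn (hR.theta p hp)
  have h1 : ∀ p ∈ B.dom, pd et (tauOf V) p - pd ex (xiOf V) p
      + (E.n - 1) * pd eu (thetaOf V) p = 0 := fun p hp =>
    (mul_eq_zero.1 (hind p hp).1).resolve_left (mul_ne_zero ha hn0)
  have h2 : ∀ p ∈ B.dom, thetaOf V p = p.2.2 * pd eu (thetaOf V) p := fun p hp =>
    sub_eq_zero.1 <| (mul_eq_zero.1 (hind p hp).2.1).resolve_left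
      (mul_ne_zero (mul_ne_zero ha hn0) hn1)
  have hθu : Set.EqOn (pd eu (thetaOf V))
      (fun p => (E.n - 1)⁻¹ * (pd ex (xiOf V) p - pd et (tauOf V) p)) B.dom := fun p hp => by
    have := h1 p hp
    field_simp
    linarith
  have dxi : ∀ p ∈ B.dom, DifferentiableAt ℝ (pd ex (xiOf V)) p := fun p hp =>
    differentiableAt_of_contDiffOn hS (contDiffOn_pd hS hξ ex) hp
  have dtau : ∀ p ∈ B.dom, DifferentiableAt ℝ (pd et (tauOf V)) p := fun p hp =>
    differentiableAt_of_contDiffOn hS (contDiffOn_pd hS hτ et) hp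
  have hθux : ∀ p ∈ B.dom, pd ex (pd eu (thetaOf V)) p = 0 := fun p hp => by
    rw [pd_congr hS hθu ex hp, pd_mul (by fun_prop) ((dxi p hp).fun_sub (dtau p hp)),
      pd_sub (dxi p hp) (dtau p hp), hR.xi_xx p hp, hR.tau_tx p hp, pd_const]
    ring
  have hξt : ∀ p ∈ B.dom, pd et (xiOf V) p = 0 := fun p hp => by
    have := (hind p hp).2.2
    rw [hθux p hp] at this
    linarith
  have hξxt : ∀ p ∈ B.dom, pd et (pd ex (xiOf V)) p = 0 := fun p hp => by
    rw [pd_comm hS hξ hp]; exact pd_eq_zero hS hξt _ hp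
  obtain ⟨c3, hc3⟩ := eq_const_of_pd_eq_zero hS hcv (contDiffOn_pd hS hξ ex) fun v p hp =>
    pd_eq_zero_of_basis (hξxt p hp) (hR.xi_xx p hp) (hR.xi_xu p hp) v
  have hθx : ∀ p ∈ B.dom, pd ex (thetaOf V) p = 0 := fun p hp => by
    rw [pd_congr hS h2 ex hp, pd_mul (by fun_prop)
      (differentiableAt_of_contDiffOn hS (contDiffOn_pd hS hθ eu) hp), hθux p hp,
      show (fun q : Pt => q.2.2) = quad 0 0 0 0 0 1 0 by funext q; simp [quad], pd_ex_quad]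
    simp [quad]
  have hθt : ∀ p ∈ B.dom, pd et (thetaOf V) p = 0 := fun p hp => by
    have := (hD p hp).theta_t
    rw [hθx p hp, pd_eq_zero hS hθx _ hp] at this
    linarith
  have hθut : ∀ p ∈ B.dom, pd et (pd eu (thetaOf V)) p = 0 := fun p hp => by
    rw [pd_comm hS hθ hp]; exact pd_eq_zero hS hθt _ hp
  obtain ⟨m, hm⟩ := eq_const_of_pd_eq_zero hS hcv (contDiffOn_pd hS hθ eu) fun v p hp =>
    pd_eq_zero_of_basis (hθut p hp) (hθux p hp) (hD p hp).theta_uu v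
  have hτt : ∀ p ∈ B.dom, pd et (tauOf V) p = c3 - (E.n - 1) * m := fun p hp => by
    have := h1 p hp
    rw [hc3 p hp, hm p hp] at this
    linarith
  obtain ⟨c2, hc2⟩ := exists_eqOn_quad hS hcv hτ (A := 0) (B := 0) (C := 0)
    (D := c3 - (E.n - 1) * m) (E := 0) (F := 0)
    (fun p hp => by rw [hτt p hp]; ring) (fun p hp => by rw [(hD p hp).tau_x]; ring)
    (fun p hp => by rw [(hD p hp).tau_u]; ring)
  obtain ⟨c5, hc5⟩ := exists_eqOn_quad hS hcv hξ (A := 0) (B := 0) (C := 0)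
    (D := 0) (E := c3) (F := 0)
    (fun p hp => by rw [hξt p hp]; ring) (fun p hp => by rw [hc3 p hp]; ring)
    (fun p hp => by rw [(hD p hp).xi_u]; ring)
  refine ⟨![0, c3 - (E.n - 1) * m, c2, c3, 0, c5], admissible_of_eqOn hD (Or.inr (by simp))
    ?_ ?_ ?_, ?_⟩
  · intro p hp; rw [hc2 p hp]; simp [quad]
  · intro p hp; rw [hτt p hp]; simp
  · intro p hp; rw [hc3 p hp]; simp
  · intro p hp
    have e1 := hc2 p hp
    have e2 := hc5 p hp
    have e3 := h2 p hp
    rw [hm p hp] at e3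
    refine Prod.ext ?_ (Prod.ext ?_ ?_)
    · refine e1.trans ?_
      simp [quad, symField_apply]
    · refine e2.trans ?_
      simp [quad, symField_apply]
    · refine e3.trans ?_
      simp [symField_apply]
      field_simp

/-- For n = 2 the power `u ^ (n - 2)` is constant, so only two relations split off, and they give θ
= u(ξ_x - τ_t) + ξ_t/(2a). Inserted in the last determining equation, this gives u(2ξ_xt - τ_tt) +
ξ_tt/(2a) = 0. Hence ξ_tt = 0 and τ_tt = 2ξ_xt is constant, which leaves room for the projective and
Galilean terms c₀ and c₄. -/
theorem exists_params_of_eq_two (hn : E.n = 2) (hV : ContDiffOn ℝ ∞ V B.dom)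
    (hD : ∀ p ∈ B.dom, Determining E V p) :
    ∃ c, Admissible E c ∧ Set.EqOn V (symField E.a E.n c) B.dom := by
  have hS := isOpen_dom B
  have hcv := convex_dom B
  have hτ := contDiffOn_tauOf hV
  have hξ := contDiffOn_xiOf hV
  have hθ := contDiffOn_thetaOf hV
  have hR := reduced_of_determining hV hD
  have ha := E.a_ne_zero
  have hind : ∀ p ∈ B.dom, _ ∧ _ := fun p hp =>
    affine_eq_zero_on B.interval_J (B := 2 * E.a * (pd et (tauOf V) p - pd ex (xiOf V) p
      + pd eu (thetaOf V) p)) (C := 2 * E.a * (thetaOf V p - p.2.2 * pd eu (thetaOf V) p)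
      - (pd et (xiOf V) p + 2 * E.g p.1 * pd ex (pd eu (thetaOf V)) p)) fun v hv => by
      have h := hR.theta p hp v hv
      rw [hn, show (2 : ℝ) - 1 = 1 by norm_num, sub_self, Real.rpow_one, Real.rpow_zero] at h
      linear_combination h
  have h1 : ∀ p ∈ B.dom, pd eu (thetaOf V) p = pd ex (xiOf V) p - pd et (tauOf V) p :=
    fun p hp => by
      have := (mul_eq_zero.1 (hind p hp).1).resolve_left (mul_ne_zero two_ne_zero ha)
      linarith
  have dxi : ∀ v, ∀ p ∈ B.dom, DifferentiableAt ℝ (pd v (xiOf V)) p := fun v p hp =>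
    differentiableAt_of_contDiffOn hS (contDiffOn_pd hS hξ v) hp
  have dtau : ∀ p ∈ B.dom, DifferentiableAt ℝ (pd et (tauOf V)) p := fun p hp =>
    differentiableAt_of_contDiffOn hS (contDiffOn_pd hS hτ et) hp
  have hθux : ∀ p ∈ B.dom, pd ex (pd eu (thetaOf V)) p = 0 := fun p hp => by
    rw [pd_congr hS h1 ex hp, pd_sub (dxi ex p hp) (dtau p hp), hR.xi_xx p hp, hR.tau_tx p hp,
      sub_zero]
  have h2 : Set.EqOn (thetaOf V) (fun p => p.2.2 * (pd ex (xiOf V) p - pd et (tauOf V) p)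
      + (2 * E.a)⁻¹ * pd et (xiOf V) p) B.dom := fun p hp => by
    have := (hind p hp).2
    rw [hθux p hp, h1 p hp] at this
    field_simp
    linarith
  have hu : ∀ v, ∀ p : Pt, pd v (fun q : Pt => q.2.2) p = v.2.2 := fun v p => by
    rw [show (fun q : Pt => q.2.2) = quad 0 0 0 0 0 1 0 by funext q; simp [quad], pd, fderiv_quad]
    ring
  have hpd : ∀ v, ∀ p ∈ B.dom, pd v (thetaOf V) p
      = v.2.2 * (pd ex (xiOf V) p - pd et (tauOf V) p)
        + p.2.2 * (pd v (pd ex (xiOf V)) p - pd v (pd et (tauOf V)) p)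
        + (2 * E.a)⁻¹ * pd v (pd et (xiOf V)) p := fun v p hp => by
    have d1 : DifferentiableAt ℝ (fun q : Pt => q.2.2) p := by fun_prop
    have d2 := (dxi ex p hp).fun_sub (dtau p hp)
    have d3 : DifferentiableAt ℝ (fun _ : Pt => (2 * E.a)⁻¹) p := by fun_prop
    rw [pd_congr hS h2 v hp, pd_add (d1.fun_mul d2) (d3.fun_mul (dxi et p hp)), pd_mul d1 d2,
      pd_mul d3 (dxi et p hp), pd_sub (dxi ex p hp) (dtau p hp), hu, pd_const]
    ring
  have hξxtx : ∀ p ∈ B.dom, pd ex (pd et (pd ex (xiOf V))) p = 0 := fun p hp => by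
    rw [pd_comm hS (contDiffOn_pd hS hξ ex) hp]; exact pd_eq_zero hS hR.xi_xx _ hp
  have hξxtu : ∀ p ∈ B.dom, pd eu (pd et (pd ex (xiOf V))) p = 0 := fun p hp => by
    rw [pd_comm hS (contDiffOn_pd hS hξ ex) hp]; exact pd_eq_zero hS hR.xi_xu _ hp
  have hcomm : Set.EqOn (pd ex (pd et (xiOf V))) (pd et (pd ex (xiOf V))) B.dom := fun p hp =>
    pd_comm hS hξ hp _ _
  have hθx : Set.EqOn (pd ex (thetaOf V)) (fun p => (2 * E.a)⁻¹ * pd et (pd ex (xiOf V)) p)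
      B.dom := fun p hp => by
    simp only [hpd ex p hp, hcomm hp, hR.xi_xx p hp, hR.tau_tx p hp]
    ring
  have hθxx : ∀ p ∈ B.dom, pd ex (pd ex (thetaOf V)) p = 0 := fun p hp => by
    rw [pd_congr hS hθx ex hp, pd_mul (by fun_prop) (differentiableAt_of_contDiffOn hS
      (contDiffOn_pd hS (contDiffOn_pd hS hξ ex) et) hp), hξxtx p hp, pd_const]
    ring
  have h3 : ∀ p ∈ B.dom, p.2.2 * (2 * pd et (pd ex (xiOf V)) p - pd et (pd et (tauOf V)) p)
      + (2 * E.a)⁻¹ * pd et (pd et (xiOf V)) p = 0 := fun p hp => by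
    have := (hD p hp).theta_t
    rw [hθxx p hp, hθx hp, hpd et p hp, hn, show (2 : ℝ) - 1 = 1 by norm_num, Real.rpow_one] at this
    field_simp at this ⊢
    linarith
  have hτttu : ∀ p ∈ B.dom, pd eu (pd et (pd et (tauOf V))) p = 0 := fun p hp => by
    rw [pd_comm hS (contDiffOn_pd hS hτ et) hp]; exact pd_eq_zero hS hR.tau_tu _ hp
  have hτttx : ∀ p ∈ B.dom, pd ex (pd et (pd et (tauOf V))) p = 0 := fun p hp => by
    rw [pd_comm hS (contDiffOn_pd hS hτ et) hp]; exact pd_eq_zero hS hR.tau_tx _ hp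
  have hξttu : ∀ p ∈ B.dom, pd eu (pd et (pd et (xiOf V))) p = 0 := fun p hp => by
    rw [pd_comm hS (contDiffOn_pd hS hξ et) hp]; exact pd_eq_zero hS hR.xi_tu _ hp
  have hτtt : ∀ p ∈ B.dom, pd et (pd et (tauOf V)) p = 2 * pd et (pd ex (xiOf V)) p :=
    fun p hp => by
      have d1 : DifferentiableAt ℝ (fun q : Pt => q.2.2) p := by fun_prop
      have d2 : DifferentiableAt ℝ (fun _ : Pt => (2 : ℝ)) p := by fun_prop
      have d3 : DifferentiableAt ℝ (fun _ : Pt => (2 * E.a)⁻¹) p := by fun_prop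
      have d4 := differentiableAt_of_contDiffOn hS
        (contDiffOn_pd hS (contDiffOn_pd hS hξ ex) et) hp
      have d5 := differentiableAt_of_contDiffOn hS
        (contDiffOn_pd hS (contDiffOn_pd hS hτ et) et) hp
      have d6 := differentiableAt_of_contDiffOn hS
        (contDiffOn_pd hS (contDiffOn_pd hS hξ et) et) hp
      -- The derivative in u isolates the coefficient of u, because all other factors depend on (t,
      -- x) only.
      have := pd_eq_zero hS h3 eu hp
      rw [pd_add (d1.fun_mul ((d2.fun_mul d4).fun_sub d5)) (d3.fun_mul d6),
        pd_mul d1 ((d2.fun_mul d4).fun_sub d5), pd_sub (d2.fun_mul d4) d5, pd_mul d2 d4, pd_mul d3 d6, hu, hτttu p hp, hξttu p hp,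
        hξxtu p hp, pd_const, pd_const] at this
      linarith
  have hξtt : ∀ p ∈ B.dom, pd et (pd et (xiOf V)) p = 0 := fun p hp => by
    have := h3 p hp
    rw [hτtt p hp, sub_self, mul_zero, zero_add] at this
    exact (mul_eq_zero.1 this).resolve_left (inv_ne_zero (mul_ne_zero two_ne_zero ha))
  have hξxtt : ∀ p ∈ B.dom, pd et (pd et (pd ex (xiOf V))) p = 0 := fun p hp => by
    rw [← pd_congr hS hcomm et hp, pd_comm hS (contDiffOn_pd hS hξ et) hp]
    exact pd_eq_zero hS hξtt _ hp
  obtain ⟨c0, hc0⟩ := eq_const_of_pd_eq_zero hS hcv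
    (contDiffOn_pd hS (contDiffOn_pd hS hξ ex) et) fun v p hp =>
    pd_eq_zero_of_basis (hξxtt p hp) (hξxtx p hp) (hξxtu p hp) v
  obtain ⟨c3, hc3⟩ := exists_eqOn_quad hS hcv (contDiffOn_pd hS hξ ex) (A := 0) (B := 0) (C := 0)
    (D := c0) (E := 0) (F := 0)
    (fun p hp => by rw [hc0 p hp]; ring) (fun p hp => by rw [hR.xi_xx p hp]; ring)
    (fun p hp => by rw [hR.xi_xu p hp]; ring)
  obtain ⟨c4, hc4⟩ := exists_eqOn_quad hS hcv (contDiffOn_pd hS hξ et) (A := 0) (B := 0) (C := 0)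
    (D := 0) (E := c0) (F := 0)
    (fun p hp => by rw [hξtt p hp]; ring) (fun p hp => by rw [hcomm hp, hc0 p hp]; ring)
    (fun p hp => by rw [hR.xi_tu p hp]; ring)
  obtain ⟨c1, hc1⟩ := exists_eqOn_quad hS hcv (contDiffOn_pd hS hτ et) (A := 0) (B := 0) (C := 0)
    (D := 2 * c0) (E := 0) (F := 0)
    (fun p hp => by rw [hτtt p hp, hc0 p hp]; ring) (fun p hp => by rw [hR.tau_tx p hp]; ring)
    (fun p hp => by rw [hR.tau_tu p hp]; ring)
  obtain ⟨c2, hc2⟩ := exists_eqOn_quad hS hcv hτ (A := c0) (B := 0) (C := 0)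
    (D := c1) (E := 0) (F := 0)
    (fun p hp => by rw [hc1 p hp]; simp only [quad]; ring)
    (fun p hp => by rw [(hD p hp).tau_x]; ring) (fun p hp => by rw [(hD p hp).tau_u]; ring)
  obtain ⟨c5, hc5⟩ := exists_eqOn_quad hS hcv hξ (A := 0) (B := c0) (C := 0)
    (D := c4) (E := c3) (F := 0)
    (fun p hp => by rw [hc4 p hp]; simp only [quad]; ring)
    (fun p hp => by rw [hc3 p hp]; simp only [quad]; ring)
    (fun p hp => by rw [(hD p hp).xi_u]; ring)
  refine ⟨![c0, c1, c2, c3, c4, c5], admissible_of_eqOn hD (Or.inl hn) ?_ ?_ ?_, ?_⟩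
  · intro p hp; rw [hc2 p hp]; simp [quad]
  · intro p hp; rw [hc1 p hp]; simp [quad]
  · intro p hp; rw [hc3 p hp]; simp [quad]
  · intro p hp
    have e1 := hc2 p hp
    have e2 := hc5 p hp
    have e3 := h2 hp
    simp only [hc3 p hp, hc1 p hp, hc4 p hp] at e3
    refine Prod.ext ?_ (Prod.ext ?_ ?_)
    · refine e1.trans ?_
      simp [quad, symField_apply]
    · refine e2.trans ?_
      simp [quad, symField_apply]; ring
    · refine e3.trans ?_
      simp [quad, symField_apply, hn]
      norm_num
      field_simp
      ring

/-- The reduction to ℝ⁶. The converse passes from `symField` to any field that agrees with it on the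
box, since derivatives on an open set depend only on the values there. -/
theorem isLieSymmetry_iff (E : Equation) (B : Box E) (V : VF) :
    IsLieSymmetry E B V ↔ ∃ c, Admissible E c ∧ Set.EqOn V (symField E.a E.n c) B.dom := by
  constructor
  · intro h
    obtain ⟨hV, hD⟩ := (isLieSymmetry_iff_determining E B V).1 h
    by_cases hn : E.n = 2
    · exact exists_params_of_eq_two hn hV hD
    · exact exists_params_of_ne_two hn hV hD
  · rintro ⟨c, hc, hV⟩
    have h := isLieSymmetry_symField (B := B) hc
    rw [isLieSymmetry_iff_determining] at h ⊢
    have hS := isOpen_dom B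
    have e1 : Set.EqOn (tauOf V) (tauOf (symField E.a E.n c)) B.dom := fun p hp => by
      simp only [tauOf, hV hp]
    have e2 : Set.EqOn (xiOf V) (xiOf (symField E.a E.n c)) B.dom := fun p hp => by
      simp only [xiOf, hV hp]
    have e3 : Set.EqOn (thetaOf V) (thetaOf (symField E.a E.n c)) B.dom := fun p hp => by
      simp only [thetaOf, hV hp]
    refine ⟨h.1.congr hV, fun p hp => ?_⟩
    obtain ⟨d1, d2, d3, d4, d5, d6, d7⟩ := h.2 p hp
    have c1 := fun v => pd_congr hS e1 v
    have c2 := fun v => pd_congr hS e2 v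
    have c3 := fun v => pd_congr hS e3 v
    constructor
    · rwa [c1 _ hp]
    · rwa [c1 _ hp]
    · rwa [c2 _ hp]
    · rwa [pd_congr hS (c3 _) _ hp]
    · rwa [c2 _ hp, c1 _ hp, e1 hp]
    · rwa [c2 _ hp, c1 _ hp, e3 hp, c2 _ hp, pd_congr hS (c3 _) _ hp, pd_congr hS (c2 _) _ hp]
    · rwa [c3 _ hp, c3 _ hp, pd_congr hS (c3 _) _ hp]

end Forward

/-! ### Spans and bases given by lists of coefficients -/

theorem spanOf_map (a n : ℝ) (cs : List Params) (W : VF) :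
    W ∈ spanOf (cs.map (symField a n)) ↔
      ∃ c ∈ Submodule.span ℝ {c | c ∈ cs}, W = symField a n c := by
  have h : {W | W ∈ cs.map (symField a n)} = symField a n '' {c | c ∈ cs} := by
    ext W; simp
  rw [spanOf, h, Submodule.span_image, Submodule.mem_map]
  simp only [eq_comm]

theorem linearIndependent_domRestrict {E : Equation} (B : Box E) (a n : ℝ) {cs : List Params}
    (hcs : LinearIndependent ℝ cs.get) :
    LinearIndependent ℝ (fun i : Fin (cs.map (symField a n)).length =>
      B.dom.domRestrict ((cs.map (symField a n)).get i)) := by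
  let L : Params →ₗ[ℝ] (B.dom → Pt) :=
    { toFun := fun c => B.dom.domRestrict (symField a n c)
      map_add' := fun c d => by rw [map_add]; rfl
      map_smul' := fun r c => by rw [map_smul]; rfl }
  have hL : LinearMap.ker L = ⊥ := by
    rw [LinearMap.ker_eq_bot']
    intro c hc
    exact symField_injOn E.interval_I B.interval_X B.interval_J fun p hp => congrFun hc ⟨p, hp⟩
  have hlen : (cs.map (symField a n)).length = cs.length := List.length_map _
  have h := (hcs.map' L hL).comp (Fin.cast hlen) (Fin.cast_injective hlen)
  have e : (fun i : Fin (cs.map (symField a n)).length =>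
      B.dom.domRestrict ((cs.map (symField a n)).get i)) = (L ∘ cs.get) ∘ Fin.cast hlen := by
    funext i
    simp [L]
  rw [e]
  exact h

/-- A list of coefficients spanning the admissible ones yields a basis of the algebra. -/
theorem isBasisOfMaxAlgebra_map {E : Equation} (B : Box E) {cs : List Params}
    (hcs : LinearIndependent ℝ cs.get)
    (hspan : ∀ c, c ∈ Submodule.span ℝ {c | c ∈ cs} ↔ Admissible E c) :
    IsBasisOfMaxAlgebra E B (cs.map (symField E.a E.n)) := by
  refine ⟨linearIndependent_domRestrict B E.a E.n hcs, fun V => ?_⟩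
  rw [isLieSymmetry_iff]
  constructor
  · rintro ⟨c, hc, h⟩
    exact ⟨_, (spanOf_map _ _ _ _).2 ⟨c, (hspan c).2 hc, rfl⟩, h⟩
  · rintro ⟨W, hW, h⟩
    obtain ⟨c, hc, rfl⟩ := (spanOf_map _ _ _ _).1 hW
    exact ⟨c, (hspan c).1 hc, h⟩

/-- Together with `mem_span_nil`, this lets `simp` unroll membership in the span of an explicit list
into the existence of scalars satisfying six coordinate equations. -/
theorem mem_span_cons {x : Params} {cs : List Params} {c : Params} :
    c ∈ Submodule.span ℝ {c | c ∈ x :: cs} ↔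
      ∃ r : ℝ, c - r • x ∈ Submodule.span ℝ {c | c ∈ cs} := by
  rw [show {c | c ∈ x :: cs} = insert x {c | c ∈ cs} by ext; simp, Submodule.mem_span_insert]
  refine exists_congr fun r => ⟨?_, fun h => ⟨_, h, by abel⟩⟩
  rintro ⟨d, hd, rfl⟩
  rwa [add_sub_cancel_left]

theorem mem_span_nil {c : Params} : c ∈ Submodule.span ℝ {c | c ∈ ([] : List Params)} ↔ c = 0 := by
  simp

theorem linearIndependent_get_cons {x : Params} {cs : List Params} :
    LinearIndependent ℝ (x :: cs).get ↔
      LinearIndependent ℝ cs.get ∧ x ∉ Submodule.span ℝ {c | c ∈ cs} := by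
  have h : (x :: cs).get = Fin.cons x cs.get := by
    funext i
    refine Fin.cases ?_ (fun j => ?_) i <;> simp
  rw [h, linearIndependent_finCons, show Set.range cs.get = {c | c ∈ cs} by
    ext; simp [List.mem_iff_get]]

theorem linearIndependent_get_nil : LinearIndependent ℝ ([] : List Params).get :=
  have : IsEmpty (Fin ([] : List Params).length) := inferInstanceAs (IsEmpty (Fin 0))
  linearIndependent_empty_type

/-! ### The rows of the table -/

/-- The function `g` satisfies `(q₀ t² + q₁ t + q₂) g' = k g`, with a factor that does not vanish. -/
def LogDeriv (E : Equation) (q : Fin 3 → ℝ) (k : ℝ) : Prop :=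
  ∀ t ∈ E.I, q 0 * t ^ 2 + q 1 * t + q 2 ≠ 0 ∧
    (q 0 * t ^ 2 + q 1 * t + q 2) * deriv E.g t = k * E.g t

theorem LogDeriv.admissible_iff {E : Equation} {q : Fin 3 → ℝ} {k : ℝ} (h : LogDeriv E q k)
    (c : Params) : Admissible E c ↔ (E.n = 2 ∨ c 0 = 0 ∧ c 4 = 0) ∧
      k * c 0 = (2 * c 3 - c 1) * q 0 ∧ k * c 1 = (2 * c 3 - c 1) * q 1 ∧
      k * c 2 = (2 * c 3 - c 1) * q 2 := by
  refine and_congr_right fun _ => ⟨fun hc => ?_, fun ⟨h0, h1, h2⟩ t ht => ?_⟩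
  · obtain ⟨h0, h1, h2⟩ := quadratic_eq_zero_on E.interval_I
      -- Eliminating g' between the two equations for g gives (k τ - (2c₃ - c₁) q) g = 0, and the
      -- quadratic factor must vanish identically.
      (A := k * c 0 - (2 * c 3 - c 1) * q 0) (B := k * c 1 - (2 * c 3 - c 1) * q 1)
      (C := k * c 2 - (2 * c 3 - c 1) * q 2) fun t ht => by
        refine (mul_eq_zero.1 ?_).resolve_right (E.g_ne_zero t ht)
        linear_combination (q 0 * t ^ 2 + q 1 * t + q 2) * hc t ht
          - (c 0 * t ^ 2 + c 1 * t + c 2) * (h t ht).2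
    exact ⟨sub_eq_zero.1 h0, sub_eq_zero.1 h1, sub_eq_zero.1 h2⟩
  · obtain ⟨hq, hg⟩ := h t ht
    apply mul_left_cancel₀ hq
    linear_combination (c 0 * t ^ 2 + c 1 * t + c 2) * hg
      + E.g t * (t ^ 2 * h0 + t * h1 + h2)

namespace Row

/-- Coefficients of the polynomial Q in the equation Q g' = k g satisfied by the function g of the
row; the constant k is `Row.rate`. -/
def quad : Row → Fin 3 → ℝ
  | row2 _ _ _ => ![0, 1, 0]
  | row3 _ _ => ![0, 0, 1]
  | row4 _ => ![0, 0, 1]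
  | row6 _ _ => ![0, 1, 0]
  | row7 _ => ![0, 0, 1]
  | row8 _ _ => ![1, 0, 1]
  | row9 => ![0, 0, 1]

def rate : Row → ℝ
  | row2 _ _ ρ => ρ
  | row3 _ _ => 1
  | row4 _ => 0
  | row6 _ ρ => ρ
  | row7 _ => 1
  | row8 _ ρ => 2 * ρ
  | row9 => 0

/-- The coefficients of the basis operators of the row. -/
noncomputable def params : Row → List Params
  | row2 _ _ ρ => [![0, 0, 0, 0, 0, 1], ![0, 2, 0, ρ + 1, 0, 0]]
  | row3 _ _ => [![0, 0, 0, 0, 0, 1], ![0, 0, 2, 1, 0, 0]]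
  | row4 _ => [![0, 0, 0, 0, 0, 1], ![0, 0, 1, 0, 0, 0], ![0, 2, 0, 1, 0, 0]]
  | row6 _ ρ => [![0, 0, 0, 0, 0, 1], ![0, 0, 0, 0, 1, 0], ![0, 2, 0, ρ + 1, 0, 0]]
  | row7 _ => [![0, 0, 0, 0, 0, 1], ![0, 0, 0, 0, 1, 0], ![0, 0, 2, 1, 0, 0]]
  | row8 _ ρ => [![0, 0, 0, 0, 0, 1], ![0, 0, 0, 0, 1, 0], ![1, 0, 1, ρ, 0, 0]]
  | row9 => [![0, 0, 0, 0, 0, 1], ![0, 0, 0, 0, 1, 0], ![0, 0, 1, 0, 0, 0], ![0, 2, 0, 1, 0, 0],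
      ![1, 0, 0, 0, 0, 0]]

end Row

theorem dx_eq (a n : ℝ) : dx = symField a n ![0, 0, 0, 0, 0, 1] := by
  funext p; simp [dx, symField_apply]

theorem dt_eq (a n : ℝ) : dt = symField a n ![0, 0, 1, 0, 0, 0] := by
  funext p; simp [dt, symField_apply]

theorem galilei_eq {a : ℝ} (n : ℝ) (ha : a ≠ 0) :
    galilei a = symField a n ![0, 0, 0, 0, 2 * a, 0] := by
  funext p; simp [galilei, symField_apply, ha]

theorem Row.basis_eq {R : Row} {n : ℝ} (hn : n = R.n) :
    R.basis = R.params.map (symField (1 / n) n) := by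
  subst hn
  have h2 : (2 : ℝ) - 1 = 1 := by norm_num
  have hG : galilei (1 / 2) = symField (1 / 2) 2 ![0, 0, 0, 0, 1, 0] := by
    rw [galilei_eq 2 (by norm_num : (1 / 2 : ℝ) ≠ 0)]; norm_num
  cases R <;>
    simp only [Row.basis, Row.params, Row.n, List.map_cons, List.map_nil, ← dx_eq, ← dt_eq, ← hG,
      List.cons.injEq, and_true, true_and] <;>
    (try refine ⟨?_, ?_⟩) <;> funext p <;>
    simp only [symField_apply, Matrix.cons_val, h2, Prod.mk.injEq] <;>
    refine ⟨?_, ?_, ?_⟩ <;> ring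

theorem Row.linearIndependent_params (R : Row) : LinearIndependent ℝ R.params.get := by
  cases R <;>
    simp only [Row.params, linearIndependent_get_cons, linearIndependent_get_nil, mem_span_cons,
      mem_span_nil] <;>
    simp [funext_iff, Fin.forall_fin_succ]

/-- In the power rows, g(t) ≠ 0 and ρ ≠ 0 exclude t = 0. There both Q and the differentiability of
the power could fail. -/
theorem Row.hasDerivAt_g {R : Row} {t : ℝ} (hR : R.Valid) (ht : R.g t ≠ 0) :
    R.quad 0 * t ^ 2 + R.quad 1 * t + R.quad 2 ≠ 0 ∧ ∃ g', HasDerivAt R.g g' t ∧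
      (R.quad 0 * t ^ 2 + R.quad 1 * t + R.quad 2) * g' = R.rate * R.g t := by
  have hpow : ∀ ε ρ : ℝ, ρ ≠ 0 → ε * t ^ ρ ≠ 0 → t ≠ 0 ∧ ∃ g',
      HasDerivAt (fun t : ℝ => ε * t ^ ρ) g' t ∧ t * g' = ρ * (ε * t ^ ρ) := by
    intro ε ρ hρ h
    have h0 : t ≠ 0 := by
      rintro rfl
      rw [Real.zero_rpow hρ, mul_zero] at h
      exact h rfl
    refine ⟨h0, _, (Real.hasDerivAt_rpow_const (Or.inl h0)).const_mul ε, ?_⟩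
    have : t ^ ρ = t ^ (ρ - 1) * t := by rw [← Real.rpow_add_one h0]; ring_nf
    rw [this]; ring
  cases R with
  | row2 n ε ρ => simpa [Row.quad, Row.rate, Row.g] using hpow ε ρ hR.2.2 ht
  | row6 ε ρ => simpa [Row.quad, Row.rate, Row.g] using hpow ε ρ hR.2 ht
  | row3 n ε =>
    exact ⟨by simp [Row.quad], _, (Real.hasDerivAt_exp t).const_mul ε, by
      simp [Row.quad, Row.rate, Row.g]⟩
  | row7 ε =>
    exact ⟨by simp [Row.quad], _, (Real.hasDerivAt_exp t).const_mul ε, by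
      simp [Row.quad, Row.rate, Row.g]⟩
  | row4 n => exact ⟨by simp [Row.quad], 0, hasDerivAt_const _ _, by simp [Row.rate]⟩
  | row9 => exact ⟨by simp [Row.quad], 0, hasDerivAt_const _ _, by simp [Row.rate]⟩
  | row8 ε ρ =>
    have h0 : t ^ 2 + 1 ≠ 0 := by positivity
    refine ⟨?_, _, (((Real.hasDerivAt_arctan t).const_mul (2 * ρ)).exp).const_mul ε, ?_⟩
    · simpa [Row.quad] using h0
    · simp [Row.quad, Row.rate, Row.g]
      field_simp
      ring

theorem InRow.logDeriv {E : Equation} {R : Row} (h : InRow E R) : LogDeriv E R.quad R.rate := by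
  obtain ⟨hR, -, -, -, hg⟩ := h
  intro t ht
  obtain ⟨h1, g', h2, h3⟩ := Row.hasDerivAt_g hR (hg t ht ▸ E.g_ne_zero t ht)
  refine ⟨h1, ?_⟩
  have : E.g =ᶠ[nhds t] R.g := by
    filter_upwards [E.interval_I.1.mem_nhds ht] with s hs using hg s hs
  rw [this.deriv_eq, h2.deriv, h3, hg t ht]

theorem params_eq_zero_iff {c : Params} :
    c = 0 ↔ c 0 = 0 ∧ c 1 = 0 ∧ c 2 = 0 ∧ c 3 = 0 ∧ c 4 = 0 ∧ c 5 = 0 := by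
  constructor
  · rintro rfl; simp
  · rintro ⟨h0, h1, h2, h3, h4, h5⟩
    funext i
    fin_cases i
    exacts [h0, h1, h2, h3, h4, h5]

/-- The right-hand side is the linear system of `LogDeriv.admissible_iff` with the data of the row,
so the tabulated coefficients are a basis of its solution space. -/
theorem Row.mem_span_params_iff {R : Row} (hR : R.Valid) (c : Params) :
    c ∈ Submodule.span ℝ {c | c ∈ R.params} ↔ (R.n = 2 ∨ c 0 = 0 ∧ c 4 = 0) ∧
      R.rate * c 0 = (2 * c 3 - c 1) * R.quad 0 ∧ R.rate * c 1 = (2 * c 3 - c 1) * R.quad 1 ∧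
      R.rate * c 2 = (2 * c 3 - c 1) * R.quad 2 := by
  cases R <;>
    simp only [Row.params, mem_span_cons, mem_span_nil, Row.n, Row.rate, Row.quad,
      params_eq_zero_iff, Pi.sub_apply, Pi.smul_apply, smul_eq_mul, Matrix.cons_val, mul_zero,
      mul_one, sub_zero] <;>
    simp only [Row.Valid] at hR
  case row2 n ε ρ =>
    constructor
    · rintro ⟨r, s, h0, h1, h2, h3, h4, h5⟩
      exact ⟨Or.inr ⟨h0, h4⟩, by rw [h0, mul_zero], by linear_combination (ρ + 1) * h1 - 2 * h3,
        by rw [h2, mul_zero]⟩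
    · rintro ⟨h, h0, h1, h2⟩
      obtain ⟨h0, h4⟩ := h.resolve_left hR.1
      exact ⟨c 5, c 1 / 2, h0, by ring, (mul_eq_zero.1 h2).resolve_left hR.2.2,
        by linear_combination (-1 / 2) * h1, h4, by ring⟩
  case row3 n ε =>
    constructor
    · rintro ⟨r, s, h0, h1, h2, h3, h4, h5⟩
      exact ⟨Or.inr ⟨h0, h4⟩, by rw [h0, mul_zero], by rw [h1, mul_zero],
        by linear_combination h2 - 2 * h3 + h1⟩
    · rintro ⟨h, h0, h1, h2⟩
      obtain ⟨h0, h4⟩ := h.resolve_left hR.1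
      exact ⟨c 5, c 2 / 2, h0, by linarith, by ring, by linarith, h4, by ring⟩
  case row4 n =>
    constructor
    · rintro ⟨r, s, s', h0, h1, h2, h3, h4, h5⟩
      exact ⟨Or.inr ⟨h0, h4⟩, by ring, by ring, by linarith⟩
    · rintro ⟨h, -, -, h2⟩
      obtain ⟨h0, h4⟩ := h.resolve_left hR
      exact ⟨c 5, c 2, c 3, h0, by linarith, by ring, by ring, h4, by ring⟩
  case row6 ε ρ =>
    constructor
    · rintro ⟨r, s', s, h0, h1, h2, h3, h4, h5⟩
      exact ⟨Or.inl trivial, by rw [h0, mul_zero], by linear_combination (ρ + 1) * h1 - 2 * h3,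
        by rw [h2, mul_zero]⟩
    · rintro ⟨-, h0, h1, h2⟩
      exact ⟨c 5, c 4, c 1 / 2, (mul_eq_zero.1 h0).resolve_left hR.2, by ring,
        (mul_eq_zero.1 h2).resolve_left hR.2, by linear_combination (-1 / 2) * h1, by ring, by ring⟩
  case row7 ε =>
    constructor
    · rintro ⟨r, s', s, h0, h1, h2, h3, h4, h5⟩
      exact ⟨Or.inl trivial, by rw [h0, mul_zero], by rw [h1, mul_zero],
        by linear_combination h2 - 2 * h3 + h1⟩
    · rintro ⟨-, h0, h1, h2⟩
      exact ⟨c 5, c 4, c 2 / 2, by linarith, by linarith, by ring, by linarith, by ring, by ring⟩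
  case row8 ε ρ =>
    constructor
    · rintro ⟨r, s', s, h0, h1, h2, h3, h4, h5⟩
      exact ⟨Or.inl trivial, by linear_combination 2 * ρ * h0 - 2 * h3 + h1,
        by rw [h1, mul_zero], by linear_combination 2 * ρ * h2 - 2 * h3 + h1⟩
    · rintro ⟨-, h0, h1, h2⟩
      have hρ : 2 * ρ ≠ 0 := mul_ne_zero two_ne_zero hR.2
      have h1' : c 1 = 0 := (mul_eq_zero.1 h1).resolve_left hρ
      exact ⟨c 5, c 4, c 0, by ring, h1', sub_eq_zero.2 (mul_left_cancel₀ hρ (h2.trans h0.symm)),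
        by linear_combination (-1 / 2) * h0 + (1 / 2) * h1', by ring, by ring⟩
  case row9 =>
    constructor
    · rintro ⟨r, s₁, s₂, s₃, s₄, h0, h1, h2, h3, h4, h5⟩
      exact ⟨Or.inl trivial, by ring, by ring, by linarith⟩
    · rintro ⟨-, -, -, h2⟩
      exact ⟨c 5, c 4, c 2, c 3, c 0, by ring, by linarith, by ring, by ring, by ring, by ring⟩

theorem InRow.mem_span_iff {E : Equation} {R : Row} (h : InRow E R) (c : Params) :
    c ∈ Submodule.span ℝ {c | c ∈ R.params} ↔ Admissible E c := by
  rw [h.logDeriv.admissible_iff, h.2.2.1, Row.mem_span_params_iff h.1]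

theorem InRow.isBasis {E : Equation} {R : Row} (h : InRow E R) (B : Box E) :
    IsBasisOfMaxAlgebra E B R.basis := by
  rw [Row.basis_eq h.2.2.1, ← h.2.2.2.1]
  exact isBasisOfMaxAlgebra_map B R.linearIndependent_params h.mem_span_iff

theorem InRow.mem_spanOf_basis_iff {E : Equation} {R : Row} (h : InRow E R) (W : VF) :
    W ∈ spanOf R.basis ↔ ∃ c, Admissible E c ∧ W = symField E.a E.n c := by
  rw [Row.basis_eq h.2.2.1, ← h.2.2.2.1, spanOf_map]
  simp only [h.mem_span_iff]

/-! ### The kernel -/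

/-- The coefficients of the operators of the kernel. -/
def IsKernel (n : ℝ) (c : Params) : Prop :=
  (c 0 = 0 ∧ c 1 = 0 ∧ c 2 = 0 ∧ c 3 = 0) ∧ (n = 2 ∨ c 4 = 0)

theorem IsKernel.admissible {E : Equation} {c : Params} (h : IsKernel E.n c) : Admissible E c := by
  obtain ⟨⟨h0, h1, h2, h3⟩, h4⟩ := h
  refine ⟨h4.imp_right fun h4 => ⟨h0, h4⟩, fun t _ => ?_⟩
  rw [h0, h1, h2, h3]; ring

theorem map_kernel_params (a n : ℝ) :
    [dx] = [![0, 0, 0, 0, 0, 1]].map (symField a n) := by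
  rw [dx_eq a n]; rfl

theorem map_kernel_params_two {a : ℝ} (ha : a ≠ 0) (n : ℝ) :
    [dx, galilei a] = [![0, 0, 0, 0, 0, 1], ![0, 0, 0, 0, 2 * a, 0]].map (symField a n) := by
  rw [dx_eq a n, galilei_eq n ha]; rfl

theorem mem_span_kernel {n : ℝ} (hn : n ≠ 2) (c : Params) :
    c ∈ Submodule.span ℝ {c | c ∈ [(![0, 0, 0, 0, 0, 1] : Params)]} ↔ IsKernel n c := by
  simp only [mem_span_cons, mem_span_nil, params_eq_zero_iff, Pi.sub_apply, Pi.smul_apply,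
    smul_eq_mul, Matrix.cons_val, mul_zero, mul_one, sub_zero, IsKernel, hn, false_or]
  exact ⟨fun ⟨r, h0, h1, h2, h3, h4, h5⟩ => ⟨⟨h0, h1, h2, h3⟩, h4⟩,
    fun ⟨⟨h0, h1, h2, h3⟩, h4⟩ => ⟨c 5, h0, h1, h2, h3, h4, sub_self _⟩⟩

theorem mem_span_kernel_two {a : ℝ} (ha : a ≠ 0) (c : Params) :
    c ∈ Submodule.span ℝ {c | c ∈ [(![0, 0, 0, 0, 0, 1] : Params), ![0, 0, 0, 0, 2 * a, 0]]} ↔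
      IsKernel 2 c := by
  simp only [mem_span_cons, mem_span_nil, params_eq_zero_iff, Pi.sub_apply, Pi.smul_apply,
    smul_eq_mul, Matrix.cons_val, mul_zero, mul_one, sub_zero, IsKernel, true_or, and_true]
  exact ⟨fun ⟨r, s, h0, h1, h2, h3, h4, h5⟩ => ⟨h0, h1, h2, h3⟩,
    fun ⟨h0, h1, h2, h3⟩ => ⟨c 5, c 4 / (2 * a), h0, h1, h2, h3, by field_simp; ring, sub_self _⟩⟩

theorem linearIndependent_kernel : LinearIndependent ℝ [(![0, 0, 0, 0, 0, 1] : Params)].get := by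
  simp only [linearIndependent_get_cons, linearIndependent_get_nil, mem_span_nil]
  simp [funext_iff, Fin.forall_fin_succ]

theorem linearIndependent_kernel_two {a : ℝ} (ha : a ≠ 0) :
    LinearIndependent ℝ [(![0, 0, 0, 0, 0, 1] : Params), ![0, 0, 0, 0, 2 * a, 0]].get := by
  simp only [linearIndependent_get_cons, linearIndependent_get_nil, mem_span_nil, mem_span_cons]
  simp [funext_iff, Fin.forall_fin_succ, ha]

/-- The common symmetries of all equations with given `a` and `n` on a given box. -/
theorem common_symmetries_iff {a n : ℝ} {I X J : Set ℝ} (V : VF) (ha : a ≠ 0) (hn0 : n ≠ 0)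
    (hn1 : n ≠ 1) (hI : IsOpenInterval I) (hX : IsOpenInterval X) (hJ : IsOpenInterval J)
    (hn : PowerRegular n J) :
    (∀ (E : Equation) (B : Box E), E.a = a → E.n = n → E.I = I → B.X = X → B.J = J →
      IsLieSymmetry E B V) ↔
    ∃ c, IsKernel n c ∧ Set.EqOn V (symField a n c) (I ×ˢ X ×ˢ J) := by
  constructor
  · intro h
    -- Two test functions suffice: g = 1 forces 2c₃ = c₁, and g = exp then forces τ = 0.
    let E₁ : Equation := ⟨a, n, fun _ => 1, I, ha, hn0, hn1, hI, contDiffOn_const, by simp⟩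
    let E₂ : Equation := ⟨a, n, Real.exp, I, ha, hn0, hn1, hI, Real.contDiff_exp.contDiffOn,
      fun t _ => Real.exp_ne_zero t⟩
    let B₁ : Box E₁ := ⟨X, J, hX, hJ, hn⟩
    let B₂ : Box E₂ := ⟨X, J, hX, hJ, hn⟩
    obtain ⟨c, hc, hVc⟩ := (isLieSymmetry_iff E₁ B₁ V).1 (h E₁ B₁ rfl rfl rfl rfl rfl)
    obtain ⟨d, hd, hVd⟩ := (isLieSymmetry_iff E₂ B₂ V).1 (h E₂ B₂ rfl rfl rfl rfl rfl)
    have hcd : c - d = 0 := symField_injOn (a := a) (n := n) hI hX hJ fun p hp => by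
      rw [map_sub]
      exact sub_eq_zero.2 ((hVc hp).symm.trans (hVd hp))
    obtain rfl := sub_eq_zero.1 hcd
    refine ⟨c, ?_, hVc⟩
    have hk : ∀ t ∈ I, 0 * t + (2 * c 3 - c 1) = 0 := fun t ht => by
      have := hc.2 t ht
      simp only [E₁, deriv_const, mul_zero, mul_one] at this
      linarith
    have hk' := (affine_eq_zero_on hI hk).2
    obtain ⟨h0, h1, h2⟩ := quadratic_eq_zero_on hI (A := c 0) (B := c 1) (C := c 2) fun t ht => by
      have := hd.2 t ht
      simp only [E₂, Real.deriv_exp, hk', zero_mul] at this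
      exact (mul_eq_zero.1 this).resolve_right (Real.exp_ne_zero t)
    exact ⟨⟨h0, h1, h2, by linarith⟩, hc.1.imp_right And.right⟩
  · rintro ⟨c, hc, hV⟩ E B rfl rfl rfl rfl rfl
    exact (isLieSymmetry_iff E B V).2 ⟨c, hc.admissible, hV⟩

/-- Coefficients are determined by the field on the box and kernel coefficients are always
admissible, so the box disappears from the statement. -/
theorem isBasis_kernel_iff {E : Equation} (B : Box E) {cs : List Params}
    (hcs : LinearIndependent ℝ cs.get)
    (hspan : ∀ c, c ∈ Submodule.span ℝ {c | c ∈ cs} ↔ IsKernel E.n c) :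
    IsBasisOfMaxAlgebra E B (cs.map (symField E.a E.n)) ↔
      ∀ c, Admissible E c → IsKernel E.n c := by
  constructor
  · intro h c hc
    obtain ⟨W, hW, hEq⟩ := (h.2 _).1 (isLieSymmetry_symField (B := B) hc)
    obtain ⟨d, hd, rfl⟩ := (spanOf_map _ _ _ _).1 hW
    have : c - d = 0 := symField_injOn (a := E.a) (n := E.n) E.interval_I B.interval_X B.interval_J
      fun p hp => by
        rw [map_sub]
        exact sub_eq_zero.2 (hEq hp)
    rw [sub_eq_zero.1 this]
    exact (hspan d).1 hd
  · intro h
    exact isBasisOfMaxAlgebra_map B hcs fun c =>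
      (hspan c).trans ⟨IsKernel.admissible, h c⟩

/-! ### Equivalence transformations -/

/-- A common description of the transformations of the two equivalence groups. -/
structure IsTransformation (E E' : Equation) (φ : Pt → Pt) (α β γ δ κ μ₁ μ₀ lam : ℝ) : Prop where
  det_ne : α * δ - β * γ ≠ 0
  kappa_ne : κ ≠ 0
  lam_ne : lam ≠ 0
  denom_ne : ∀ t ∈ E.I, γ * t + δ ≠ 0
  map_eq : ∀ t x u : ℝ, φ (t, x, u) = ((α * t + β) / (γ * t + δ),
    (κ * x + μ₁ * t + μ₀) / (γ * t + δ),
    lam * ((γ * t + δ) * u + (μ₁ * δ - μ₀ * γ - κ * γ * x) / (2 * E.a * κ)))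
  n_eq : E'.n = E.n
  cases_n : (E.n = 2 ∧ E'.a * lam * (α * δ - β * γ) = E.a * κ) ∨
    (E.n ≠ 2 ∧ γ = 0 ∧ δ = 1 ∧ μ₁ = 0)
  image_I : E'.I = (fun t => (α * t + β) / (γ * t + δ)) '' E.I
  g_eq : ∀ t ∈ E.I, E'.g ((α * t + β) / (γ * t + δ)) = κ ^ 2 / (α * δ - β * γ) * E.g t

theorem Equiv.exists_isTransformation {E E' : Equation} {φ : Pt → Pt} (h : Equiv E E' φ) :
    ∃ α β γ δ κ μ₁ μ₀ lam, IsTransformation E E' φ α β γ δ κ μ₁ μ₀ lam := by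
  rcases h with ⟨hn, δ₁, δ₂, δ₃, δ₄, δ₅, h0, -, hφ, hn', -, hI, hg⟩ |
    ⟨hn, α, β, γ, δ, κ, μ₁, μ₀, σ, hΔ, hκσ, hd, hφ, -, hn', ha, hI, hg⟩
  · have h5 : δ₅ ≠ 0 := right_ne_zero_of_mul h0
    have h3 : δ₃ ≠ 0 := right_ne_zero_of_mul (left_ne_zero_of_mul h0)
    have h1 : δ₁ ≠ 0 := left_ne_zero_of_mul (left_ne_zero_of_mul h0)
    -- The relation between the two constants a is dropped for n ≠ 2: a enters a symmetry operator
    -- only together with c₀ or c₄, which vanish there.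
    refine ⟨δ₁, δ₂, 0, 1, δ₃, 0, δ₄, δ₅, ⟨by simpa using h1, h3, h5, by simp, fun t x u => ?_, hn',
      Or.inr ⟨hn, rfl, rfl, rfl⟩, by simpa using hI, fun t ht => by simpa using hg t ht⟩⟩
    rw [hφ]; simp
  · have hκ := left_ne_zero_of_mul hκσ
    have hσ := right_ne_zero_of_mul hκσ
    have ha0 := E.a_ne_zero
    refine ⟨α, β, γ, δ, κ, μ₁, μ₀, σ * κ / (α * δ - β * γ), ⟨hΔ, hκ,
      div_ne_zero (mul_ne_zero hσ hκ) hΔ, hd, fun t x u => ?_, hn'.trans hn.symm,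
      Or.inl ⟨hn, ?_⟩, hI, hg⟩⟩
    · rw [hφ]
      simp only [Prod.mk.injEq, true_and]
      field_simp
      ring
    · rw [ha]; field_simp

/-- The action of an equivalence transformation on the coefficients of symmetry operators. -/
noncomputable def pullParams (α β γ δ κ μ₁ μ₀ : ℝ) (c : Params) : Params :=
  ![(c 0 * α ^ 2 + c 1 * γ * α + c 2 * γ ^ 2) / (α * δ - β * γ),
    (2 * α * β * c 0 + (α * δ + β * γ) * c 1 + 2 * γ * δ * c 2) / (α * δ - β * γ),
    (c 0 * β ^ 2 + c 1 * β * δ + c 2 * δ ^ 2) / (α * δ - β * γ),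
    c 3 + (c 0 * α * β + c 1 * γ * β + c 2 * γ * δ) / (α * δ - β * γ),
    (c 0 * α * (μ₀ * α - μ₁ * β) / (α * δ - β * γ) + c 3 * μ₁ + c 4 * α + c 5 * γ
      - (μ₁ * δ - μ₀ * γ) * (c 1 * α + c 2 * γ) / (α * δ - β * γ)) / κ,
    (c 0 * β * (μ₀ * α - μ₁ * β) / (α * δ - β * γ) + c 3 * μ₀ + c 4 * β + c 5 * δ
      - (μ₁ * δ - μ₀ * γ) * (c 1 * β + c 2 * δ) / (α * δ - β * γ)) / κ]

/-- Surjectivity ensures that pullbacks exhaust the symmetries of the original equation. The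
quadratic part is inverted with the adjugate matrix, and the pair (c₄, c₅) with Cramer's rule. The
second clause keeps the constraint c₀ = c₄ = 0 when n ≠ 2. -/
theorem exists_pullParams_eq {α β γ δ κ : ℝ} (μ₁ μ₀ : ℝ) (hΔ : α * δ - β * γ ≠ 0) (hκ : κ ≠ 0)
    (c : Params) : ∃ d, pullParams α β γ δ κ μ₁ μ₀ d = c ∧
      (γ = 0 → μ₁ = 0 → c 0 = 0 → c 4 = 0 → d 0 = 0 ∧ d 4 = 0) := by
  obtain ⟨d0, h0⟩ : ∃ d0, d0 = (c 0 * δ ^ 2 - c 1 * γ * δ + c 2 * γ ^ 2) / (α * δ - β * γ) :=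
    ⟨_, rfl⟩
  obtain ⟨d1, h1⟩ : ∃ d1, d1 = (-2 * β * δ * c 0 + (α * δ + β * γ) * c 1 - 2 * α * γ * c 2)
    / (α * δ - β * γ) := ⟨_, rfl⟩
  obtain ⟨d2, h2⟩ : ∃ d2, d2 = (β ^ 2 * c 0 - α * β * c 1 + α ^ 2 * c 2) / (α * δ - β * γ) :=
    ⟨_, rfl⟩
  obtain ⟨d3, h3⟩ : ∃ d3, d3 = c 3 - (d0 * α * β + d1 * γ * β + d2 * γ * δ) / (α * δ - β * γ) :=
    ⟨_, rfl⟩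
  obtain ⟨r4, h4⟩ : ∃ r4, r4 = κ * c 4 - (d0 * α * (μ₀ * α - μ₁ * β) / (α * δ - β * γ) + d3 * μ₁
    - (μ₁ * δ - μ₀ * γ) * (d1 * α + d2 * γ) / (α * δ - β * γ)) := ⟨_, rfl⟩
  obtain ⟨r5, h5⟩ : ∃ r5, r5 = κ * c 5 - (d0 * β * (μ₀ * α - μ₁ * β) / (α * δ - β * γ) + d3 * μ₀
    - (μ₁ * δ - μ₀ * γ) * (d1 * β + d2 * δ) / (α * δ - β * γ)) := ⟨_, rfl⟩
  obtain ⟨D, hD⟩ : ∃ D, D = α * δ - β * γ := ⟨_, rfl⟩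
  refine ⟨![d0, d1, d2, d3, (δ * r4 - γ * r5) / (α * δ - β * γ),
    (α * r5 - β * r4) / (α * δ - β * γ)], ?_, ?_⟩
  · rw [← sub_eq_zero, params_eq_zero_iff]
    simp only [pullParams, Pi.sub_apply, Matrix.cons_val, sub_eq_zero]
    rw [← hD] at h0 h1 h2 h3 h4 h5 hΔ ⊢
    have e4 : (δ * r4 - γ * r5) / D * α + (α * r5 - β * r4) / D * γ = r4 := by
      field_simp; rw [hD]; ring
    have e5 : (δ * r4 - γ * r5) / D * β + (α * r5 - β * r4) / D * δ = r5 := by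
      field_simp; rw [hD]; ring
    refine ⟨?_, ?_, ?_, ?_, ?_, ?_⟩
    · rw [h0, h1, h2]; field_simp; rw [hD]; ring
    · rw [h0, h1, h2]; field_simp; rw [hD]; ring
    · rw [h0, h1, h2]; field_simp; rw [hD]; ring
    · rw [h3]; ring
    · rw [div_eq_iff hκ]; linear_combination e4 + h4
    · rw [div_eq_iff hκ]; linear_combination e5 + h5
  · rintro rfl rfl c0 c4
    rw [c0] at h0
    rw [c4] at h4
    have h0' : d0 = 0 := by rw [h0]; simp
    simp only [Matrix.cons_val]
    refine ⟨h0', ?_⟩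
    rw [h4, h0']
    simp

/-- An injective endomorphism of a finite-dimensional space is invertible, so the inverse in
`VectorField.pullback` need not be computed; it suffices to check L v = W ∘ φ. -/
theorem HasFDerivAt.pullback_eq {φ : Pt → Pt} {L : Pt →L[ℝ] Pt} {p v : Pt} {W : VF}
    (h : HasFDerivAt φ L p) (hL : ∀ w, L w = 0 → w = 0) (hv : L v = W (φ p)) :
    VectorField.pullback ℝ φ W p = v := by
  have hinj : Function.Injective (L : Pt →ₗ[ℝ] Pt) :=
    (injective_iff_map_eq_zero _).2 hL
  have hinv : L.IsInvertible :=
    ⟨(LinearEquiv.ofInjectiveEndo (L : Pt →ₗ[ℝ] Pt) hinj).toContinuousLinearEquiv, by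
      ext <;> rfl⟩
  rw [VectorField.pullback, h.fderiv, hinv.inverse_apply_eq, hv]

theorem IsTransformation.hasFDerivAt {E E' : Equation} {φ : Pt → Pt}
    {α β γ δ κ μ₁ μ₀ lam : ℝ} (h : IsTransformation E E' φ α β γ δ κ μ₁ μ₀ lam) {t : ℝ}
    (ht : t ∈ E.I) (x u : ℝ) : ∃ L : Pt →L[ℝ] Pt, HasFDerivAt φ L (t, x, u) ∧ ∀ t' x' u' : ℝ,
      L (t', x', u') = ((α * δ - β * γ) / (γ * t + δ) ^ 2 * t',
        κ / (γ * t + δ) * x' + (μ₁ * δ - μ₀ * γ - κ * γ * x) / (γ * t + δ) ^ 2 * t',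
        lam * ((γ * t + δ) * u' + γ * u * t' - γ / (2 * E.a) * x')) := by
  have hG := h.denom_ne t ht
  have ha := E.a_ne_zero
  have hκ := h.kappa_ne
  have hφ : φ = fun p : Pt => ((α * p.1 + β) / (γ * p.1 + δ),
      (κ * p.2.1 + μ₁ * p.1 + μ₀) / (γ * p.1 + δ),
      lam * ((γ * p.1 + δ) * p.2.2 + (μ₁ * δ - μ₀ * γ - κ * γ * p.2.1) / (2 * E.a * κ))) :=
    funext fun ⟨t, x, u⟩ => h.map_eq t x u
  have hd : DifferentiableAt ℝ φ (t, x, u) := by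
    rw [hφ]
    have hG' : γ * (t, x, u).1 + δ ≠ 0 := hG
    fun_prop (disch := assumption)
  refine ⟨fderiv ℝ φ (t, x, u), hd.hasFDerivAt, fun t' x' u' => ?_⟩
  have hline : HasDerivAt (fun s : ℝ => ((t, x, u) : Pt) + s • ((t', x', u') : Pt))
      (t', x', u') 0 := by
    simpa only [id, one_smul] using
      ((hasDerivAt_id (0 : ℝ)).smul_const ((t', x', u') : Pt)).const_add (t, x, u)
  have h1 : HasDerivAt (fun s : ℝ => φ ((t, x, u) + s • (t', x', u')))
      (fderiv ℝ φ (t, x, u) (t', x', u')) 0 := by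
    have h0 : HasFDerivAt φ (fderiv ℝ φ (t, x, u)) ((t, x, u) + (0 : ℝ) • (t', x', u')) := by
      rw [zero_smul, add_zero]; exact hd.hasFDerivAt
    exact h0.comp_hasDerivAt (0 : ℝ) hline
  have lin : ∀ b c : ℝ, HasDerivAt (fun s : ℝ => b + s * c) c 0 := fun b c => by
    simpa using ((hasDerivAt_id (0 : ℝ)).mul_const c).const_add b
  have hA := ((lin t t').const_mul α).add_const β
  have hGd := ((lin t t').const_mul γ).add_const δ
  have hX := (((lin x x').const_mul κ).add ((lin t t').const_mul μ₁)).add_const μ₀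
  have hU := ((hGd.mul (lin u u')).add
    ((((lin x x').const_mul (κ * γ)).const_sub (μ₁ * δ - μ₀ * γ)).div_const
      (2 * E.a * κ))).const_mul lam
  have hG0 : γ * (t + 0 * t') + δ ≠ 0 := by rwa [zero_mul, add_zero]
  have h2 := (hA.div hGd hG0).prodMk ((hX.div hGd hG0).prodMk hU)
  rw [hφ] at h1 ⊢
  rw [HasDerivAt.unique h1 h2]
  simp only [zero_mul, add_zero, Prod.mk.injEq, Pi.add_apply]
  refine ⟨?_, ?_, ?_⟩ <;> field_simp <;> ring

theorem IsTransformation.pullback_symField {E E' : Equation} {φ : Pt → Pt}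
    {α β γ δ κ μ₁ μ₀ lam : ℝ} (h : IsTransformation E E' φ α β γ δ κ μ₁ μ₀ lam) {c : Params}
    (hc : E.n = 2 ∨ c 0 = 0 ∧ c 4 = 0) {p : Pt} (hp : p.1 ∈ E.I) :
    VectorField.pullback ℝ φ (symField E'.a E'.n c) p =
      symField E.a E.n (pullParams α β γ δ κ μ₁ μ₀ c) p := by
  obtain ⟨t, x, u⟩ := p
  obtain ⟨L, hL, hLe⟩ := h.hasFDerivAt hp x u
  have hG := h.denom_ne t hp
  have ha := E.a_ne_zero
  have ha' := E'.a_ne_zero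
  have hκ := h.kappa_ne
  have hΔ := h.det_ne
  have hlam := h.lam_ne
  refine HasFDerivAt.pullback_eq hL ?_ ?_
  · rintro ⟨t', x', u'⟩ hw
    rw [hLe] at hw
    simp only [Prod.mk_eq_zero] at hw
    obtain ⟨w1, w2, w3⟩ := hw
    obtain rfl : t' = 0 := (mul_eq_zero.1 w1).resolve_left (div_ne_zero hΔ (pow_ne_zero 2 hG))
    rw [mul_zero, add_zero] at w2
    obtain rfl : x' = 0 := (mul_eq_zero.1 w2).resolve_left (div_ne_zero hκ hG)
    have w4 := (mul_eq_zero.1 w3).resolve_left hlam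
    obtain rfl : u' = 0 := by
      refine (mul_eq_zero.1 (?_ : (γ * t + δ) * u' = 0)).resolve_left hG
      linarith
    rfl
  · rw [symField_apply, hLe, h.map_eq, symField_apply, h.n_eq]
    simp only [pullParams, Matrix.cons_val, Prod.mk.injEq]
    have hn1 : E.n - 1 ≠ 0 := sub_ne_zero.2 E.n_ne_one
    rcases h.cases_n with ⟨h2, hlm⟩ | ⟨h2, rfl, rfl, rfl⟩
    · have hlm' : E'.a = E.a * κ / (lam * (α * δ - β * γ)) := by
        rw [eq_div_iff (mul_ne_zero hlam hΔ)]; linarith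
      obtain ⟨D, hD⟩ : ∃ D, D = α * δ - β * γ := ⟨_, rfl⟩
      obtain ⟨G, hGe⟩ : ∃ G, G = γ * t + δ := ⟨_, rfl⟩
      rw [hlm', h2, show (2 : ℝ) - 1 = 1 by norm_num]
      rw [← hD] at hΔ ⊢
      rw [← hGe] at hG ⊢
      refine ⟨?_, ?_, ?_⟩ <;> field_simp <;> simp only [hD, hGe] <;> ring
    · obtain ⟨c0, c4⟩ := hc.resolve_left h2
      have hα : α ≠ 0 := by simpa using hΔ
      rw [c0, c4]
      simp only [mul_one, mul_zero, sub_zero, zero_mul, zero_add, add_zero, div_one]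
      refine ⟨?_, ?_, ?_⟩ <;> field_simp <;> ring

/-- The classifying equation is covariant: differentiating the relation between the two functions g
shows that the two expressions τ g' - (2c₃ - c₁) g differ by the nonzero factor κ²/(αδ - βγ). -/
theorem IsTransformation.admissible_iff {E E' : Equation} {φ : Pt → Pt}
    {α β γ δ κ μ₁ μ₀ lam : ℝ} (h : IsTransformation E E' φ α β γ δ κ μ₁ μ₀ lam) {c : Params}
    (hc : E.n = 2 ∨ c 0 = 0 ∧ c 4 = 0) :
    Admissible E' c ↔ Admissible E (pullParams α β γ δ κ μ₁ μ₀ c) := by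
  have hΔ := h.det_ne
  have hκ := h.kappa_ne
  have hc' : E.n = 2 ∨ pullParams α β γ δ κ μ₁ μ₀ c 0 = 0 ∧ pullParams α β γ δ κ μ₁ μ₀ c 4 = 0 := by
    rcases h.cases_n with ⟨h2, -⟩ | ⟨h2, rfl, rfl, rfl⟩
    · exact Or.inl h2
    · obtain ⟨c0, c4⟩ := hc.resolve_left h2
      exact Or.inr ⟨by simp [pullParams, c0], by simp [pullParams, c0, c4]⟩
  rw [Admissible, Admissible, h.n_eq, h.image_I, Set.forall_mem_image]
  simp only [hc, hc', true_and]
  refine forall₂_congr fun t ht => ?_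
  have hG := h.denom_ne t ht
  have hderiv : deriv E'.g ((α * t + β) / (γ * t + δ)) * ((α * δ - β * γ) / (γ * t + δ) ^ 2)
      = κ ^ 2 / (α * δ - β * γ) * deriv E.g t := by
    have hm : HasDerivAt (fun t : ℝ => (α * t + β) / (γ * t + δ))
        ((α * δ - β * γ) / (γ * t + δ) ^ 2) t := by
      have h1 := (((hasDerivAt_id t).const_mul α).add_const β).div
        (((hasDerivAt_id t).const_mul γ).add_const δ) hG
      refine h1.congr_deriv ?_
      simp only [id]
      congr 1
      ring
    have hmem : (α * t + β) / (γ * t + δ) ∈ E'.I := by rw [h.image_I]; exact ⟨t, ht, rfl⟩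
    have h1 := (E'.differentiableAt_g hmem).hasDerivAt.comp t hm
    have h2 := (E.differentiableAt_g ht).hasDerivAt.const_mul (κ ^ 2 / (α * δ - β * γ))
    refine h1.unique (h2.congr_of_eventuallyEq ?_)
    filter_upwards [E.interval_I.1.mem_nhds ht] with s hs using h.g_eq s hs
  have hderiv' : deriv E'.g ((α * t + β) / (γ * t + δ))
      = κ ^ 2 * (γ * t + δ) ^ 2 / (α * δ - β * γ) ^ 2 * deriv E.g t := by
    have aux : ∀ y D G z K : ℝ, D ≠ 0 → G ≠ 0 → y * (D / G ^ 2) = K / D * z →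
        y = K * G ^ 2 / D ^ 2 * z := by
      intro y D G z K hD hG h
      have e : y = y * (D / G ^ 2) * (G ^ 2 / D) := by field_simp
      rw [e, h]
      field_simp
    exact aux _ _ _ _ _ hΔ hG hderiv
  simp only [hderiv', h.g_eq t ht, pullParams, Matrix.cons_val]
  have hfac : κ ^ 2 / (α * δ - β * γ) ≠ 0 := div_ne_zero (pow_ne_zero 2 hκ) hΔ
  obtain ⟨D, hD⟩ : ∃ D, D = α * δ - β * γ := ⟨_, rfl⟩
  obtain ⟨G, hGe⟩ : ∃ G, G = γ * t + δ := ⟨_, rfl⟩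
  have key : ∀ y z w v r : ℝ, r ≠ 0 → y - z = r * (w - v) → (y = z ↔ w = v) := by
    intro y z w v r hr h
    rw [← sub_eq_zero, h, mul_eq_zero, or_iff_right hr, sub_eq_zero]
  refine key _ _ _ _ _ hfac ?_
  rw [← hD] at hΔ ⊢
  rw [← hGe] at hG ⊢
  field_simp
  simp only [hD, hGe]
  ring

theorem Equiv.isLieSymmetry_iff {E E' : Equation} {φ : Pt → Pt} (h : Equiv E E' φ) (B : Box E)
    (V : VF) : IsLieSymmetry E B V ↔ ∃ c, Admissible E' c ∧
      Set.EqOn V (VectorField.pullback ℝ φ (symField E'.a E'.n c)) B.dom := by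
  obtain ⟨α, β, γ, δ, κ, μ₁, μ₀, lam, h⟩ := h.exists_isTransformation
  rw [BurgersLie.isLieSymmetry_iff]
  constructor
  · rintro ⟨c, hc, hV⟩
    obtain ⟨d, rfl, hd⟩ := exists_pullParams_eq μ₁ μ₀ h.det_ne h.kappa_ne c
    have hd' : E.n = 2 ∨ d 0 = 0 ∧ d 4 = 0 := by
      rcases h.cases_n with ⟨h2, -⟩ | ⟨h2, h3, -, h4⟩
      · exact Or.inl h2
      · obtain ⟨c0, c4⟩ := hc.1.resolve_left h2
        exact Or.inr (hd h3 h4 c0 c4)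
    refine ⟨d, (h.admissible_iff hd').2 hc, fun p hp => ?_⟩
    rw [hV hp, h.pullback_symField hd' hp.1]
  · rintro ⟨c, hc, hV⟩
    have hc' : E.n = 2 ∨ c 0 = 0 ∧ c 4 = 0 := h.n_eq ▸ hc.1
    refine ⟨_, (h.admissible_iff hc').1 hc, fun p hp => ?_⟩
    rw [hV hp, h.pullback_symField hc' hp.1]

theorem InRow.isLieSymmetry_iff_pullback {R : Row} {E E' : Equation} {φ : Pt → Pt}
    (hR : InRow E' R) (h : Equiv E E' φ) (B : Box E) (V : VF) : IsLieSymmetry E B V ↔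
      ∃ W ∈ spanOf R.basis, Set.EqOn V (VectorField.pullback ℝ φ W) B.dom := by
  rw [h.isLieSymmetry_iff]
  simp only [hR.mem_spanOf_basis_iff]
  constructor
  · rintro ⟨c, hc, hV⟩
    exact ⟨_, ⟨c, hc, rfl⟩, hV⟩
  · rintro ⟨_, ⟨c, hc, rfl⟩, hV⟩
    exact ⟨c, hc, hV⟩

/-! ### Inequivalence of the rows -/

theorem Row.quad_zero {R : Row} (h : R.Valid) : R.n = 2 ∨ R.quad 0 = 0 := by
  cases R <;> simp [Row.n, Row.quad]

theorem Row.quad_ne_zero (R : Row) : ¬ (R.quad 0 = 0 ∧ R.quad 1 = 0 ∧ R.quad 2 = 0) := by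
  cases R <;> simp [Row.quad]

theorem Equiv.n_eq {E E' : Equation} {φ : Pt → Pt} (h : Equiv E E' φ) : E'.n = E.n := by
  obtain ⟨α, β, γ, δ, κ, μ₁, μ₀, lam, h⟩ := h.exists_isTransformation
  exact h.n_eq

/-- An equation equivalent to one of a row has a symmetry outside of the kernel. -/
theorem InRow.exists_admissible {R : Row} {E E' : Equation} {φ : Pt → Pt} (hR : InRow E' R)
    (h : Equiv E E' φ) : ∃ c, Admissible E c ∧ 2 * c 3 - c 1 = R.rate ∧
      c 1 ^ 2 - 4 * c 0 * c 2 = R.quad 1 ^ 2 - 4 * R.quad 0 * R.quad 2 ∧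
      ¬ (c 0 = 0 ∧ c 1 = 0 ∧ c 2 = 0) := by
  obtain ⟨α, β, γ, δ, κ, μ₁, μ₀, lam, h⟩ := h.exists_isTransformation
  have hΔ := h.det_ne
  have hq : E.n = 2 ∨ R.quad 0 = 0 := by
    rw [← h.n_eq, hR.2.2.1]; exact R.quad_zero hR.1
  -- The symmetry with τ = Q; the entry c₃ is chosen so that 2c₃ - c₁ equals the rate of the row.
  set d : Params := ![R.quad 0, R.quad 1, R.quad 2, (R.rate + R.quad 1) / 2, 0, 0] with hd
  have hd' : E.n = 2 ∨ d 0 = 0 ∧ d 4 = 0 := by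
    refine hq.imp_right fun h => ?_
    simp [hd, h]
  have hadm : Admissible E' d := by
    rw [hR.logDeriv.admissible_iff, h.n_eq]
    refine ⟨hd', ?_, ?_, ?_⟩ <;> simp only [hd, Matrix.cons_val] <;> ring
  refine ⟨_, (h.admissible_iff hd').1 hadm, ?_, ?_, ?_⟩
  · simp only [pullParams, hd, Matrix.cons_val]
    obtain ⟨D, hD⟩ : ∃ D, D = α * δ - β * γ := ⟨_, rfl⟩
    rw [← hD] at hΔ ⊢
    field_simp
    simp only [hD]
    ring
  · simp only [pullParams, hd, Matrix.cons_val]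
    obtain ⟨D, hD⟩ : ∃ D, D = α * δ - β * γ := ⟨_, rfl⟩
    rw [← hD] at hΔ ⊢
    field_simp
    simp only [hD]
    ring
  · simp only [pullParams, hd, Matrix.cons_val, div_eq_zero_iff, hΔ, or_false]
    rintro ⟨e0, e1, e2⟩
    have hΔ2 : (α * δ - β * γ) ^ 2 ≠ 0 := pow_ne_zero 2 hΔ
    refine R.quad_ne_zero ⟨?_, ?_, ?_⟩ <;> refine (mul_eq_zero.1 ?_).resolve_left hΔ2
    · linear_combination δ ^ 2 * e0 - γ * δ * e1 + γ ^ 2 * e2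
    · linear_combination -2 * β * δ * e0 + (α * δ + β * γ) * e1 - 2 * α * γ * e2
    · linear_combination β ^ 2 * e0 - α * β * e1 + α ^ 2 * e2

/-- The exponent n and the vanishing of the rate are invariant, and so is the proportion of rate² to
the discriminant of Q. That discriminant is positive in the power rows, zero in the exponential rows
and negative in the arctangent row. -/
theorem InRow.no_eq {R R' : Row} {E E' : Equation} {φ : Pt → Pt} (hR : InRow E R)
    (hR' : InRow E' R') (h : Equiv E E' φ) : R.no = R'.no := by
  obtain ⟨c, hc, hk, hdisc, hne⟩ := hR'.exists_admissible h
  rw [hR.logDeriv.admissible_iff, hk] at hc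
  obtain ⟨-, e0, e1, e2⟩ := hc
  have hn : R.n = 2 ↔ R'.n = 2 := by rw [← hR.2.2.1, ← hR'.2.2.1, h.n_eq]
  have hrate : R.rate = 0 ↔ R'.rate = 0 := by
    constructor
    · intro h0
      by_contra h1
      rw [h0] at e0 e1 e2
      exact R.quad_ne_zero ⟨by simpa [h1] using e0, by simpa [h1] using e1, by simpa [h1] using e2⟩
    · intro h0
      by_contra h1
      rw [h0] at e0 e1 e2
      exact hne ⟨by simpa [h1] using e0, by simpa [h1] using e1, by simpa [h1] using e2⟩
  -- The transported quadratic, multiplied by one rate, equals the own quadratic of the row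
  -- multiplied by the other rate; comparing discriminants gives this identity.
  have hd : R.rate ^ 2 * (R'.quad 1 ^ 2 - 4 * R'.quad 0 * R'.quad 2)
      = R'.rate ^ 2 * (R.quad 1 ^ 2 - 4 * R.quad 0 * R.quad 2) := by
    linear_combination (-R.rate ^ 2) * hdisc + (R.rate * c 1 + R'.rate * R.quad 1) * e1
      - 4 * R.rate * c 2 * e0 - 4 * R'.rate * R.quad 0 * e2
  have v := hR.1
  have v' := hR'.1
  have hneg : ∀ ρ ρ' : ℝ, ρ ≠ 0 → -(ρ ^ 2 * 4) = (2 * ρ') ^ 2 → False := fun ρ ρ' h0 h => by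
    have := sq_nonneg ρ'
    have := pow_pos (abs_pos.2 h0) 2
    rw [sq_abs] at this
    nlinarith
  have hneg' : ∀ ρ ρ' : ℝ, ρ' ≠ 0 → (2 * ρ) ^ 2 = -(ρ' ^ 2 * 4) → False := fun ρ ρ' h0 h =>
    hneg ρ' ρ h0 h.symm
  clear hR hR' h hdisc e0 e1 e2 hne hk
  cases R <;> cases R' <;>
    first
    | rfl
    | (simp [Row.n, Row.rate, Row.quad, Row.Valid] at hn hrate hd v v'
       done)
    | (exfalso
       simp [Row.n, Row.rate, Row.quad, Row.Valid] at hn hrate hd v v'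
       first
       | exact v hn
       | exact v' hn
       | exact v.1 hn
       | exact v'.1 hn
       | exact v.2 hrate
       | exact v'.2 hrate
       | exact v.2.2 hrate
       | exact v'.2.2 hrate
       | exact v.2 hd
       | exact v'.2 hd
       | exact v.2.2 hd
       | exact v'.2.2 hd
       | exact hneg _ _ v.2 hd
       | exact hneg' _ _ v'.2 hd)

/-! ### Construction of equivalent equations -/

section Moebius

variable {α β γ δ : ℝ} {I : Set ℝ}

theorem continuousOn_moebius (hG : ∀ t ∈ I, γ * t + δ ≠ 0) :
    ContinuousOn (fun t => (α * t + β) / (γ * t + δ)) I :=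
  ContinuousOn.div (by fun_prop) (by fun_prop) hG

theorem moebius_inverse {t : ℝ} (hΔ : α * δ - β * γ ≠ 0) (hG : γ * t + δ ≠ 0) :
    α - γ * ((α * t + β) / (γ * t + δ)) ≠ 0 ∧
      (δ * ((α * t + β) / (γ * t + δ)) - β) / (α - γ * ((α * t + β) / (γ * t + δ))) = t := by
  obtain ⟨D, hD⟩ : ∃ D, D = α * δ - β * γ := ⟨_, rfl⟩
  obtain ⟨G, hGe⟩ : ∃ G, G = γ * t + δ := ⟨_, rfl⟩
  rw [← hD] at hΔ
  rw [← hGe] at hG ⊢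
  have e1 : α - γ * ((α * t + β) / G) = D / G := by
    field_simp; simp only [hD, hGe]; ring
  have e2 : δ * ((α * t + β) / G) - β = D * t / G := by
    field_simp; simp only [hD, hGe]; ring
  rw [e1, e2]
  refine ⟨div_ne_zero hΔ hG, ?_⟩
  field_simp

theorem IsOpenInterval.image_moebius (hI : IsOpenInterval I) (hΔ : α * δ - β * γ ≠ 0)
    (hG : ∀ t ∈ I, γ * t + δ ≠ 0) :
    IsOpenInterval ((fun t => (α * t + β) / (γ * t + δ)) '' I) := by
  refine ⟨?_, ?_, hI.2.2.image _⟩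
  · have hU : IsOpen {s : ℝ | α - γ * s ≠ 0} :=
      isOpen_ne_fun (by fun_prop) continuous_const
    have hc : ContinuousOn (fun s : ℝ => (δ * s - β) / (α - γ * s)) {s : ℝ | α - γ * s ≠ 0} :=
      ContinuousOn.div (by fun_prop) (by fun_prop) fun s hs => hs
    have hopen := hc.isOpen_inter_preimage hU hI.1
    convert hopen using 1
    ext s
    constructor
    · rintro ⟨t, ht, rfl⟩
      obtain ⟨h1, h2⟩ := moebius_inverse hΔ (hG t ht)
      exact ⟨h1, by rw [Set.mem_preimage]; simp only [h2]; exact ht⟩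
    · rintro ⟨hs, ht⟩
      refine ⟨_, ht, ?_⟩
      have hΔ' : δ * α - (-β) * (-γ) ≠ 0 := by
        intro h; exact hΔ (by linarith)
      have hs' : -γ * s + α ≠ 0 := by
        intro h; exact hs (by linarith)
      have := (moebius_inverse hΔ' hs').2
      refine Eq.trans ?_ this
      simp only
      rw [show -γ * s + α = α - γ * s by ring, ← sub_eq_add_neg]
      congr 1 <;> ring
  · exact (hI.2.1.isPreconnected.image _ (continuousOn_moebius hG)).ordConnected

/-- On the image h equals K g ∘ m⁻¹, where m⁻¹ is the inverse Möbius map, smooth off its pole. -/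
theorem contDiffOn_of_moebius {g h : ℝ → ℝ} {K : ℝ} (hg : ContDiffOn ℝ ∞ g I)
    (hΔ : α * δ - β * γ ≠ 0) (hG : ∀ t ∈ I, γ * t + δ ≠ 0)
    (hh : ∀ t ∈ I, h ((α * t + β) / (γ * t + δ)) = K * g t) :
    ContDiffOn ℝ ∞ h ((fun t => (α * t + β) / (γ * t + δ)) '' I) := by
  have h1 : ContDiffOn ℝ ∞ (fun s : ℝ => (δ * s - β) / (α - γ * s))
      ((fun t => (α * t + β) / (γ * t + δ)) '' I) := by
    refine ContDiffOn.div (by fun_prop) (by fun_prop) ?_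
    rintro _ ⟨t, ht, rfl⟩
    exact (moebius_inverse hΔ (hG t ht)).1
  have h2 : Set.MapsTo (fun s : ℝ => (δ * s - β) / (α - γ * s))
      ((fun t => (α * t + β) / (γ * t + δ)) '' I) I := by
    rintro _ ⟨t, ht, rfl⟩
    simp only [(moebius_inverse hΔ (hG t ht)).2]
    exact ht
  refine ((contDiffOn_const (c := K)).mul (hg.comp h1 h2)).congr ?_
  rintro _ ⟨t, ht, rfl⟩
  simp only [Function.comp_apply, (moebius_inverse hΔ (hG t ht)).2]
  exact hh t ht

/-- The equation with a prescribed coefficient function on the image of the `t`-interval. -/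
def Equation.transform (E : Equation) (a' : ℝ) (h : ℝ → ℝ) (K : ℝ) (ha' : a' ≠ 0)
    (hK : K ≠ 0) (hΔ : α * δ - β * γ ≠ 0) (hG : ∀ t ∈ E.I, γ * t + δ ≠ 0)
    (hh : ∀ t ∈ E.I, h ((α * t + β) / (γ * t + δ)) = K * E.g t) : Equation where
  a := a'
  n := E.n
  g := h
  I := (fun t => (α * t + β) / (γ * t + δ)) '' E.I
  a_ne_zero := ha'
  n_ne_zero := E.n_ne_zero
  n_ne_one := E.n_ne_one
  interval_I := E.interval_I.image_moebius hΔ hG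
  smooth_g := contDiffOn_of_moebius E.smooth_g hΔ hG hh
  g_ne_zero := by
    rintro _ ⟨t, ht, rfl⟩
    simp only [hh t ht]
    exact mul_ne_zero hK (E.g_ne_zero t ht)

end Moebius

/-- Only κ² acts on g, so the sign of the scaling of x is free. It is used to make r positive, and
the positive factor δ₅ = r^(1/(1-n)) then brings a to 1/n, for noninteger n as well. -/
theorem exists_usualEquiv (E : Equation) {α κ : ℝ} (β : ℝ) {h : ℝ → ℝ} (hα : α ≠ 0) (hκ : κ ≠ 0)
    (hh : ∀ t ∈ E.I, h (α * t + β) = κ ^ 2 / α * E.g t) :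
    ∃ (E' : Equation) (φ : Pt → Pt), UsualEquiv E E' φ ∧ E'.a = 1 / E'.n ∧ E'.n = E.n ∧
      E'.g = h ∧ E'.I = (fun t => α * t + β) '' E.I := by
  have hn0 := E.n_ne_zero
  have ha := E.a_ne_zero
  obtain ⟨k, hk, hkpos⟩ : ∃ k : ℝ, k ^ 2 = κ ^ 2 ∧ 0 < k / α * E.a * E.n := by
    have hne : κ / α * E.a * E.n ≠ 0 := by positivity
    rcases lt_or_gt_of_ne hne with h | h
    · exact ⟨-κ, by ring, by
        have : -κ / α * E.a * E.n = -(κ / α * E.a * E.n) := by ring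
        rw [this]; linarith⟩
    · exact ⟨κ, rfl, h⟩
  have hk0 : k ≠ 0 := by
    rintro rfl
    simp at hkpos
  have hK : κ ^ 2 / α ≠ 0 := by positivity
  set r : ℝ := (k / α * E.a * E.n)⁻¹ with hr
  have hrpos : 0 < r := inv_pos.2 hkpos
  have hexp : (r ^ (1 / (1 - E.n))) ^ (1 - E.n) = r := by
    rw [← Real.rpow_mul hrpos.le, one_div_mul_cancel (sub_ne_zero.2 E.n_ne_one.symm),
      Real.rpow_one]
  have hΔ : α * 1 - β * 0 ≠ 0 := by simpa using hα
  refine ⟨E.transform (1 / E.n) h (κ ^ 2 / α) (one_div_ne_zero hn0) hK hΔ (by simp)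
    (by simpa using hh), fun p => (α * p.1 + β, k * p.2.1 + 0, r ^ (1 / (1 - E.n)) * p.2.2),
    ⟨α, β, k, 0, r ^ (1 / (1 - E.n)), ?_, Or.inl (Real.rpow_pos_of_pos hrpos _), fun _ _ _ => rfl,
      rfl, ?_, ?_, ?_⟩, rfl, rfl, rfl, ?_⟩
  · exact mul_ne_zero (mul_ne_zero hα hk0) (Real.rpow_pos_of_pos hrpos _).ne'
  · rw [hexp, hr]
    simp only [Equation.transform]
    field_simp
  · simp [Equation.transform]
  · intro t ht
    rw [hk]
    exact hh t ht
  · simp [Equation.transform]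

theorem exists_quadraticEquiv (E : Equation) {α β γ δ κ : ℝ} {h : ℝ → ℝ} (hn : E.n = 2)
    (hΔ : α * δ - β * γ ≠ 0) (hκ : κ ≠ 0) (hG : ∀ t ∈ E.I, γ * t + δ ≠ 0)
    (hh : ∀ t ∈ E.I, h ((α * t + β) / (γ * t + δ)) = κ ^ 2 / (α * δ - β * γ) * E.g t) :
    ∃ (E' : Equation) (φ : Pt → Pt), QuadraticEquiv E E' φ ∧ E'.a = 1 / E'.n ∧ E'.n = E.n ∧
      E'.g = h ∧ E'.I = (fun t => (α * t + β) / (γ * t + δ)) '' E.I := by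
  have ha := E.a_ne_zero
  have hK : κ ^ 2 / (α * δ - β * γ) ≠ 0 := div_ne_zero (pow_ne_zero 2 hκ) hΔ
  -- The choice σ = 2a turns a/σ into 1/2, which is the gauge for n = 2.
  refine ⟨E.transform (1 / E.n) h _ (one_div_ne_zero E.n_ne_zero) hK hΔ hG hh, fun (t, x, u) =>
    ((α * t + β) / (γ * t + δ), (κ * x + 0 * t + 0) / (γ * t + δ),
      2 * E.a / (2 * E.a * (α * δ - β * γ)) *
          (2 * E.a * κ * (γ * t + δ) * u - κ * γ * x + 0 * δ - 0 * γ)),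
    ⟨α, β, γ, δ, κ, 0, 0, 2 * E.a, hΔ, by positivity, hG, fun _ _ _ => rfl, hn, hn, ?_, rfl, hh⟩,
    rfl, rfl, rfl, rfl⟩
  simp only [Equation.transform, hn]
  field_simp

theorem exists_equiv (E : Equation) {α β γ δ κ : ℝ} {h : ℝ → ℝ} (hn : E.n = 2 ∨ γ = 0 ∧ δ = 1)
    (hΔ : α * δ - β * γ ≠ 0) (hκ : κ ≠ 0) (hG : ∀ t ∈ E.I, γ * t + δ ≠ 0)
    (hh : ∀ t ∈ E.I, h ((α * t + β) / (γ * t + δ)) = κ ^ 2 / (α * δ - β * γ) * E.g t) :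
    ∃ (E' : Equation) (φ : Pt → Pt), Equiv E E' φ ∧ E'.a = 1 / E'.n ∧ E'.n = E.n ∧
      E'.g = h ∧ E'.I = (fun t => (α * t + β) / (γ * t + δ)) '' E.I := by
  by_cases h2 : E.n = 2
  · obtain ⟨E', φ, hE, h'⟩ := exists_quadraticEquiv E h2 hΔ hκ hG hh
    exact ⟨E', φ, Or.inr ⟨h2, hE⟩, h'⟩
  · obtain ⟨rfl, rfl⟩ := hn.resolve_left h2
    simp only [zero_mul, zero_add, div_one, mul_one, mul_zero, sub_zero] at hΔ hh ⊢
    obtain ⟨E', φ, hE, h'⟩ := exists_usualEquiv E β hΔ hκ hh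
    exact ⟨E', φ, Or.inl ⟨h2, hE⟩, h'⟩

theorem exists_gauge (E : Equation) :
    ∃ (E' : Equation) (φ : Pt → Pt), UsualEquiv E E' φ ∧ E'.a = 1 / E'.n := by
  obtain ⟨E', φ, h, ha, -⟩ := exists_usualEquiv E (α := 1) (κ := 1) 0 (h := E.g) one_ne_zero
    one_ne_zero (by simp)
  exact ⟨E', φ, h, ha⟩

/-- The exponent `ρ` of `Row.row6` can be replaced by its opposite. -/
theorem InRow.exists_equiv_row6 {ε ρ : ℝ} {E : Equation} (h : InRow E (Row.row6 ε ρ)) :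
    (∃ (ε' : ℝ) (E' : Equation) (φ : Pt → Pt), InRow E' (Row.row6 ε' ρ) ∧ Equiv E E' φ) ∧
    ∃ (ε' : ℝ) (E' : Equation) (φ : Pt → Pt), InRow E' (Row.row6 ε' (-ρ)) ∧ Equiv E E' φ := by
  obtain ⟨⟨hε, hρ⟩, hadm, hn, ha, hg⟩ := h
  simp only [Row.Admits, Row.n, Row.g] at hadm hn hg
  have ht0 : ∀ t ∈ E.I, t ≠ 0 := by
    rintro t ht rfl
    have := E.g_ne_zero 0 ht
    rw [hg 0 ht, Real.zero_rpow hρ, mul_zero] at this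
    exact this rfl
  constructor
  · obtain ⟨E', φ, hE, ha', hn', hg', hI'⟩ := exists_equiv E (α := 1) (β := 0) (γ := 0) (δ := 1)
      (κ := 1) (h := fun t => ε * t ^ ρ) (Or.inl hn) (by simp) one_ne_zero (by simp)
      (fun t ht => by simp [hg t ht])
    refine ⟨ε, E', φ, ⟨⟨hε, hρ⟩, ?_, hn'.trans hn, ha', fun t _ => by rw [hg']; rfl⟩, hE⟩
    simpa [hI', Row.Admits] using hadm
  -- The inversion t ↦ 1/t has determinant -1, so it reverses the sign of ε along with that of ρ.
  · obtain ⟨E', φ, hE, ha', hn', hg', hI'⟩ := exists_equiv E (α := 0) (β := 1) (γ := 1) (δ := 0)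
      (κ := 1) (h := fun t => -ε * t ^ (-ρ)) (Or.inl hn) (by simp) one_ne_zero
      (fun t ht => by simpa using ht0 t ht)
      (fun t ht => by
        have : (1 / t) ^ (-ρ) = t ^ ρ := by
          rcases hadm with h | ⟨m, rfl, -⟩
          · have := h ht
            rw [one_div, Real.inv_rpow this.le, Real.rpow_neg this.le, inv_inv]
          · rw [← Int.cast_neg, Real.rpow_intCast, Real.rpow_intCast]
            simp
        simp only [zero_mul, one_mul, zero_add, add_zero, hg t ht, this]
        ring)
    refine ⟨-ε, E', φ, ⟨⟨?_, neg_ne_zero.2 hρ⟩, ?_, hn'.trans hn, ha', fun t _ => by rw [hg']; rfl⟩,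
      hE⟩
    · rcases hε with rfl | rfl <;> simp
    · simp only [Row.Admits, hI']
      rcases hadm with h | ⟨m, rfl, -⟩
      · left
        rintro _ ⟨t, ht, rfl⟩
        have : 0 < t := h ht
        simpa using this
      · right
        refine ⟨-m, by simp, Or.inr ?_⟩
        rintro ⟨t, ht, h0⟩
        simp at h0
        exact ht0 t ht h0

/-! ### Completeness of the list of extensions -/

/-- Two solutions of the same first-order linear equation have a quotient with zero derivative. -/
theorem exists_eq_const_mul {I : Set ℝ} (hI : IsOpenInterval I) {g r r' : ℝ → ℝ}
    (hg : ∀ t ∈ I, DifferentiableAt ℝ g t) (hr : ∀ t ∈ I, HasDerivAt r (r' t) t)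
    (hr0 : ∀ t ∈ I, r t ≠ 0) (h : ∀ t ∈ I, deriv g t * r t = g t * r' t) :
    ∃ C, ∀ t ∈ I, g t = C * r t := by
  have hd : ∀ t ∈ I, HasDerivAt (fun t => g t / r t) 0 t := fun t ht => by
    have h1 := (hg t ht).hasDerivAt.div (hr t ht) (hr0 t ht)
    rwa [h t ht, sub_self, zero_div] at h1
  obtain ⟨t₀, ht₀⟩ := hI.2.2
  refine ⟨g t₀ / r t₀, fun t ht => ?_⟩
  have h1 : g t / r t = g t₀ / r t₀ := hI.1.is_const_of_deriv_eq_zero hI.2.1.isPreconnected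
    (fun s hs => (hd s hs).differentiableAt.differentiableWithinAt)
    (fun s hs => (hd s hs).deriv) ht ht₀
  rw [← h1, div_mul_cancel₀ _ (hr0 t ht)]

theorem exists_pos_mul {I : Set ℝ} (hI : IsOpenInterval I) {f : ℝ → ℝ} (hf : ContinuousOn f I)
    (h0 : ∀ t ∈ I, f t ≠ 0) : ∃ s : ℝ, (s = 1 ∨ s = -1) ∧ ∀ t ∈ I, 0 < s * f t := by
  have hoc := (hI.2.1.isPreconnected.image f hf).ordConnected
  by_cases hpos : ∀ t ∈ I, 0 < f t
  · exact ⟨1, Or.inl rfl, fun t ht => by rw [one_mul]; exact hpos t ht⟩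
  · push Not at hpos
    obtain ⟨t₁, ht₁, h1⟩ := hpos
    refine ⟨-1, Or.inr rfl, fun t ht => ?_⟩
    by_contra h2
    have h3 : 0 ≤ f t := by linarith
    obtain ⟨t₂, ht₂, h4⟩ := hoc.out ⟨t₁, ht₁, rfl⟩ ⟨t, ht, rfl⟩ ⟨h1, h3⟩
    exact h0 t₂ ht₂ h4

/-! ### Reduction to canonical forms -/

section Canonical

variable {E : Equation} {α β γ δ : ℝ}

/-- An equation whose function `g` solves the same differential equation as the transformed
function of a row is equivalent to an equation of this row. -/
theorem exists_inRow (F : ℝ → Row) {P : ℝ → ℝ} {k : ℝ} (hn : E.n = 2 ∨ γ = 0 ∧ δ = 1)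
    (hΔ : α * δ - β * γ ≠ 0) (hG : ∀ t ∈ E.I, γ * t + δ ≠ 0)
    (hF : ∀ ε, (ε = 1 ∨ ε = -1) → (F ε).Valid ∧
      (F ε).Admits ((fun t => (α * t + β) / (γ * t + δ)) '' E.I) ∧ (F ε).n = E.n ∧
      ∀ s, (F ε).g s = ε * (F 1).g s)
    (hne : ∀ t ∈ E.I, (F 1).g ((α * t + β) / (γ * t + δ)) ≠ 0)
    (hP : ∀ t ∈ E.I, P t ≠ 0 ∧ P t * deriv E.g t = k * E.g t)
    (hcond : ∀ t ∈ E.I, k * ((F 1).quad 0 * (α * t + β) ^ 2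
      + (F 1).quad 1 * (α * t + β) * (γ * t + δ) + (F 1).quad 2 * (γ * t + δ) ^ 2)
      = (F 1).rate * (α * δ - β * γ) * P t) :
    ∃ (R : Row) (E' : Equation) (φ : Pt → Pt), InRow E' R ∧ Equiv E E' φ := by
  have hm : ∀ t ∈ E.I, HasDerivAt (fun t : ℝ => (α * t + β) / (γ * t + δ))
      ((α * δ - β * γ) / (γ * t + δ) ^ 2) t := fun t ht => by
    have h1 := (((hasDerivAt_id t).const_mul α).add_const β).div
      (((hasDerivAt_id t).const_mul γ).add_const δ) (hG t ht)
    refine h1.congr_deriv ?_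
    simp only [id]
    congr 1
    ring
  have hrow := fun t ht => Row.hasDerivAt_g (hF 1 (Or.inl rfl)).1 (hne t ht)
  -- By `hcond`, g and the row function composed with the Möbius map have the same logarithmic
  -- derivative.
  obtain ⟨C, hC⟩ := exists_eq_const_mul E.interval_I (g := E.g)
    (r := fun t => (F 1).g ((α * t + β) / (γ * t + δ)))
    (r' := fun t => deriv (F 1).g ((α * t + β) / (γ * t + δ))
      * ((α * δ - β * γ) / (γ * t + δ) ^ 2))
    (fun t ht => E.differentiableAt_g ht)
    (fun t ht => by
      obtain ⟨-, g', hg', -⟩ := hrow t ht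
      have h1 := hg'.comp t (hm t ht)
      rwa [← hg'.deriv] at h1) hne
    (fun t ht => by
      obtain ⟨hQ, g', hg', hode⟩ := hrow t ht
      obtain ⟨hP0, hPg⟩ := hP t ht
      have hc := hcond t ht
      have hGt := hG t ht
      simp only [hg'.deriv]
      generalize hmt : (α * t + β) / (γ * t + δ) = m at hQ hode ⊢
      rw [div_eq_iff hGt] at hmt
      rw [hmt] at hc
      generalize γ * t + δ = G at hGt hmt hc ⊢
      generalize α * δ - β * γ = D at hc ⊢
      field_simp
      refine mul_left_cancel₀ (mul_ne_zero hP0 hQ) ?_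
      linear_combination (((F 1).quad 0 * m ^ 2 + (F 1).quad 1 * m + (F 1).quad 2)
        * (F 1).g m * G ^ 2) * hPg + E.g t * (F 1).g m * hc - (E.g t * D * P t) * hode)
  have hC0 : C ≠ 0 := by
    rintro rfl
    obtain ⟨t, ht⟩ := E.interval_I.2.2
    exact E.g_ne_zero t ht (by rw [hC t ht, zero_mul])
  -- Matching g requires κ² = ε(αδ - βγ)/C; the sign ε makes this positive.
  obtain ⟨ε, hε, hpos⟩ : ∃ ε : ℝ, (ε = 1 ∨ ε = -1) ∧ 0 < ε * ((α * δ - β * γ) / C) := by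
    have hne := div_ne_zero hΔ hC0
    rcases lt_or_gt_of_ne hne with h | h
    · exact ⟨-1, Or.inr rfl, by linarith⟩
    · exact ⟨1, Or.inl rfl, by linarith⟩
  obtain ⟨hv, ha, hn', hg⟩ := hF ε hε
  obtain ⟨E', φ, hE, ha', hnE, hgE, hIE⟩ := exists_equiv E (h := (F ε).g)
    (κ := √(ε * ((α * δ - β * γ) / C))) hn hΔ (Real.sqrt_pos.2 hpos).ne' hG (fun t ht => by
      rw [Real.sq_sqrt hpos.le, hg, hC t ht]
      field_simp)
  exact ⟨F ε, E', φ, ⟨hv, by rw [hIE]; exact ha, hnE.trans hn'.symm, ha', fun t _ => by rw [hgE]⟩,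
    hE⟩

/-- Rescaling t by C itself, whatever its sign, normalises g to 1; hence no ε in these rows. -/
theorem exists_inRow_of_const {C : ℝ} (hC : ∀ t ∈ E.I, E.g t = C) :
    ∃ (R : Row) (E' : Equation) (φ : Pt → Pt), InRow E' R ∧ Equiv E E' φ := by
  have hC0 : C ≠ 0 := by
    obtain ⟨t, ht⟩ := E.interval_I.2.2
    exact hC t ht ▸ E.g_ne_zero t ht
  obtain ⟨E', φ, hE, ha, hnE, hgE, -⟩ := exists_equiv E (α := C) (β := 0) (γ := 0) (δ := 1)
    (κ := 1) (h := fun _ => 1) (Or.inr ⟨rfl, rfl⟩) (by simpa using hC0) one_ne_zero (by simp)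
    (fun t ht => by rw [hC t ht]; simp [hC0])
  by_cases hn : E.n = 2
  · exact ⟨Row.row9, E', φ, ⟨trivial, trivial, hnE.trans hn, ha, fun t _ => by rw [hgE]; rfl⟩, hE⟩
  · exact ⟨Row.row4 E.n, E', φ, ⟨hn, trivial, hnE, ha, fun t _ => by rw [hgE]; rfl⟩, hE⟩

/-- The rows with exponential functions `g`. -/
noncomputable def expRow (n ε : ℝ) : Row := open Classical in if n = 2 then Row.row7 ε else Row.row3 n ε

/-- The rows with power functions `g`. -/
noncomputable def powRow (n ρ ε : ℝ) : Row := open Classical in if n = 2 then Row.row6 ε ρ else Row.row2 n ε ρ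

theorem expRow_spec (n ε : ℝ) : (expRow n ε).n = n ∧ (∀ I, (expRow n ε).Admits I) ∧
    ((ε = 1 ∨ ε = -1) → (expRow n ε).Valid) ∧ (expRow n ε).g = (fun t => ε * Real.exp t) ∧
    (expRow n ε).quad = ![0, 0, 1] ∧ (expRow n ε).rate = 1 := by
  by_cases hn : n = 2
  · rw [expRow, if_pos hn]
    exact ⟨hn.symm, fun _ => trivial, id, rfl, rfl, rfl⟩
  · rw [expRow, if_neg hn]
    exact ⟨rfl, fun _ => trivial, fun h => ⟨hn, h⟩, rfl, rfl, rfl⟩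

theorem powRow_spec (n ρ ε : ℝ) : (powRow n ρ ε).n = n ∧
    (∀ I, PowerRegular ρ I → (powRow n ρ ε).Admits I) ∧
    ((ε = 1 ∨ ε = -1) → ρ ≠ 0 → (powRow n ρ ε).Valid) ∧ (powRow n ρ ε).g = (fun t => ε * t ^ ρ) ∧
    (powRow n ρ ε).quad = ![0, 1, 0] ∧ (powRow n ρ ε).rate = ρ := by
  by_cases hn : n = 2
  · rw [powRow, if_pos hn]
    exact ⟨hn.symm, fun _ => id, fun h h' => ⟨h, h'⟩, rfl, rfl, rfl⟩
  · rw [powRow, if_neg hn]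
    exact ⟨rfl, fun _ => id, fun h h' => ⟨hn, h, h'⟩, rfl, rfl, rfl⟩

theorem exists_inRow_exp {P : ℝ → ℝ} {k : ℝ} (hn : E.n = 2 ∨ γ = 0 ∧ δ = 1)
    (hΔ : α * δ - β * γ ≠ 0) (hG : ∀ t ∈ E.I, γ * t + δ ≠ 0)
    (hP : ∀ t ∈ E.I, P t ≠ 0 ∧ P t * deriv E.g t = k * E.g t)
    (hcond : ∀ t ∈ E.I, k * (γ * t + δ) ^ 2 = (α * δ - β * γ) * P t) :
    ∃ (R : Row) (E' : Equation) (φ : Pt → Pt), InRow E' R ∧ Equiv E E' φ := by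
  refine exists_inRow (expRow E.n) hn hΔ hG (fun ε hε => ?_) (fun t _ => ?_) hP (fun t ht => ?_)
  · obtain ⟨h1, h2, h3, h4, -⟩ := expRow_spec E.n ε
    obtain ⟨-, -, -, h5, -⟩ := expRow_spec E.n 1
    exact ⟨h3 hε, h2 _, h1, fun s => by simp only [h4, h5, one_mul]⟩
  · obtain ⟨-, -, -, h5, -⟩ := expRow_spec E.n 1
    rw [h5]
    exact mul_ne_zero one_ne_zero (Real.exp_ne_zero _)
  · obtain ⟨-, -, -, -, h5, h6⟩ := expRow_spec E.n 1
    rw [h5, h6]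
    simp only [Matrix.cons_val]
    linear_combination hcond t ht

theorem exists_inRow_pow {P : ℝ → ℝ} {k ρ : ℝ} (hn : E.n = 2 ∨ γ = 0 ∧ δ = 1) (hρ : ρ ≠ 0)
    (hΔ : α * δ - β * γ ≠ 0) (hG : ∀ t ∈ E.I, γ * t + δ ≠ 0)
    (hpos : ∀ t ∈ E.I, 0 < (α * t + β) / (γ * t + δ))
    (hP : ∀ t ∈ E.I, P t ≠ 0 ∧ P t * deriv E.g t = k * E.g t)
    (hcond : ∀ t ∈ E.I, k * ((α * t + β) * (γ * t + δ)) = ρ * (α * δ - β * γ) * P t) :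
    ∃ (R : Row) (E' : Equation) (φ : Pt → Pt), InRow E' R ∧ Equiv E E' φ := by
  refine exists_inRow (powRow E.n ρ) hn hΔ hG (fun ε hε => ?_) (fun t ht => ?_) hP (fun t ht => ?_)
  · obtain ⟨h1, h2, h3, h4, -⟩ := powRow_spec E.n ρ ε
    obtain ⟨-, -, -, h5, -⟩ := powRow_spec E.n ρ 1
    refine ⟨h3 hε hρ, h2 _ (Or.inl ?_), h1, fun s => by simp only [h4, h5, one_mul]⟩
    rintro _ ⟨t, ht, rfl⟩
    exact hpos t ht
  · obtain ⟨-, -, -, h5, -⟩ := powRow_spec E.n ρ 1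
    rw [h5]
    exact mul_ne_zero one_ne_zero (Real.rpow_pos_of_pos (hpos t ht) _).ne'
  · obtain ⟨-, -, -, -, h5, h6⟩ := powRow_spec E.n ρ 1
    rw [h5, h6]
    simp only [Matrix.cons_val]
    linear_combination hcond t ht

/-- For b = 0, g is an exponential with rate k/c, absorbed into t. Otherwise g is a constant times
|bt + c|^(k/b), and a sign makes the new time variable positive. -/
theorem exists_inRow_of_affine {b c k : ℝ} (hk : k ≠ 0)
    (hP : ∀ t ∈ E.I, b * t + c ≠ 0 ∧ (b * t + c) * deriv E.g t = k * E.g t) :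
    ∃ (R : Row) (E' : Equation) (φ : Pt → Pt), InRow E' R ∧ Equiv E E' φ := by
  by_cases hb : b = 0
  · subst hb
    have hc : c ≠ 0 := by
      obtain ⟨t, ht⟩ := E.interval_I.2.2
      simpa using (hP t ht).1
    refine exists_inRow_exp (α := k / c) (β := 0) (γ := 0) (δ := 1) (k := k) (Or.inr ⟨rfl, rfl⟩)
      (by simp [hk, hc]) (by simp) hP (fun t _ => ?_)
    field_simp
    ring
  · obtain ⟨s, hs, hpos⟩ := exists_pos_mul E.interval_I (f := fun t => b * t + c) (by fun_prop)
      fun t ht => (hP t ht).1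
    have hs0 : s ≠ 0 := by rcases hs with rfl | rfl <;> norm_num
    refine exists_inRow_pow (α := s * b) (β := s * c) (γ := 0) (δ := 1) (k := k) (ρ := k / b)
      (Or.inr ⟨rfl, rfl⟩) (div_ne_zero hk hb) (by simp [hs0, hb]) (by simp) (fun t ht => ?_) hP
      (fun t _ => ?_)
    · have := hpos t ht
      simp only [zero_mul, zero_add, div_one]
      linarith
    · field_simp
      ring

theorem exists_inRow_of_quadratic {a b c k : ℝ} (hn : E.n = 2) (ha : a ≠ 0) (hk : k ≠ 0)
    (hP : ∀ t ∈ E.I, a * t ^ 2 + b * t + c ≠ 0 ∧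
      (a * t ^ 2 + b * t + c) * deriv E.g t = k * E.g t) :
    ∃ (R : Row) (E' : Equation) (φ : Pt → Pt), InRow E' R ∧ Equiv E E' φ := by
  rcases lt_trichotomy (b ^ 2 - 4 * a * c) 0 with hD | hD | hD
  -- Complex roots -b/(2a) ± iw: an affine change moves them to ±i, and ρ = k/(2aw).
  · obtain ⟨w, hw, hw2⟩ : ∃ w : ℝ, 0 < w ∧ w ^ 2 = (4 * a * c - b ^ 2) / (4 * a ^ 2) := by
      have h : 0 < (4 * a * c - b ^ 2) / (4 * a ^ 2) := div_pos (by linarith) (by positivity)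
      exact ⟨_, Real.sqrt_pos.2 h, Real.sq_sqrt h.le⟩
    have hw0 := hw.ne'
    have hc : c = a * w ^ 2 + b ^ 2 / (4 * a) := by
      rw [hw2]; field_simp; ring
    refine exists_inRow (fun ε => Row.row8 ε (k / (2 * a * w))) (α := 1 / w)
      (β := b / (2 * a * w)) (γ := 0) (δ := 1) (k := k) (Or.inl hn) (by simp [hw0]) (by simp)
      (fun ε hε => ⟨⟨hε, by positivity⟩, trivial, hn.symm, fun s => by simp [Row.g]⟩)
      (fun t _ => by simp [Row.g, Real.exp_ne_zero]) hP (fun t _ => ?_)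
    simp only [Row.quad, Row.rate, Matrix.cons_val]
    rw [hc]
    field_simp
    ring
  -- A double root is sent to infinity, where τ becomes constant and g exponential.
  · have hc : c = b ^ 2 / (4 * a) := by field_simp; linarith
    have hPt : ∀ t, a * t ^ 2 + b * t + c = a * (1 * t + b / (2 * a)) ^ 2 := fun t => by
      rw [hc]; field_simp; ring
    refine exists_inRow_exp (α := 0) (β := -k / a) (γ := 1) (δ := b / (2 * a)) (k := k) (Or.inl hn)
      (by simp [hk, ha]) (fun t ht h0 => (hP t ht).1 (by rw [hPt, h0]; simp)) hP (fun t _ => ?_)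
    rw [hPt]
    field_simp
    ring
  -- Two real roots are sent to 0 and infinity, with a sign that makes the new time variable
  -- positive; g becomes a power with exponent k/(a(r₁ - r₂)).
  · obtain ⟨w, hw, hw2⟩ : ∃ w : ℝ, 0 < w ∧ w ^ 2 = b ^ 2 - 4 * a * c :=
      ⟨_, Real.sqrt_pos.2 hD, Real.sq_sqrt hD.le⟩
    have hw0 := hw.ne'
    obtain ⟨r₁, hr₁⟩ : ∃ r₁, r₁ = (-b + w) / (2 * a) := ⟨_, rfl⟩
    obtain ⟨r₂, hr₂⟩ : ∃ r₂, r₂ = (-b - w) / (2 * a) := ⟨_, rfl⟩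
    have hc : c = (b ^ 2 - w ^ 2) / (4 * a) := by field_simp; linarith
    have hPt : ∀ t, a * t ^ 2 + b * t + c = a * (t - r₁) * (t - r₂) := fun t => by
      rw [hc, hr₁, hr₂]; field_simp; ring
    have hr : r₁ - r₂ = w / a := by rw [hr₁, hr₂]; field_simp; ring
    have hr0 : r₁ - r₂ ≠ 0 := by rw [hr]; positivity
    have h1 : ∀ t ∈ E.I, t - r₁ ≠ 0 := fun t ht h0 => (hP t ht).1 (by rw [hPt, h0]; simp)
    have h2 : ∀ t ∈ E.I, t - r₂ ≠ 0 := fun t ht h0 => (hP t ht).1 (by rw [hPt, h0]; simp)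
    obtain ⟨s, hs, hpos⟩ := exists_pos_mul E.interval_I (f := fun t => (t - r₁) / (t - r₂))
      (ContinuousOn.div (by fun_prop) (by fun_prop) h2) fun t ht => div_ne_zero (h1 t ht) (h2 t ht)
    have hs0 : s ≠ 0 := by rcases hs with rfl | rfl <;> norm_num
    have hdet : s * -r₂ - -s * r₁ * 1 = s * (r₁ - r₂) := by ring
    refine exists_inRow_pow (α := s) (β := -s * r₁) (γ := 1) (δ := -r₂) (k := k)
      (ρ := k / (a * (r₁ - r₂))) (Or.inl hn) (by positivity) (by rw [hdet]; positivity)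
      (fun t ht => by rw [one_mul, ← sub_eq_add_neg]; exact h2 t ht) (fun t ht => ?_) hP
      (fun t _ => ?_)
    · have := hpos t ht
      rwa [show (s * t + -s * r₁) / (1 * t + -r₂) = s * ((t - r₁) / (t - r₂)) by
        rw [one_mul, ← sub_eq_add_neg]; ring]
    · rw [hdet, hPt]
      field_simp
      ring

/-- An equation with a symmetry outside of the kernel is equivalent to one of the rows. -/
theorem exists_inRow_of_admissible {c : Params} (hc : Admissible E c) (hker : ¬ IsKernel E.n c) :
    ∃ (R : Row) (E' : Equation) (φ : Pt → Pt), InRow E' R ∧ Equiv E E' φ := by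
  obtain ⟨hn, hode⟩ := hc
  by_cases hk : 2 * c 3 - c 1 = 0
  · have hne : ¬ (c 0 = 0 ∧ c 1 = 0 ∧ c 2 = 0) := fun ⟨h0, h1, h2⟩ =>
      hker ⟨⟨h0, h1, h2, by linarith⟩, hn.imp_right And.right⟩
    have hcont : ContinuousOn (deriv E.g) E.I :=
      E.smooth_g.continuousOn_deriv_of_isOpen E.interval_I.1 (by simp)
    -- Here τ g' = 0 with τ ≢ 0. If g' were nonzero at a point, it would be nonzero on a
    -- neighbourhood, and the quadratic τ would vanish there.
    have hd0 : ∀ t ∈ E.I, deriv E.g t = 0 := by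
      intro t ht
      by_contra h0
      have hU : IsOpen (E.I ∩ deriv E.g ⁻¹' {0}ᶜ) :=
        hcont.isOpen_inter_preimage E.interval_I.1 isOpen_compl_singleton
      obtain ⟨e, he, hb⟩ := Metric.isOpen_iff.1 hU t ⟨ht, h0⟩
      rw [Real.ball_eq_Ioo] at hb
      refine hne (quadratic_eq_zero_on (I := Set.Ioo (t - e) (t + e))
        ⟨isOpen_Ioo, Set.ordConnected_Ioo, ⟨t, by linarith, by linarith⟩⟩ fun s hs => ?_)
      have := hode s (hb hs).1
      rw [hk, zero_mul] at this
      exact (mul_eq_zero.1 this).resolve_right (hb hs).2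
    obtain ⟨t₀, ht₀⟩ := E.interval_I.2.2
    refine exists_inRow_of_const (C := E.g t₀) fun t ht => ?_
    exact E.interval_I.1.is_const_of_deriv_eq_zero E.interval_I.2.1.isPreconnected
      (fun s hs => (E.differentiableAt_g hs).differentiableWithinAt) hd0 ht ht₀
  · have hP : ∀ t ∈ E.I, c 0 * t ^ 2 + c 1 * t + c 2 ≠ 0 ∧
        (c 0 * t ^ 2 + c 1 * t + c 2) * deriv E.g t = (2 * c 3 - c 1) * E.g t := fun t ht => by
      refine ⟨fun h0 => ?_, hode t ht⟩
      have := hode t ht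
      rw [h0, zero_mul] at this
      exact mul_ne_zero hk (E.g_ne_zero t ht) this.symm
    by_cases h0 : c 0 = 0
    · refine exists_inRow_of_affine (b := c 1) (c := c 2) hk fun t ht => ?_
      have := hP t ht
      rwa [h0, zero_mul, zero_add] at this
    · exact exists_inRow_of_quadratic (hn.resolve_right fun h => h0 h.1) h0 hk hP

theorem forall_isKernel_iff (E : Equation) : (∀ c, Admissible E c → IsKernel E.n c) ↔
    ¬ ∃ (R : Row) (E' : Equation) (φ : Pt → Pt), InRow E' R ∧ Equiv E E' φ := by
  constructor
  · rintro h ⟨R, E', φ, hR, hE⟩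
    obtain ⟨c, hc, -, -, hne⟩ := hR.exists_admissible hE
    obtain ⟨⟨h0, h1, h2, -⟩, -⟩ := h c hc
    exact hne ⟨h0, h1, h2⟩
  · intro h c hc
    by_contra hker
    exact h (exists_inRow_of_admissible hc hker)

end Canonical

/-! ### The structure of the five-dimensional algebra -/

theorem fderiv_symField (a n : ℝ) (c : Params) (p v : Pt) : fderiv ℝ (symField a n c) p v =
    (fderiv ℝ (tauOf (symField a n c)) p v, fderiv ℝ (xiOf (symField a n c)) p v,
      fderiv ℝ (thetaOf (symField a n c)) p v) := by
  have h : ∀ A B C D E F G, DifferentiableAt ℝ (quad A B C D E F G) p := fun A B C D E F G =>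
    (contDiff_quad A B C D E F G).differentiable (by simp) p
  have h1 : DifferentiableAt ℝ (tauOf (symField a n c)) p := by
    rw [tauOf_symField]; exact h ..
  have h2 : DifferentiableAt ℝ (xiOf (symField a n c)) p := by
    rw [xiOf_symField]; exact h ..
  have h3 : DifferentiableAt ℝ (thetaOf (symField a n c)) p := by
    rw [thetaOf_symField]; exact h ..
  have h4 := h1.hasFDerivAt.prodMk (h2.hasFDerivAt.prodMk h3.hasFDerivAt)
  have h5 : HasFDerivAt (symField a n c) _ p := h4
  rw [h5.fderiv]
  rfl

theorem lieBracket_symField (c d : Params) :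
    VectorField.lieBracket ℝ (symField (1 / 2) 2 c) (symField (1 / 2) 2 d) =
      symField (1 / 2) 2 ![c 1 * d 0 - c 0 * d 1, 2 * (c 2 * d 0 - c 0 * d 2),
        c 2 * d 1 - c 1 * d 2, c 2 * d 0 - c 0 * d 2,
        c 1 * d 4 + c 5 * d 0 + c 4 * d 3 - (c 4 * d 1 + c 0 * d 5 + c 3 * d 4),
        c 2 * d 4 + c 5 * d 3 - (c 4 * d 2 + c 3 * d 5)] := by
  funext p
  simp only [VectorField.lieBracket_eq, fderiv_symField, tauOf_symField, xiOf_symField,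
    thetaOf_symField, fderiv_quad, symField_apply, Prod.mk_sub_mk, Matrix.cons_val, Prod.mk.injEq]
  refine ⟨?_, ?_, ?_⟩ <;> ring

/-- The coefficients of the vector field that corresponds to an element of `sl(2, ℝ) ⋉ 2A₁`. -/
def slParams : SlTwoA1 →ₗ[ℝ] Params where
  toFun z := ![-z.right.1 1 0, -2 * z.right.1 0 0, z.right.1 0 1, -z.right.1 0 0,
    z.left 1, z.left 0]
  map_add' z w := by
    funext i
    fin_cases i <;> simp <;> ring
  map_smul' r z := by
    funext i
    fin_cases i <;> simp
    ring

theorem slParams_apply (z : SlTwoA1) : slParams z = ![-z.right.1 1 0, -2 * z.right.1 0 0,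
    z.right.1 0 1, -z.right.1 0 0, z.left 1, z.left 0] := rfl

theorem sl_apply_one_one (A : LieAlgebra.SpecialLinear.sl (Fin 2) ℝ) : A.1 1 1 = -A.1 0 0 := by
  have h : Matrix.trace A.1 = 0 := A.2
  rw [Matrix.trace_fin_two] at h
  linarith

theorem slParams_injective : Function.Injective slParams := by
  rw [injective_iff_map_eq_zero]
  rintro z hz
  rw [slParams_apply, params_eq_zero_iff] at hz
  simp only [Matrix.cons_val] at hz
  obtain ⟨h0, h1, h2, h3, h4, h5⟩ := hz
  have h11 := sl_apply_one_one z.right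
  refine LieAlgebra.SemiDirectSum.ext ?_ (Subtype.ext ?_)
  · funext i
    fin_cases i
    exacts [h5, h4]
  · ext i j
    fin_cases i <;> fin_cases j
    exacts [neg_eq_zero.1 h3, h2, neg_eq_zero.1 h0, h11.trans h3]

theorem exists_slParams_eq {c : Params} (h : c 1 = 2 * c 3) : ∃ z, slParams z = c := by
  refine ⟨⟨![c 5, c 4], ⟨!![-c 3, c 2; -c 0, c 3], ?_⟩⟩, ?_⟩
  · change Matrix.trace (!![-c 3, c 2; -c 0, c 3] : Matrix (Fin 2) (Fin 2) ℝ) = 0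
    simp [Matrix.trace_fin_two]
  · rw [slParams_apply]
    funext i
    fin_cases i <;> simp [h]

/-- The signs in `slParams` compensate for the sign reversal between matrix commutators and
commutators of vector fields. They are chosen so that the coefficients of ∂_x and t∂_x + ∂_u, in
this order, transform by A itself rather than by its dual. -/
theorem symField_slParams_lie (z w : SlTwoA1) : symField (1 / 2) 2 (slParams ⁅z, w⁆) =
    VectorField.lieBracket ℝ (symField (1 / 2) 2 (slParams z)) (symField (1 / 2) 2 (slParams w)) := by
  rw [lieBracket_symField]
  congr 1
  have hz := sl_apply_one_one z.right
  have hw := sl_apply_one_one w.right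
  have hr : (⁅z, w⁆ : SlTwoA1).right.1 = z.right.1 * w.right.1 - w.right.1 * z.right.1 := rfl
  have hl : (⁅z, w⁆ : SlTwoA1).left =
      0 + z.right.1.mulVec w.left - w.right.1.mulVec z.left := rfl
  simp only [slParams_apply, hr, hl]
  funext i
  fin_cases i <;>
    simp [Matrix.mul_apply, Fin.sum_univ_two, hz, hw] <;> ring

theorem InRow.maxAlgebraIso {E : Equation} (h : InRow E Row.row9) (B : Box E) :
    MaxAlgebraIso E B SlTwoA1 := by
  have hn : E.n = 2 := h.2.2.1
  have ha : E.a = 1 / 2 := h.2.2.2.1.trans (by rw [hn])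
  refine ⟨symField (1 / 2) 2 ∘ₗ slParams, fun z hz => ?_, fun V => ?_, fun z w p _ =>
    congrFun (symField_slParams_lie z w) p⟩
  · exact (map_eq_zero_iff _ slParams_injective).1
      (symField_injOn E.interval_I B.interval_X B.interval_J hz)
  · have hadm : ∀ c, Admissible E c ↔ c 1 = 2 * c 3 := fun c => by
      rw [← h.mem_span_iff, Row.mem_span_params_iff h.1]
      simp [Row.n, Row.rate, Row.quad]
      constructor <;> intro h <;> linarith
    rw [isLieSymmetry_iff, ha, hn]
    constructor
    · rintro ⟨c, hc, hV⟩
      obtain ⟨z, rfl⟩ := exists_slParams_eq ((hadm c).1 hc)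
      exact ⟨z, hV⟩
    · rintro ⟨z, hV⟩
      exact ⟨slParams z, (hadm _).2 (by rw [slParams_apply]; simp), hV⟩

end BurgersLie

/-! ### The classification theorem -/

open BurgersLie in
theorem mainTheorem2 :
    -- the kernel for n ≠ 2: the symmetries common to all functions g
    (∀ (a n : ℝ) (I X J : Set ℝ) (V : VF), a ≠ 0 → n ≠ 0 → n ≠ 1 → n ≠ 2 →
      IsOpenInterval I → IsOpenInterval X → IsOpenInterval J → PowerRegular n J →
      ((∀ (E : Equation) (B : Box E), E.a = a → E.n = n → E.I = I → B.X = X → B.J = J →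
          IsLieSymmetry E B V) ↔
        ∃ W ∈ spanOf [dx], Set.EqOn V W (I ×ˢ X ×ˢ J))) ∧
    -- the kernel for n = 2
    (∀ (a : ℝ) (I X J : Set ℝ) (V : VF), a ≠ 0 →
      IsOpenInterval I → IsOpenInterval X → IsOpenInterval J →
      ((∀ (E : Equation) (B : Box E), E.a = a → E.n = 2 → E.I = I → B.X = X → B.J = J →
          IsLieSymmetry E B V) ↔
        ∃ W ∈ spanOf [dx, galilei a], Set.EqOn V W (I ×ˢ X ×ˢ J))) ∧
    -- the gauge a = 1 / n
    (∀ E : Equation, ∃ (E' : Equation) (φ : Pt → Pt), UsualEquiv E E' φ ∧ E'.a = 1 / E'.n) ∧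
    -- the maximal algebras of the equations of Rows 2-4 and 6-9
    (∀ (R : Row) (E : Equation), InRow E R → ∀ B : Box E, IsBasisOfMaxAlgebra E B R.basis) ∧
    -- an equation equivalent to one of these has the algebra carried over from its row
    (∀ (R : Row) (E E' : Equation) (φ : Pt → Pt), InRow E' R → Equiv E E' φ →
      ∀ (B : Box E) (V : VF), IsLieSymmetry E B V ↔
        ∃ W ∈ spanOf R.basis, Set.EqOn V (VectorField.pullback ℝ φ W) B.dom) ∧
    -- Row 1: the algebra is the kernel exactly when the equation is not equivalent to such a one
    (∀ E : Equation, E.n ≠ 2 → ∀ B : Box E, IsBasisOfMaxAlgebra E B [dx] ↔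
      ¬ ∃ (R : Row) (E' : Equation) (φ : Pt → Pt), InRow E' R ∧ Equiv E E' φ) ∧
    -- Row 5: the same for n = 2
    (∀ E : Equation, E.n = 2 → ∀ B : Box E, IsBasisOfMaxAlgebra E B [dx, galilei E.a] ↔
      ¬ ∃ (R : Row) (E' : Equation) (φ : Pt → Pt), InRow E' R ∧ Equiv E E' φ) ∧
    -- different rows are inequivalent
    (∀ (R R' : Row) (E E' : Equation) (φ : Pt → Pt), InRow E R → InRow E' R' → Equiv E E' φ →
      R.no = R'.no) ∧
    -- in Row 6 one can set ρ > 0, and one can set ρ < 0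
    (∀ (ε ρ : ℝ) (E : Equation), InRow E (Row.row6 ε ρ) →
      (∃ (ε' ρ' : ℝ) (E' : Equation) (φ : Pt → Pt), 0 < ρ' ∧ InRow E' (Row.row6 ε' ρ') ∧
        Equiv E E' φ) ∧
      (∃ (ε' ρ' : ℝ) (E' : Equation) (φ : Pt → Pt), ρ' < 0 ∧ InRow E' (Row.row6 ε' ρ') ∧
        Equiv E E' φ)) ∧
    -- the structure of the five-dimensional algebra of Row 9
    (∀ E : Equation, InRow E Row.row9 → ∀ B : Box E, MaxAlgebraIso E B SlTwoA1) := by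
  refine ⟨fun a n I X J V ha hn0 hn1 hn2 hI hX hJ hn => ?_, fun a I X J V ha hI hX hJ => ?_,
    exists_gauge, fun R E h => h.isBasis, fun R E E' φ hR h => hR.isLieSymmetry_iff_pullback h,
    fun E hn B => ?_, fun E hn B => ?_, fun R R' E E' φ => InRow.no_eq, fun ε ρ E h => ?_,
    fun E h => h.maxAlgebraIso⟩
  · rw [common_symmetries_iff V ha hn0 hn1 hI hX hJ hn, map_kernel_params a n]
    simp only [spanOf_map, mem_span_kernel hn2]
    exact ⟨fun ⟨c, hc, hV⟩ => ⟨_, ⟨c, hc, rfl⟩, hV⟩,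
      fun ⟨_, ⟨c, hc, hW⟩, hV⟩ => ⟨c, hc, hW ▸ hV⟩⟩
  · rw [common_symmetries_iff V ha two_ne_zero (by norm_num) hI hX hJ
      (Or.inr ⟨2, by norm_num, Or.inl (by norm_num)⟩), map_kernel_params_two ha 2]
    simp only [spanOf_map, mem_span_kernel_two ha]
    exact ⟨fun ⟨c, hc, hV⟩ => ⟨_, ⟨c, hc, rfl⟩, hV⟩,
      fun ⟨_, ⟨c, hc, hW⟩, hV⟩ => ⟨c, hc, hW ▸ hV⟩⟩
  · rw [map_kernel_params E.a E.n,
      isBasis_kernel_iff B linearIndependent_kernel (mem_span_kernel hn), forall_isKernel_iff]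
  · rw [map_kernel_params_two E.a_ne_zero E.n,
      isBasis_kernel_iff B (linearIndependent_kernel_two E.a_ne_zero)
        (fun c => by rw [hn]; exact mem_span_kernel_two E.a_ne_zero c), forall_isKernel_iff]
  · obtain ⟨⟨ε₁, E₁, φ₁, h₁, e₁⟩, ε₂, E₂, φ₂, h₂, e₂⟩ := h.exists_equiv_row6
    rcases lt_or_gt_of_ne h.1.2 with hρ | hρ
    · exact ⟨⟨ε₂, -ρ, E₂, φ₂, neg_pos.2 hρ, h₂, e₂⟩, ε₁, ρ, E₁, φ₁, hρ, h₁, e₁⟩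
    · exact ⟨⟨ε₁, ρ, E₁, φ₁, hρ, h₁, e₁⟩, ε₂, -ρ, E₂, φ₂, neg_neg_iff_pos.2 hρ, h₂, e₂⟩
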